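/- Let $a,b\in\mathbb R$ with $ab=0$. Let $\mathbb R^{1|1}$ be the smooth superdomain with even coordinate $t$ and odd coordinate $\tau$, and let $(t_1,t_2,\tau_1,\tau_2)$ be the coordinates of $\mathbb R^{1|1}\times\mathbb R^{1|1}=\mathbb R^{2|2}$. There is exactly one morphism of supermanifolds $\mu=\mu_{a,b}:\mathbb R^{1|1}\times\mathbb R^{1|1}\to\mathbb R^{1|1}$ (a continuous map $\widetilde\mu$ of the bodies together with a morphism $\mu^*$ of sheaves of $\mathbb Z/2$-graded $\mathbb R$-algebras) such that $$\widetilde\mu(t_1,t_2)=t_1+t_2,\qquad \mu^*(t)=t_1+t_2+a\,\tau_1\tau_2,\qquad \mu^*(\tau)=\tau_1+e^{bt_1}\tau_2 ,$$ and the following hold. (i) There exists a unique Lie supergroup structure on $\mathbb R^{1|1}$ (multiplication $\mathbb R^{1|1}\times\mathbb R^{1|1}\to\mathbb R^{1|1}$, unit $\mathrm{pt}\to\mathbb R^{1|1}$ and inversion $\mathbb R^{1|1}\to\mathbb R^{1|1}$ satisfying the group axioms as identities of morphisms) whose multiplication morphism is $\mu_{a,b}$. (ii) Put $D_0=\partial_t+b\,\tau\partial_\tau$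 and $D_1=\partial_\tau+a\,\tau\partial_t$. Then $D_0$ is an even and $D_1$ an odd vector field on $\mathbb R^{1|1}$, they are linearly independent over $\mathbb R$, and a (not necessarily homogeneous) vector field $Z$ on $\mathbb R^{1|1}$ is right invariant, i.e. satisfies $\mu^*\circ Z=(Z\otimes\mathrm{id})\circ\mu^*$, if and only if $Z\in\mathbb R D_0\oplus\mathbb R D_1$. Here $Z\otimes\mathrm{id}$ is the vector field on $\mathbb R^{1|1}\times\mathbb R^{1|1}$ that acts as $Z$ on superfunctions of the first factor and annihilates superfunctions of the second factor. The supercommutators $[X,Y]=XY-(-1)^{|X||Y|}YX$ are $$[D_0,D_0]=0,\qquad [D_0,D_1]=-b\,D_1,\qquad [D_1,D_1]=2a\,D_0 .$$ -/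

import Mathlib

open TopologicalSpace
open scoped Manifold ContDiff TensorProduct

noncomputable section

/-- The superdomain `ℝ^{m|n}`, recorded by its even and odd dimensions. -/
structure SuperDomain where
  even : ℕ
  odd : ℕ

namespace SuperDomain

/-- The body `ℝ^m` of `ℝ^{m|n}`. -/
abbrev Body (d : SuperDomain) : Type := Fin d.even → ℝ

/-- Smooth real functions on an open subset of the body. -/
abbrev Smooth {d : SuperDomain} (U : Opens d.Body) : Type :=
  C^∞⟮𝓘(ℝ, d.Body), U; 𝓘(ℝ, ℝ), ℝ⟯

/-- The Grassmann algebra on the odd coordinates of `ℝ^{m|n}`. -/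
abbrev Grassmann (d : SuperDomain) : Type := ExteriorAlgebra ℝ (Fin d.odd → ℝ)

/-- The structure sheaf of `ℝ^{m|n}`: the superfunctions `C^∞(U) ⊗ Λ(τ_1, …, τ_n)` on an open
subset `U` of the body. -/
abbrev O {d : SuperDomain} (U : Opens d.Body) : Type := Smooth U ⊗[ℝ] Grassmann d

/-- The homogeneous superfunctions of parity `i` on `U`. -/
def parity {d : SuperDomain} (U : Opens d.Body) (i : ZMod 2) : Submodule ℝ (O U) :=
  LinearMap.range (LinearMap.lTensor (Smooth U)
    (CliffordAlgebra.evenOdd (0 : QuadraticForm ℝ (Fin d.odd → ℝ)) i).subtype)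

/-- The preimage of an open subset under a continuous map of bodies. -/
def preim {d e : SuperDomain} (φ : C(d.Body, e.Body)) (V : Opens e.Body) : Opens d.Body :=
  ⟨φ ⁻¹' V, V.isOpen.preimage φ.continuous⟩

theorem preim_mono {d e : SuperDomain} (φ : C(d.Body, e.Body)) {V W : Opens e.Body} (h : V ≤ W) :
    preim φ V ≤ preim φ W := fun _ hx => h hx

/-! ### Smooth functions and their pull-backs -/

/-- Pull-back of smooth functions along a smooth map of bodies carrying `U` into `V`. -/
def smoothPull {d e : SuperDomain} (φ : d.Body → e.Body) (hφ : ContDiff ℝ ∞ φ)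
    (V : Opens e.Body) (U : Opens d.Body) (h : ∀ x ∈ U, φ x ∈ V) : Smooth V →ₐ[ℝ] Smooth U where
  toFun f := ⟨fun x => f ⟨φ x, h x x.2⟩, by
    refine f.contMDiff.comp (g := f) (f := fun x : U => (⟨φ x, h x x.2⟩ : V)) ?_
    rw [← ContMDiff.subtypeVal_comp_iff]
    exact hφ.contMDiff.comp contMDiff_subtype_val⟩
  map_one' := rfl
  map_mul' _ _ := rfl
  map_zero' := rfl
  map_add' _ _ := rfl
  commutes' _ := rfl

/-- The restriction map of the structure sheaf. -/
def res {d : SuperDomain} {U V : Opens d.Body} (h : U ≤ V) : O V →ₐ[ℝ] O U :=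
  Algebra.TensorProduct.map (smoothPull id contDiff_id V U h) (AlgHom.id ℝ (Grassmann d))

/-- A smooth function on the body, as an even superfunction on `U`. -/
def ofSmooth {d : SuperDomain} (f : d.Body → ℝ) (hf : ContDiff ℝ ∞ f) (U : Opens d.Body) : O U :=
  (⟨fun x => f x, hf.contMDiff.comp contMDiff_subtype_val⟩ : Smooth U) ⊗ₜ[ℝ] (1 : Grassmann d)

/-- The even coordinate `t_i` as a superfunction on `U`. -/
def evenCoord {d : SuperDomain} (U : Opens d.Body) (i : Fin d.even) : O U :=
  ofSmooth (fun x => x i) (contDiff_apply ℝ ℝ i) U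

/-- The odd coordinate `τ_j` as a superfunction on `U`. -/
def oddCoord {d : SuperDomain} (U : Opens d.Body) (j : Fin d.odd) : O U :=
  (1 : Smooth U) ⊗ₜ[ℝ] ExteriorAlgebra.ι ℝ (Pi.single j (1 : ℝ))

/-! ### Morphisms -/

/-- A morphism of superdomains: a continuous map of the bodies together with a morphism of sheaves
of `ℤ/2`-graded `ℝ`-algebras over it. -/
@[ext]
structure Hom (d e : SuperDomain) where
  base : C(d.Body, e.Body)
  pull : ∀ V : Opens e.Body, O V →ₐ[ℝ] O (preim base V)
  pull_parity : ∀ (V : Opens e.Body) (i : ZMod 2) (f : O V),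
    f ∈ parity V i → pull V f ∈ parity (preim base V) i
  pull_res : ∀ (V W : Opens e.Body) (h : V ≤ W) (f : O W),
    pull V (res h f) = res (preim_mono base h) (pull W f)

/-- `d ⟶ₛ e` is the set of morphisms from `d` to `e`. -/
infixr:10 " ⟶ₛ " => Hom

/-- The identity morphism. -/
def Hom.id (d : SuperDomain) : Hom d d where
  base := ContinuousMap.id d.Body
  pull V := AlgHom.id ℝ (O V)
  pull_parity _ _ _ h := h
  pull_res _ _ _ _ := rfl

/-- The composition of morphisms, `(ψ ∘ φ)^* = φ^* ∘ ψ^*`. -/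
def Hom.comp {d e k : SuperDomain} (φ : Hom d e) (ψ : Hom e k) : Hom d k where
  base := ψ.base.comp φ.base
  pull V := (φ.pull (preim ψ.base V)).comp (ψ.pull V)
  pull_parity V i f h := φ.pull_parity (preim ψ.base V) i (ψ.pull V f) (ψ.pull_parity V i f h)
  pull_res V W h f := by
    have := φ.pull_res (preim ψ.base V) (preim ψ.base W) (preim_mono ψ.base h) (ψ.pull W f)
    rw [← ψ.pull_res V W h] at this
    exact this

/-- `φ ⋙ₛ ψ` is the composite `ψ ∘ φ`. -/
infixr:80 " ⋙ₛ " => Hom.comp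

/-- The homomorphism of Grassmann algebras with `τ_j ↦ τ_{κ j}`. -/
def grassmannMap {d e : SuperDomain} (κ : Fin e.odd → Fin d.odd) : Grassmann e →ₐ[ℝ] Grassmann d :=
  ExteriorAlgebra.map ((Pi.basisFun ℝ (Fin e.odd)).constr ℝ fun j => Pi.single (κ j) (1 : ℝ))

theorem map_evenOdd_le {M N : Type} [AddCommGroup M] [Module ℝ M] [AddCommGroup N] [Module ℝ N]
    (f : M →ₗ[ℝ] N) (i : ZMod 2) (x : ExteriorAlgebra ℝ M)
    (hx : x ∈ CliffordAlgebra.evenOdd (0 : QuadraticForm ℝ M) i) :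
    ExteriorAlgebra.map f x ∈ CliffordAlgebra.evenOdd (0 : QuadraticForm ℝ N) i := by
  have hle : (CliffordAlgebra.evenOdd (0 : QuadraticForm ℝ M) i).map
      (ExteriorAlgebra.map f).toLinearMap ≤ CliffordAlgebra.evenOdd (0 : QuadraticForm ℝ N) i := by
    rw [CliffordAlgebra.evenOdd, Submodule.map_iSup]
    refine iSup_le fun j => ?_
    rw [Submodule.map_pow]
    refine le_trans (pow_le_pow_left' ?_ _)
      (le_iSup (fun k : { n : ℕ // ↑n = i } =>
        LinearMap.range (CliffordAlgebra.ι (0 : QuadraticForm ℝ N)) ^ (k : ℕ)) j)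
    rintro _ ⟨_, ⟨m, rfl⟩, rfl⟩
    exact ⟨f m, (ExteriorAlgebra.map_apply_ι f m).symm⟩
  exact hle ⟨x, hx, rfl⟩

/-- The morphism `ℝ^{m|n} → ℝ^{p|q}` pulling the coordinates back to coordinates,
`t_i ↦ t_{ι i}` and `τ_j ↦ τ_{κ j}`. -/
def coordMap {d e : SuperDomain} (ι : Fin e.even → Fin d.even) (κ : Fin e.odd → Fin d.odd) :
    d ⟶ₛ e where
  base := ⟨fun x i => x (ι i), by fun_prop⟩
  pull V := Algebra.TensorProduct.map
    (smoothPull (fun x i => x (ι i)) (by fun_prop) V _ fun _ h => h) (grassmannMap κ)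
  pull_parity V i f := by
    rintro ⟨g, rfl⟩
    induction g using TensorProduct.induction_on with
    | zero => simp
    | add x y hx hy => rw [map_add, map_add]; exact add_mem hx hy
    | tmul s x => exact ⟨smoothPull (fun x i => x (ι i)) (by fun_prop) V _ (fun _ h => h) s ⊗ₜ[ℝ]
        ⟨grassmannMap κ x, by rw [grassmannMap]; exact map_evenOdd_le _ i _ x.2⟩, rfl⟩
  pull_res V W h f := by
    induction f using TensorProduct.induction_on with
    | zero => simp
    | add x y hx hy => simp only [map_add, hx, hy]
    | tmul s x => rfl

/-- The point `ℝ^{0|0}`. -/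
abbrev point : SuperDomain := ⟨0, 0⟩

/-- The morphism to the point. -/
def toPoint (d : SuperDomain) : d ⟶ₛ point := coordMap Fin.elim0 Fin.elim0

/-- The product `ℝ^{m|n} × ℝ^{p|q} = ℝ^{m+p|n+q}`. -/
abbrev prod (d e : SuperDomain) : SuperDomain := ⟨d.even + e.even, d.odd + e.odd⟩

/-- The first projection of the product. -/
def fst (d e : SuperDomain) : prod d e ⟶ₛ d := coordMap (Fin.castAdd e.even) (Fin.castAdd e.odd)

/-- The second projection of the product. -/
def snd (d e : SuperDomain) : prod d e ⟶ₛ e := coordMap (Fin.natAdd d.even) (Fin.natAdd d.odd)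

/-- `h` is the morphism `(x, y) : T → d × e`, the unique one with components `x` and `y`. -/
def IsPair {T d e : SuperDomain} (x : T ⟶ₛ d) (y : T ⟶ₛ e) (h : T ⟶ₛ prod d e) : Prop :=
  (h ⋙ₛ fst d e = x ∧ h ⋙ₛ snd d e = y) ∧
    ∀ h' : T ⟶ₛ prod d e, h' ⋙ₛ fst d e = x → h' ⋙ₛ snd d e = y → h' = h

/-- The relation `μ ∘ (x, y) = z` for morphisms `x, y, z : T → G`. -/
def MulEq {G T : SuperDomain} (μ : prod G G ⟶ₛ G) (x y z : T ⟶ₛ G) : Prop :=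
  ∃ h : T ⟶ₛ prod G G, IsPair x y h ∧ h ⋙ₛ μ = z

/-- A Lie supergroup structure on the superdomain `G`: a multiplication morphism, a unit
`pt → G` and an inversion satisfying the group axioms as identities of morphisms. Associativity
is the identity `(x y) z = x (y z)` for the three projections `x, y, z` of `(G × G) × G`. -/
@[ext]
structure LieSupergroup (G : SuperDomain) where
  mul : prod G G ⟶ₛ G
  one : point ⟶ₛ G
  inv : G ⟶ₛ G
  assoc : ∃ xy yz xyz : prod (prod G G) G ⟶ₛ G,
    MulEq mul (fst (prod G G) G ⋙ₛ fst G G) (fst (prod G G) G ⋙ₛ snd G G) xy ∧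
    MulEq mul (fst (prod G G) G ⋙ₛ snd G G) (snd (prod G G) G) yz ∧
    MulEq mul xy (snd (prod G G) G) xyz ∧
    MulEq mul (fst (prod G G) G ⋙ₛ fst G G) yz xyz
  one_mul : MulEq mul (toPoint G ⋙ₛ one) (Hom.id G) (Hom.id G)
  mul_one : MulEq mul (Hom.id G) (toPoint G ⋙ₛ one) (Hom.id G)
  inv_mul : MulEq mul inv (Hom.id G) (toPoint G ⋙ₛ one)
  mul_inv : MulEq mul (Hom.id G) inv (toPoint G ⋙ₛ one)

/-! ### Vector fields -/

/-- The `ℝ`-linear endomorphisms of the structure sheaf of `ℝ^{m|n}`. -/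
def SheafEnd (d : SuperDomain) : Subalgebra ℝ (∀ U : Opens d.Body, Module.End ℝ (O U)) where
  carrier := {X | ∀ (U V : Opens d.Body) (h : U ≤ V) (f : O V), X U (res h f) = res h (X V f)}
  mul_mem' hX hY U V h f := by
    simp only [Pi.mul_apply, Module.End.mul_apply, hY U V h, hX U V h]
  add_mem' hX hY U V h f := by
    simp only [Pi.add_apply, LinearMap.add_apply, hX U V h, hY U V h, map_add]
  algebraMap_mem' r U V h f := by
    simp only [Pi.algebraMap_apply, Module.algebraMap_end_apply, map_smul]

/-- The Koszul sign `(-1)^{i j}`. -/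
def koszul (i j : ZMod 2) : ℝ := if i = 1 ∧ j = 1 then -1 else 1

/-- The homogeneous vector fields of parity `i` on `ℝ^{m|n}`: the sheaf endomorphisms `X` of
parity `i` with `X (f g) = X f · g + (-1)^{i |f|} f · X g`. -/
def homVectorFields (d : SuperDomain) (i : ZMod 2) : Submodule ℝ (SheafEnd d) where
  carrier := {X | ∀ (U : Opens d.Body) (j : ZMod 2) (f : O U), f ∈ parity U j →
    X.1 U f ∈ parity U (i + j) ∧
      ∀ g : O U, X.1 U (f * g) = X.1 U f * g + koszul i j • (f * X.1 U g)}
  zero_mem' U j f _ := ⟨zero_mem _, fun g => by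
    change (0 : O U) = 0 * g + koszul i j • (f * 0)
    simp⟩
  add_mem' {X Y} hX hY U j f hf := ⟨add_mem (hX U j f hf).1 (hY U j f hf).1, fun g => by
    change X.1 U (f * g) + Y.1 U (f * g) =
      (X.1 U f + Y.1 U f) * g + koszul i j • (f * (X.1 U g + Y.1 U g))
    rw [(hX U j f hf).2, (hY U j f hf).2, add_mul, mul_add, smul_add]
    abel⟩
  smul_mem' c X hX U j f hf := ⟨Submodule.smul_mem _ c (hX U j f hf).1, fun g => by
    change c • X.1 U (f * g) = (c • X.1 U f) * g + koszul i j • (f * (c • X.1 U g))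
    rw [(hX U j f hf).2, smul_add, smul_mul_assoc, mul_smul_comm, smul_comm c]⟩

/-- The vector fields on `ℝ^{m|n}`, i.e. the sums of an even and an odd vector field. -/
def vectorFields (d : SuperDomain) : Submodule ℝ (SheafEnd d) :=
  homVectorFields d 0 ⊔ homVectorFields d 1

/-- The supercommutator `X Y - (-1)^{i j} Y X` of vector fields of parities `i` and `j`. -/
def superBracket {d : SuperDomain} (i j : ZMod 2) (X Y : SheafEnd d) : SheafEnd d :=
  X * Y + (-koszul i j) • (Y * X)

/-- Extension by zero of a smooth function on `U`. -/
def ext0 {d : SuperDomain} {U : Opens d.Body} (f : Smooth U) : d.Body → ℝ :=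
  Function.extend Subtype.val f 0

theorem ext0_apply {d : SuperDomain} {U : Opens d.Body} (f : Smooth U) (x : U) :
    ext0 f x = f x := Subtype.val_injective.extend_apply _ _ _

theorem contDiffAt_ext0 {d : SuperDomain} {U : Opens d.Body} (f : Smooth U) (x : U) :
    ContDiffAt ℝ ∞ (ext0 f) x := by
  rw [← contMDiffAt_iff_contDiffAt, ← contMDiffAt_subtype_iff]
  have : (fun x : U => ext0 f x) = f := funext (ext0_apply f)
  rw [this]
  exact f.contMDiff x

/-- The classical partial derivative `∂/∂t_i` on smooth functions. -/
def smoothPartial {d : SuperDomain} (i : Fin d.even) (U : Opens d.Body) :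
    Smooth U →ₗ[ℝ] Smooth U where
  toFun f := ⟨fun x => fderiv ℝ (ext0 f) x (Pi.single i 1), fun x => by
    rw [contMDiffAt_subtype_iff (f := fun y => fderiv ℝ (ext0 f) y (Pi.single i 1)),
      contMDiffAt_iff_contDiffAt]
    exact ((contDiffAt_ext0 f x).fderiv_right (m := ∞) (by simp)).clm_apply contDiffAt_const⟩
  map_add' f g := by
    ext x
    have h : ext0 (f + g) =ᶠ[nhds (x : d.Body)] ext0 f + ext0 g := by
      filter_upwards [U.isOpen.mem_nhds x.2] with y hy
      simpa using (ext0_apply (f + g) ⟨y, hy⟩).trans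
        (congrArg₂ (· + ·) (ext0_apply f ⟨y, hy⟩).symm (ext0_apply g ⟨y, hy⟩).symm)
    change fderiv ℝ (ext0 (f + g)) x _ = fderiv ℝ (ext0 f) x _ + fderiv ℝ (ext0 g) x _
    rw [h.fderiv_eq, fderiv_add ((contDiffAt_ext0 f x).differentiableAt (by simp))
      ((contDiffAt_ext0 g x).differentiableAt (by simp))]
    rfl
  map_smul' c f := by
    ext x
    have h : ext0 (c • f) =ᶠ[nhds (x : d.Body)] c • ext0 f := by
      filter_upwards [U.isOpen.mem_nhds x.2] with y hy
      simpa using (ext0_apply (c • f) ⟨y, hy⟩).trans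
        (congrArg (c • ·) (ext0_apply f ⟨y, hy⟩).symm)
    change fderiv ℝ (ext0 (c • f)) x _ = c • fderiv ℝ (ext0 f) x _
    rw [h.fderiv_eq, fderiv_const_smul ((contDiffAt_ext0 f x).differentiableAt (by simp))]
    rfl

/-- The coordinate vector field `∂/∂t_i`. -/
def evenPartial {d : SuperDomain} (i : Fin d.even) : SheafEnd d :=
  ⟨fun U => LinearMap.rTensor (Grassmann d) (smoothPartial i U), fun U V h f => by
    induction f using TensorProduct.induction_on with
    | zero => simp
    | add x y hx hy => simp only [map_add, hx, hy]
    | tmul s x =>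
      refine congrArg (· ⊗ₜ[ℝ] x) ?_
      ext y
      have hev : ext0 (smoothPull id contDiff_id V U h s) =ᶠ[nhds (y : d.Body)] ext0 s := by
        filter_upwards [U.isOpen.mem_nhds y.2] with z hz
        exact (ext0_apply (smoothPull id contDiff_id V U h s) ⟨z, hz⟩).trans
          (ext0_apply s ⟨z, h hz⟩).symm
      exact congrArg (fun L : d.Body →L[ℝ] ℝ => L (Pi.single i 1)) hev.fderiv_eq⟩

/-- The coordinate vector field `∂/∂τ_j`, the (left) odd derivative. -/
def oddPartial {d : SuperDomain} (j : Fin d.odd) : SheafEnd d :=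
  ⟨fun U => LinearMap.lTensor (Smooth U)
    (CliffordAlgebra.contractLeft (Q := (0 : QuadraticForm ℝ (Fin d.odd → ℝ)))
      (LinearMap.proj j : (Fin d.odd → ℝ) →ₗ[ℝ] ℝ)), fun U V h f => by
    induction f using TensorProduct.induction_on with
    | zero => simp
    | add x y hx hy => simp only [map_add, hx, hy]
    | tmul s x => rfl⟩

/-- Left multiplication by the odd coordinate `τ_j`. -/
def oddMul {d : SuperDomain} (j : Fin d.odd) : SheafEnd d :=
  ⟨fun U => LinearMap.mulLeft ℝ (oddCoord U j), fun U V h f => by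
    change oddCoord U j * res h f = res h (oddCoord V j * f)
    rw [map_mul]
    congr 1⟩

/-- `W = Z ⊗ id` on `G × G`: the vector field that acts as `Z` on superfunctions of the first
factor and kills the superfunctions of the second factor. -/
def IsTensorId {G : SuperDomain} (Z : SheafEnd G) (W : SheafEnd (prod G G)) : Prop :=
  W ∈ vectorFields (prod G G) ∧ ∀ (V : Opens G.Body) (f : O V),
    W.1 (preim (fst G G).base V) ((fst G G).pull V f) = (fst G G).pull V (Z.1 V f) ∧
    W.1 (preim (snd G G).base V) ((snd G G).pull V f) = 0

/-- `Z` is a right invariant vector field for the multiplication `μ`, that is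
`μ^* ∘ Z = (Z ⊗ id) ∘ μ^*`. -/
def IsRightInvariant {G : SuperDomain} (μ : prod G G ⟶ₛ G) (Z : SheafEnd G) : Prop :=
  Z ∈ vectorFields G ∧ ∃ W : SheafEnd (prod G G), IsTensorId Z W ∧
    ∀ (V : Opens G.Body) (f : O V), μ.pull V (Z.1 V f) = W.1 (preim μ.base V) (μ.pull V f)

/-! ### The superdomain `ℝ^{1|1}` -/

/-- The superdomain `ℝ^{1|1}`, with coordinates `t` and `τ`. -/
abbrev R11 : SuperDomain := ⟨1, 1⟩

/-- `μ` is given by the formulas `μ̃(t₁,t₂) = t₁ + t₂`, `μ^* t = t₁ + t₂ + a τ₁ τ₂` and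
`μ^* τ = τ₁ + e^{b t₁} τ₂`. -/
def IsMu (a b : ℝ) (μ : prod R11 R11 ⟶ₛ R11) : Prop :=
  (∀ x : (prod R11 R11).Body, μ.base x 0 = x 0 + x 1) ∧
  μ.pull ⊤ (evenCoord ⊤ 0) =
    evenCoord _ 0 + evenCoord _ 1 + a • (oddCoord _ 0 * oddCoord _ 1) ∧
  μ.pull ⊤ (oddCoord ⊤ 0) =
    oddCoord _ 0 + ofSmooth (fun x => Real.exp (b * x 0)) (by fun_prop) _ * oddCoord _ 1

/-- `D₀ = ∂_t + b τ ∂_τ`. -/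
def D0 (b : ℝ) : SheafEnd R11 := evenPartial 0 + b • (oddMul 0 * oddPartial 0)

/-- `D₁ = ∂_τ + a τ ∂_t`. -/
def D1 (a : ℝ) : SheafEnd R11 := oddPartial 0 + a • (oddMul 0 * evenPartial 0)

end SuperDomain

end

/-! A morphism into a superdomain amounts to the pull-backs of the coordinates. For uniqueness
(`hom_ext_coord`), Hadamard's lemma at the image `q` of a point writes a smooth function as its
value at `q` plus a combination of the `t_i - q_i`. The pull-backs of these differences have no body
at the given point. A difference of two pull-backs that agree on coordinates therefore takes values
in ever higher powers of the augmentation ideal of the Grassmann algebra, and these powers are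
eventually zero (`eq_zero_of_evenCoord`, `eq_zero_of_coord`). For existence (`exists_hom`), smooth
functions are pulled back by Taylor expansion around the body. Even elements without body start in
degree 2, so with at most three odd coordinates the product of two of them is zero and the first
order expansion is already multiplicative. Three is enough: associativity lives on `ℝ^{3|3}`, and
every other domain in play has fewer odd coordinates.

Pairs `(x, y)` thus exist and are unique, and `μ` becomes an explicit operation on `T`-points
(`mulHom_evenPull`, `mulHom_oddPull`): if `x` has coordinates `(x, ξ)` and `y` has `(y, η)`, the
product has coordinates `x + y + a ξ η` and `ξ + e^{bx} η`. As `ab = 0`, either `a = 0` or `b = 0`,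
and then `e^{bx}` is multiplicative (`expPull_mul`) and the law is associative. The unit is the
point with zero coordinates, the inverse is `(-t, -e^{-bt} τ)`, and the usual group argument gives
uniqueness of both.

For right invariance, the fields given on `ℝ^{2|2}` by the formulas of `D₀` and `D₁` in the first
pair of coordinates are `D₀ ⊗ id` and `D₁ ⊗ id`. Their relatedness along `μ` need only be checked on
coordinates (`related_of_coord`). Conversely, restricting the invariance equation to the slice
(unit, identity), on which `μ` is the identity, expresses `Z t` and `Z τ` through two real numbers,
the values of these functions at the unit (`IsRightInvariant.exists_eq`). The brackets follow from
the relations between `∂_t`, `∂_τ` and multiplication by `τ`. -/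

noncomputable section

/-! ### Signs and parity in the Grassmann algebra -/

namespace ExteriorAlgebra

open CliffordAlgebra (evenOdd involute)

variable {M : Type*} [AddCommGroup M] [Module ℝ M]

/-- A vector passes a product of two vectors at the cost of two signs, which cancel; such products
generate the even part. -/
theorem commute_of_mem_even {x : ExteriorAlgebra ℝ M}
    (hx : x ∈ evenOdd (0 : QuadraticForm ℝ M) 0) (y : ExteriorAlgebra ℝ M) : Commute x y := by
  induction x, hx using CliffordAlgebra.even_induction with
  | algebraMap r => exact Algebra.commutes r y
  | add x z _ _ hx hz => exact hx.add_left hz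
  | ι_mul_ι_mul m₁ m₂ x _ ih =>
    refine Commute.mul_left ?_ ih
    clear ih
    induction y using ExteriorAlgebra.induction with
    | algebraMap r => exact (Algebra.commutes r _).symm
    | ι m =>
      have h₁ := eq_neg_of_add_eq_zero_left (ι_add_mul_swap (R := ℝ) m₂ m)
      have h₂ := eq_neg_of_add_eq_zero_left (ι_add_mul_swap (R := ℝ) m₁ m)
      change ι ℝ m₁ * ι ℝ m₂ * ι ℝ m = ι ℝ m * (ι ℝ m₁ * ι ℝ m₂)
      rw [mul_assoc, h₁, mul_neg, ← mul_assoc, h₂, neg_mul, neg_neg, mul_assoc]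
    | mul a b ha hb => exact ha.mul_right hb
    | add a b ha hb => exact ha.add_right hb

theorem mul_eq_neg_mul_of_mem_odd {x y : ExteriorAlgebra ℝ M}
    (hx : x ∈ evenOdd (0 : QuadraticForm ℝ M) 1) (hy : y ∈ evenOdd (0 : QuadraticForm ℝ M) 1) :
    x * y = -(y * x) := by
  induction x, hx using CliffordAlgebra.odd_induction with
  | ι v =>
    induction y, hy using CliffordAlgebra.odd_induction with
    | ι w => exact eq_neg_of_add_eq_zero_left (ι_add_mul_swap (R := ℝ) v w)
    | add a b _ _ ha hb => rw [mul_add, ha, hb, add_mul, neg_add]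
    | ι_mul_ι_mul m₁ m₂ a _ ih =>
      have := commute_of_mem_even
        (CliffordAlgebra.ι_mul_ι_mem_evenOdd_zero (0 : QuadraticForm ℝ M) m₁ m₂)
        (CliffordAlgebra.ι (0 : QuadraticForm ℝ M) v)
      rw [← mul_assoc, ← this.eq, mul_assoc, ih, mul_neg, mul_assoc, mul_assoc, mul_assoc]
  | add a b _ _ ha hb => rw [add_mul, ha, hb, mul_add, neg_add]
  | ι_mul_ι_mul m₁ m₂ a _ ih =>
    have := commute_of_mem_even
      (CliffordAlgebra.ι_mul_ι_mem_evenOdd_zero (0 : QuadraticForm ℝ M) m₁ m₂) y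
    rw [mul_assoc, ih, mul_neg, ← mul_assoc, this.eq, mul_assoc]

theorem mul_self_eq_zero_of_mem_odd {x : ExteriorAlgebra ℝ M}
    (hx : x ∈ evenOdd (0 : QuadraticForm ℝ M) 1) : x * x = 0 := by
  have h := mul_eq_neg_mul_of_mem_odd hx hx
  have h2 : (2 : ℝ) • (x * x) = 0 := by rw [two_smul]; nth_rw 1 [h]; exact neg_add_cancel _
  exact (smul_eq_zero.mp h2).resolve_left two_ne_zero

theorem exists_even_add_odd (x : ExteriorAlgebra ℝ M) :
    ∃ y ∈ evenOdd (0 : QuadraticForm ℝ M) 0, ∃ z ∈ evenOdd (0 : QuadraticForm ℝ M) 1,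
      y + z = x :=
  Submodule.mem_sup.mp (by
    rw [(CliffordAlgebra.evenOdd_isCompl (Q := (0 : QuadraticForm ℝ M))).sup_eq_top]
    exact Submodule.mem_top)

/-- Parity as an eigenvalue of the grade involution, 2 being invertible. In this form parity is an
equation, which algebra maps transport easily. -/
theorem mem_even_iff {x : ExteriorAlgebra ℝ M} :
    x ∈ evenOdd (0 : QuadraticForm ℝ M) 0 ↔ involute x = x := by
  refine ⟨CliffordAlgebra.involute_eq_of_mem_even, fun h => ?_⟩
  obtain ⟨y, hy, z, hz, rfl⟩ := exists_even_add_odd x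
  rw [map_add, CliffordAlgebra.involute_eq_of_mem_even hy,
    CliffordAlgebra.involute_eq_of_mem_odd hz, add_right_inj] at h
  have hz0 : z = 0 := by
    have h2 : (2 : ℝ) • z = 0 := by rw [two_smul]; nth_rw 1 [← h]; exact neg_add_cancel _
    exact (smul_eq_zero.mp h2).resolve_left two_ne_zero
  rwa [hz0, add_zero]

theorem mem_odd_iff {x : ExteriorAlgebra ℝ M} :
    x ∈ evenOdd (0 : QuadraticForm ℝ M) 1 ↔ involute x = -x := by
  refine ⟨CliffordAlgebra.involute_eq_of_mem_odd, fun h => ?_⟩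
  obtain ⟨y, hy, z, hz, rfl⟩ := exists_even_add_odd x
  rw [map_add, CliffordAlgebra.involute_eq_of_mem_even hy,
    CliffordAlgebra.involute_eq_of_mem_odd hz, neg_add, add_left_inj] at h
  have hy0 : y = 0 := by
    have h2 : (2 : ℝ) • y = 0 := by rw [two_smul]; nth_rw 1 [h]; exact neg_add_cancel _
    exact (smul_eq_zero.mp h2).resolve_left two_ne_zero
  rwa [hy0, zero_add]

/-! ### The filtration of the Grassmann algebra by degree -/

variable (M) in
/-- The ideal generated by the products of `k` vectors. -/
def degreeGE (k : ℕ) : Submodule ℝ (ExteriorAlgebra ℝ M) := LinearMap.range (ι ℝ) ^ k * ⊤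

/-- The right ideal `degreeGE` is also a left ideal: the whole algebra is the supremum of the powers
of the space of vectors, and these powers commute with one another. -/
theorem top_mul_range_pow (k : ℕ) :
    (⊤ : Submodule ℝ (ExteriorAlgebra ℝ M)) * LinearMap.range (ι ℝ) ^ k = degreeGE M k := by
  have h : (⨆ i : ℕ, LinearMap.range (ι ℝ (M := M)) ^ i) = ⊤ :=
    CliffordAlgebra.iSup_ι_range_eq_top (Q := (0 : QuadraticForm ℝ M))
  rw [degreeGE, ← h, Submodule.iSup_mul, Submodule.mul_iSup]
  exact iSup_congr fun i => by rw [← pow_add, ← pow_add, add_comm]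

theorem degreeGE_zero : degreeGE M 0 = ⊤ := by
  rw [degreeGE, pow_zero, one_mul]

theorem mul_mem_degreeGE {j k : ℕ} {x y : ExteriorAlgebra ℝ M} (hx : x ∈ degreeGE M j)
    (hy : y ∈ degreeGE M k) : x * y ∈ degreeGE M (j + k) := by
  have h := Submodule.mul_mem_mul hx hy
  rw [← top_mul_range_pow k] at h
  have h2 : degreeGE M j * (⊤ * LinearMap.range (ι ℝ) ^ k) ≤ degreeGE M (j + k) := by
    rw [degreeGE, mul_assoc, ← mul_assoc ⊤, ← mul_assoc, degreeGE, pow_add, mul_assoc,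
      mul_assoc (LinearMap.range (ι ℝ) ^ j)]
    refine mul_le_mul' le_rfl ?_
    calc _ ≤ (⊤ : Submodule ℝ (ExteriorAlgebra ℝ M)) * LinearMap.range (ι ℝ) ^ k :=
          mul_le_mul' le_top le_rfl
      _ = _ := top_mul_range_pow k
  exact h2 h

/-- More than `n` vectors of `ℝ^n` are linearly dependent, so their alternating product is zero. -/
theorem degreeGE_eq_bot {n : ℕ} (k : ℕ) (h : n < k) : degreeGE (Fin n → ℝ) k = ⊥ := by
  have : LinearMap.range (ι ℝ (M := Fin n → ℝ)) ^ k = ⊥ := by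
    change ⋀[ℝ]^k (Fin n → ℝ) = ⊥
    rw [← ιMulti_span_fixedDegree, Submodule.span_eq_bot]
    rintro _ ⟨v, rfl⟩
    refine AlternatingMap.map_linearDependent _ v fun hv => ?_
    have := hv.fintype_card_le_finrank
    simp at this
    omega
  rw [degreeGE, this, Submodule.bot_mul]

/-- With `ε` the scalar part, products are handled by `ab - ε(ab) = (a - ε a) b + ε a (b - ε b)`. -/
theorem sub_algebraMapInv_mem (x : ExteriorAlgebra ℝ M) :
    x - algebraMap ℝ _ (algebraMapInv x) ∈ degreeGE M 1 := by
  induction x using ExteriorAlgebra.induction with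
  | algebraMap r => simp [algebraMap_leftInverse M r]
  | ι m =>
    have : algebraMapInv (ι ℝ m) = 0 := by simp [algebraMapInv]
    rw [this, map_zero, sub_zero, degreeGE, pow_one, ← mul_one (ι ℝ m)]
    exact Submodule.mul_mem_mul ⟨m, rfl⟩ Submodule.mem_top
  | mul a b ha hb =>
    have : a * b - algebraMap ℝ _ (algebraMapInv (a * b)) =
        (a - algebraMap ℝ _ (algebraMapInv a)) * b +
          algebraMap ℝ _ (algebraMapInv a) * (b - algebraMap ℝ _ (algebraMapInv b)) := by
      rw [map_mul, map_mul]; noncomm_ring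
    rw [this]
    refine add_mem ?_ ?_
    · exact mul_mem_degreeGE (k := 0) ha (by rw [degreeGE_zero]; exact Submodule.mem_top)
    · rw [← Algebra.smul_def]; exact Submodule.smul_mem _ _ hb
  | add a b ha hb =>
    rw [map_add, map_add, add_sub_add_comm]
    exact add_mem ha hb

theorem mem_degreeGE_one {x : ExteriorAlgebra ℝ M} (h : algebraMapInv x = 0) :
    x ∈ degreeGE M 1 := by
  simpa [h] using sub_algebraMapInv_mem x

theorem mem_degreeGE_two {x : ExteriorAlgebra ℝ M}
    (hx : x ∈ evenOdd (0 : QuadraticForm ℝ M) 0) (h : algebraMapInv x = 0) :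
    x ∈ degreeGE M 2 := by
  -- The summands of an element without scalar part may have scalar parts, so the induction runs on
  -- the difference from the scalar part.
  have key : x - algebraMap ℝ _ (algebraMapInv x) ∈ degreeGE M 2 := by
    clear h
    induction x, hx using CliffordAlgebra.even_induction with
    | algebraMap r =>
      have := algebraMap_leftInverse M r
      simp [this]
    | add a b _ _ ha hb =>
      rw [map_add, map_add, add_sub_add_comm]
      exact add_mem ha hb
    | ι_mul_ι_mul m₁ m₂ a _ ih =>
      have : algebraMapInv (CliffordAlgebra.ι (0 : QuadraticForm ℝ M) m₁) = 0 := by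
        change algebraMapInv (ι ℝ m₁) = 0
        simp [algebraMapInv]
      rw [map_mul, map_mul, map_mul, this, zero_mul, map_zero, zero_mul, sub_zero, degreeGE, pow_two]
      exact Submodule.mul_mem_mul (Submodule.mul_mem_mul ⟨m₁, rfl⟩ ⟨m₂, rfl⟩) Submodule.mem_top
  simpa [h] using key

/-- Each factor lies in degree at least 2, so the product lies in degree at least 4, beyond the top
degree. This is the source of the bound 3 on the number of odd coordinates in everything that
follows. -/
theorem mul_eq_zero_of_mem_even {n : ℕ} (hn : n ≤ 3) {x y : ExteriorAlgebra ℝ (Fin n → ℝ)}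
    (hx : x ∈ evenOdd (0 : QuadraticForm ℝ (Fin n → ℝ)) 0) (hx0 : algebraMapInv x = 0)
    (hy : y ∈ evenOdd (0 : QuadraticForm ℝ (Fin n → ℝ)) 0) (hy0 : algebraMapInv y = 0) :
    x * y = 0 := by
  have h := mul_mem_degreeGE (mem_degreeGE_two hx hx0) (mem_degreeGE_two hy hy0)
  rwa [degreeGE_eq_bot _ (by omega), Submodule.mem_bot] at h

/-- The graded Leibniz rule for inhomogeneous `x`: the involution supplies the sign `(-1)^{|x|}`. -/
theorem contractLeft_mul (φ : Module.Dual ℝ M) (x y : ExteriorAlgebra ℝ M) :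
    CliffordAlgebra.contractLeft (Q := (0 : QuadraticForm ℝ M)) φ (x * y) =
      CliffordAlgebra.contractLeft (Q := (0 : QuadraticForm ℝ M)) φ x * y +
        involute x * CliffordAlgebra.contractLeft (Q := (0 : QuadraticForm ℝ M)) φ y := by
  induction x using CliffordAlgebra.left_induction with
  | algebraMap r =>
    rw [CliffordAlgebra.contractLeft_algebraMap_mul, CliffordAlgebra.contractLeft_algebraMap,
      zero_mul, zero_add, AlgHom.commutes]
  | add a b ha hb => rw [add_mul, map_add, map_add, ha, hb, map_add, add_mul, add_mul]; abel
  | ι_mul a m ih =>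
    rw [mul_assoc, CliffordAlgebra.contractLeft_ι_mul, CliffordAlgebra.contractLeft_ι_mul, ih,
      map_mul, CliffordAlgebra.involute_ι, sub_mul, smul_mul_assoc]
    noncomm_ring

theorem involute_contractLeft (φ : Module.Dual ℝ M) (x : ExteriorAlgebra ℝ M) :
    involute (CliffordAlgebra.contractLeft (Q := (0 : QuadraticForm ℝ M)) φ x) =
      -CliffordAlgebra.contractLeft (Q := (0 : QuadraticForm ℝ M)) φ (involute x) := by
  induction x using CliffordAlgebra.left_induction with
  | algebraMap r => simp
  | add a b ha hb => rw [map_add, map_add, ha, hb, map_add, map_add, neg_add]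
  | ι_mul a m ih =>
    rw [CliffordAlgebra.contractLeft_ι_mul, map_sub, map_smul, map_mul, ih, map_mul,
      CliffordAlgebra.involute_ι, neg_mul, neg_mul, map_neg, CliffordAlgebra.contractLeft_ι_mul]
    simp

end ExteriorAlgebra

/-! ### Integrals with parameters and Hadamard's lemma -/

open MeasureTheory intervalIntegral in
theorem hasFDerivAt_integral_of_contDiff {E F : Type} [NormedAddCommGroup E] [NormedSpace ℝ E]
    [FiniteDimensional ℝ E] [NormedAddCommGroup F] [NormedSpace ℝ F] [CompleteSpace F]
    {G : E × ℝ → F} (hG : ContDiff ℝ 1 G) (x₀ : E) :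
    HasFDerivAt (fun x => ∫ t in (0 : ℝ)..1, G (x, t))
      (∫ t in (0 : ℝ)..1, (fderiv ℝ G (x₀, t)).comp (ContinuousLinearMap.inl ℝ E ℝ)) x₀ := by
  have hc : Continuous fun z => (fderiv ℝ G z).comp (ContinuousLinearMap.inl ℝ E ℝ) :=
    (hG.continuous_fderiv one_ne_zero).clm_comp continuous_const
  -- A dominating constant: the continuous derivative is bounded on the compact set (closed unit
  -- ball around `x₀`) × `[0, 1]`.
  obtain ⟨C, hC⟩ := ((isCompact_closedBall x₀ 1).prod
    (isCompact_Icc (a := (0 : ℝ)) (b := 1))).exists_bound_of_continuousOn hc.continuousOn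
  refine hasFDerivAt_integral_of_dominated_of_fderiv_le (s := Metric.closedBall x₀ 1)
    (F := fun x t => G (x, t))
    (F' := fun x t => (fderiv ℝ G (x, t)).comp (ContinuousLinearMap.inl ℝ E ℝ))
    (bound := fun _ => C) (Metric.closedBall_mem_nhds _ one_pos) ?_ ?_ ?_ ?_ ?_ ?_
  · exact .of_forall fun x =>
      (hG.continuous.comp (by fun_prop : Continuous fun t : ℝ => (x, t))).aestronglyMeasurable
  · exact (hG.continuous.comp
      (by fun_prop : Continuous fun t : ℝ => (x₀, t))).intervalIntegrable _ _
  · exact (hc.comp (by fun_prop : Continuous fun t : ℝ => (x₀, t))).aestronglyMeasurable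
  · refine .of_forall fun t ht x hx => hC (x, t) ⟨hx, ?_⟩
    rw [Set.uIoc_of_le zero_le_one] at ht
    exact ⟨ht.1.le, ht.2⟩
  · exact intervalIntegrable_const
  · refine .of_forall fun t _ x _ => ?_
    exact ((hG.differentiable one_ne_zero).differentiableAt.hasFDerivAt (x := (x, t))).comp x
      (hasFDerivAt_prodMk_left x t)

theorem contDiff_integral_of_contDiff {E : Type} [NormedAddCommGroup E] [NormedSpace ℝ E]
    [FiniteDimensional ℝ E] (n : ℕ) {F : Type} [NormedAddCommGroup F] [NormedSpace ℝ F]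
    [CompleteSpace F] {G : E × ℝ → F} (hG : ContDiff ℝ ∞ G) :
    ContDiff ℝ n (fun x => ∫ t in (0 : ℝ)..1, G (x, t)) := by
  -- The derivative of the integral is the integral of a function with values in linear maps, so the
  -- target space changes at each step.
  induction n generalizing F with
  | zero =>
    exact contDiff_zero.mpr (continuous_iff_continuousAt.mpr fun x =>
      (hasFDerivAt_integral_of_contDiff (hG.of_le (by simp)) x).continuousAt)
  | succ n ih =>
    have hd := hasFDerivAt_integral_of_contDiff (hG.of_le (by simp))
    rw [Nat.cast_succ, contDiff_succ_iff_fderiv]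
    refine ⟨fun x => (hd x).differentiableAt, by simp, ?_⟩
    rw [funext fun x => (hd x).fderiv]
    exact ih (G := fun z => (fderiv ℝ G z).comp (ContinuousLinearMap.inl ℝ E ℝ))
      ((hG.fderiv_right (m := ∞) (by simp)).clm_comp contDiff_const)

/-- Hadamard's lemma. -/
theorem exists_eq_add_sum_mul_of_contDiff {m : ℕ} {f : (Fin m → ℝ) → ℝ} (hf : ContDiff ℝ ∞ f)
    (q : Fin m → ℝ) : ∃ g : Fin m → (Fin m → ℝ) → ℝ, (∀ i, ContDiff ℝ ∞ (g i)) ∧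
      ∀ x, f x = f q + ∑ i, (x i - q i) * g i x := by
  -- The witness is the mean of `∂_i f` over the segment from `q` to `x`; the fundamental theorem of
  -- calculus along this segment gives the formula.
  refine ⟨fun i x => ∫ t in (0 : ℝ)..1, fderiv ℝ f (q + t • (x - q)) (Pi.single i 1),
    fun i => contDiff_infty.mpr fun n => ?_, fun x => ?_⟩
  · refine contDiff_integral_of_contDiff n
      (G := fun z : (Fin m → ℝ) × ℝ => fderiv ℝ f (q + z.2 • (z.1 - q)) (Pi.single i 1)) ?_
    exact ((hf.fderiv_right (m := ∞) (by simp)).comp (by fun_prop)).clm_apply contDiff_const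
  · have hcont : Continuous fun t : ℝ => fderiv ℝ f (q + t • (x - q)) :=
      (hf.continuous_fderiv (by simp)).comp (by fun_prop)
    have hd : ∀ t : ℝ, HasDerivAt (fun t : ℝ => f (q + t • (x - q)))
        (fderiv ℝ f (q + t • (x - q)) (x - q)) t := fun t => by
      have h1 : HasDerivAt (fun t : ℝ => q + t • (x - q)) (x - q) t := by
        simpa using ((hasDerivAt_id t).smul_const (x - q)).const_add q
      exact ((hf.differentiable (by simp)).differentiableAt.hasFDerivAt).comp_hasDerivAt t h1
    have := intervalIntegral.integral_eq_sub_of_hasDerivAt (fun t _ => hd t)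
      ((hcont.clm_apply continuous_const).intervalIntegrable 0 1)
    simp only [one_smul, zero_smul, add_zero, add_sub_cancel] at this
    rw [← sub_eq_iff_eq_add', ← this]
    have hsum : ∀ t : ℝ, fderiv ℝ f (q + t • (x - q)) (x - q) =
        ∑ i, (x i - q i) * fderiv ℝ f (q + t • (x - q)) (Pi.single i 1) := fun t => by
      generalize fderiv ℝ f (q + t • (x - q)) = L
      conv_lhs => rw [← Finset.univ_sum_single (x - q), map_sum]
      refine Finset.sum_congr rfl fun i _ => ?_
      rw [← smul_eq_mul, ← map_smul, ← Pi.single_smul', smul_eq_mul, mul_one, Pi.sub_apply]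
    simp only [hsum]
    rw [intervalIntegral.integral_finsetSum fun i _ =>
      ((hcont.clm_apply continuous_const).const_mul _).intervalIntegrable 0 1]
    exact Finset.sum_congr rfl fun i _ => intervalIntegral.integral_const_mul _ _

/-- A smooth function near a point extends, as a germ, to a global smooth function. -/
theorem exists_contDiff_eqOn_ball {E : Type} [NormedAddCommGroup E] [NormedSpace ℝ E]
    [FiniteDimensional ℝ E] {f : E → ℝ} {V : Set E} (hV : IsOpen V)
    (hf : ∀ x ∈ V, ContDiffAt ℝ ∞ f x) {q : E} (hq : q ∈ V) :
    ∃ g : E → ℝ, ContDiff ℝ ∞ g ∧ ∃ r > 0, Metric.ball q r ⊆ V ∧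
      Set.EqOn f g (Metric.ball q r) := by
  obtain ⟨r, hr, hrV⟩ := Metric.isOpen_iff.mp hV q hq
  -- `χ` is 1 on the ball of radius `r / 4` and its support lies in the closed ball of radius `r /
  -- 2`, inside `V`. So `χ f` is smooth everywhere, whatever `f` is outside `V`.
  let χ : ContDiffBump q := ⟨r / 4, r / 2, by positivity, by linarith⟩
  refine ⟨fun x => χ x * f x, ?_, r / 4, by positivity,
    (Metric.ball_subset_ball (by linarith)).trans hrV, fun x hx => ?_⟩
  · refine contDiff_iff_contDiffAt.mpr fun x => ?_
    by_cases hx : x ∈ V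
    · exact χ.contDiff.contDiffAt.mul (hf x hx)
    · have hx' : x ∉ tsupport χ := fun h => hx (hrV (by
        rw [χ.tsupport_eq] at h
        exact Metric.closedBall_subset_ball (by change r / 2 < r; linarith) h))
      refine ContDiffAt.congr_of_eventuallyEq (f := fun _ => (0 : ℝ)) contDiffAt_const ?_
      filter_upwards [(isClosed_tsupport χ).isOpen_compl.mem_nhds hx'] with y hy
      rw [image_eq_zero_of_notMem_tsupport hy, zero_mul]
  · change f x = χ x * f x
    rw [χ.one_of_mem_closedBall (Metric.ball_subset_closedBall hx), one_mul]

namespace SuperDomain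

open CliffordAlgebra (evenOdd involute)

/-! ### Pointwise calculus of superfunctions -/

/-- Evaluation of smooth functions at a point. -/
def smoothEval {d : SuperDomain} {U : Opens d.Body} (p : U) : Smooth U →ₐ[ℝ] ℝ where
  toFun s := s p
  map_one' := rfl
  map_mul' _ _ := rfl
  map_zero' := rfl
  map_add' _ _ := rfl
  commutes' _ := rfl

/-- Evaluation of superfunctions at a point of the body, with values in the Grassmann algebra. -/
def evalAt {d : SuperDomain} {U : Opens d.Body} (p : U) : O U →ₐ[ℝ] Grassmann d :=
  Algebra.TensorProduct.lift ((Algebra.ofId ℝ (Grassmann d)).comp (smoothEval p))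
    (AlgHom.id ℝ (Grassmann d)) fun r x => Algebra.commutes (smoothEval p r) x

@[simp]
theorem evalAt_tmul {d : SuperDomain} {U : Opens d.Body} (p : U) (s : Smooth U)
    (l : Grassmann d) : evalAt p (s ⊗ₜ[ℝ] l) = s p • l :=
  (Algebra.TensorProduct.lift_tmul _ _ _ _ _).trans (Algebra.smul_def (s p) l).symm

theorem evalAt_smul {d : SuperDomain} {U : Opens d.Body} (p : U) (s : Smooth U) (x : O U) :
    evalAt p (s • x) = s p • evalAt p x := by
  induction x using TensorProduct.induction_on with
  | zero => simp
  | add x y hx hy => rw [smul_add, map_add, hx, hy, map_add, smul_add]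
  | tmul t l =>
    rw [TensorProduct.smul_tmul', evalAt_tmul, evalAt_tmul, smul_smul]
    rfl

/-- A basis of the Grassmann algebra identifies superfunctions with finitely supported families of
smooth functions, and these are determined by their values at points. Identities of superfunctions
thereby reduce to identities in the Grassmann algebra. -/
theorem ext_evalAt {d : SuperDomain} {U : Opens d.Body} {x y : O U}
    (h : ∀ p : U, evalAt p x = evalAt p y) : x = y := by
  classical
  let b := Module.Basis.ofVectorSpace ℝ (Grassmann d)
  refine (TensorProduct.equivFinsuppOfBasisRight (M := Smooth U) b).injective ?_
  have key : ∀ (z : O U) i (p : U),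
      (TensorProduct.equivFinsuppOfBasisRight (M := Smooth U) b z i) p =
        b.coord i (evalAt p z) := fun z i p => by
    induction z using TensorProduct.induction_on with
    | zero => simp
    | add x y hx hy =>
      rw [map_add, map_add, map_add, ← hx, ← hy]
      rfl
    | tmul s l =>
      rw [TensorProduct.equivFinsuppOfBasisRight_apply_tmul_apply, evalAt_tmul, map_smul,
        smul_eq_mul, mul_comm]
      rfl
  ext i p
  rw [key, key, h p]

@[simp]
theorem evalAt_res {d : SuperDomain} {U V : Opens d.Body} (h : U ≤ V) (f : O V) (p : U) :
    evalAt p (res h f) = evalAt ⟨p, h p.2⟩ f := by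
  induction f using TensorProduct.induction_on with
  | zero => simp
  | add x y hx hy => rw [map_add, map_add, hx, hy, map_add]
  | tmul s l =>
    rw [res, Algebra.TensorProduct.map_tmul, evalAt_tmul, evalAt_tmul]
    rfl

@[simp]
theorem evalAt_ofSmooth {d : SuperDomain} {U : Opens d.Body} (f : d.Body → ℝ)
    (hf : ContDiff ℝ ∞ f) (p : U) : evalAt p (ofSmooth f hf U) = algebraMap ℝ _ (f p) :=
  (evalAt_tmul _ _ _).trans (Algebra.algebraMap_eq_smul_one _).symm

@[simp]
theorem evalAt_evenCoord {d : SuperDomain} {U : Opens d.Body} (i : Fin d.even) (p : U) :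
    evalAt p (evenCoord U i) = algebraMap ℝ _ (p.1 i) := evalAt_ofSmooth _ _ _

@[simp]
theorem evalAt_oddCoord {d : SuperDomain} {U : Opens d.Body} (j : Fin d.odd) (p : U) :
    evalAt p (oddCoord U j) = ExteriorAlgebra.ι ℝ (Pi.single j (1 : ℝ)) :=
  (evalAt_tmul _ _ _).trans (one_smul _ _)

theorem res_evenCoord {d : SuperDomain} {U V : Opens d.Body} (h : U ≤ V) (i : Fin d.even) :
    res h (evenCoord V i) = evenCoord U i := ext_evalAt fun p => by simp

theorem res_oddCoord {d : SuperDomain} {U V : Opens d.Body} (h : U ≤ V) (j : Fin d.odd) :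
    res h (oddCoord V j) = oddCoord U j := ext_evalAt fun p => by simp

/-- The value of a superfunction at a point of the body. -/
def bodyAt {d : SuperDomain} {U : Opens d.Body} (p : U) : O U →ₐ[ℝ] ℝ :=
  ExteriorAlgebra.algebraMapInv.comp (evalAt p)

theorem bodyAt_apply {d : SuperDomain} {U : Opens d.Body} (p : U) (x : O U) :
    bodyAt p x = ExteriorAlgebra.algebraMapInv (evalAt p x) := rfl

theorem algebraMapInv_algebraMap {M : Type*} [AddCommGroup M] [Module ℝ M] (r : ℝ) :
    ExteriorAlgebra.algebraMapInv (algebraMap ℝ (ExteriorAlgebra ℝ M) r) = r :=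
  ExteriorAlgebra.algebraMap_leftInverse M r

theorem algebraMapInv_ι {M : Type*} [AddCommGroup M] [Module ℝ M] (v : M) :
    ExteriorAlgebra.algebraMapInv (ExteriorAlgebra.ι ℝ v) = 0 := by
  simp [ExteriorAlgebra.algebraMapInv]

/-- The smooth function underlying a superfunction. -/
def bodyMap {d : SuperDomain} (U : Opens d.Body) : O U →ₐ[ℝ] Smooth U :=
  Algebra.TensorProduct.lift (AlgHom.id ℝ (Smooth U))
    ((Algebra.ofId ℝ (Smooth U)).comp ExteriorAlgebra.algebraMapInv)
    fun _ _ => Commute.all _ _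

theorem bodyMap_apply {d : SuperDomain} {U : Opens d.Body} (x : O U) (p : U) :
    bodyMap U x p = bodyAt p x := by
  induction x using TensorProduct.induction_on with
  | zero => simp
  | add x y hx hy => rw [map_add, map_add, ← hx, ← hy]; rfl
  | tmul s l =>
    rw [bodyAt_apply, evalAt_tmul, map_smul, bodyMap, Algebra.TensorProduct.lift_tmul]
    rfl

/-! ### Parity -/

theorem zmod_two (i : ZMod 2) : i = 0 ∨ i = 1 := by
  revert i; decide

theorem koszul_zero_left (i : ZMod 2) : koszul 0 i = 1 := by simp [koszul]

theorem koszul_zero_right (i : ZMod 2) : koszul i 0 = 1 := by simp [koszul]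

theorem koszul_one_one : koszul 1 1 = -1 := by simp [koszul]

theorem koszul_mul_self (i j : ZMod 2) : koszul i j * koszul i j = 1 := by
  unfold koszul; split_ifs <;> norm_num

theorem koszul_add_left (i j k : ZMod 2) : koszul (i + j) k = koszul i k * koszul j k := by
  have h : (1 : ZMod 2) + 1 = 0 := rfl
  rcases zmod_two i with rfl | rfl
  · rw [zero_add, koszul_zero_left, one_mul]
  rcases zmod_two j with rfl | rfl
  · rw [add_zero, koszul_zero_left, mul_one]
  · rw [h, koszul_zero_left, koszul_mul_self]

theorem koszul_comm (i j : ZMod 2) : koszul i j = koszul j i := by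
  simp [koszul, and_comm]

theorem mem_evenOdd_iff {M : Type*} [AddCommGroup M] [Module ℝ M] {x : ExteriorAlgebra ℝ M}
    {i : ZMod 2} : x ∈ evenOdd (0 : QuadraticForm ℝ M) i ↔ involute x = koszul i 1 • x := by
  rcases zmod_two i with rfl | rfl
  · rw [koszul_zero_left, one_smul, ExteriorAlgebra.mem_even_iff]
  · rw [koszul_one_one, neg_one_smul, ExteriorAlgebra.mem_odd_iff]

/-- The parity involution of the structure sheaf. -/
def invol {d : SuperDomain} (U : Opens d.Body) : O U →ₐ[ℝ] O U :=
  Algebra.TensorProduct.map (AlgHom.id ℝ (Smooth U)) involute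

theorem invol_tmul {d : SuperDomain} {U : Opens d.Body} (s : Smooth U) (l : Grassmann d) :
    invol U (s ⊗ₜ[ℝ] l) = s ⊗ₜ[ℝ] involute l := rfl

theorem evalAt_invol {d : SuperDomain} {U : Opens d.Body} (x : O U) (p : U) :
    evalAt p (invol U x) = involute (evalAt p x) := by
  induction x using TensorProduct.induction_on with
  | zero => simp
  | add x y hx hy => rw [map_add, map_add, map_add, hx, hy, map_add]
  | tmul s l => rw [invol_tmul, evalAt_tmul, evalAt_tmul, map_smul]

theorem mem_parity_iff_invol {d : SuperDomain} {U : Opens d.Body} {x : O U} {i : ZMod 2} :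
    x ∈ parity U i ↔ invol U x = koszul i 1 • x := by
  constructor
  · rintro ⟨y, rfl⟩
    induction y using TensorProduct.induction_on with
    | zero => simp
    | add x y hx hy => rw [map_add, map_add, hx, hy, smul_add]
    | tmul s l =>
      rw [LinearMap.lTensor_tmul, invol_tmul, Submodule.subtype_apply, mem_evenOdd_iff.mp l.2,
        TensorProduct.tmul_smul]
  · intro h
    -- Averaging with the signed involution projects onto the part of parity `i`, and it fixes an
    -- `x` that satisfies the eigenvalue equation.
    have key : ∀ y : O U, (1 / 2 : ℝ) • (y + koszul i 1 • invol U y) ∈ parity U i := fun y => by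
      induction y using TensorProduct.induction_on with
      | zero => simp
      | add x y hx hy =>
        convert add_mem hx hy using 1
        rw [← smul_add, map_add, smul_add (koszul i 1)]
        congr 1; abel
      | tmul s l =>
        rw [invol_tmul, ← TensorProduct.tmul_smul, ← TensorProduct.tmul_add,
          ← TensorProduct.tmul_smul]
        refine ⟨s ⊗ₜ[ℝ] ⟨(1 / 2 : ℝ) • (l + koszul i 1 • involute l), mem_evenOdd_iff.mpr ?_⟩, rfl⟩
        rw [map_smul, map_add, map_smul, CliffordAlgebra.involute_involute, smul_comm (koszul i 1),
          smul_add (koszul i 1), smul_smul, koszul_mul_self, one_smul, add_comm]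
    have := key x
    rwa [h, smul_smul, koszul_mul_self, one_smul, ← two_smul ℝ x, smul_smul,
      show (1 / 2 : ℝ) * 2 = 1 by norm_num, one_smul] at this

theorem mem_parity_iff {d : SuperDomain} {U : Opens d.Body} {x : O U} {i : ZMod 2} :
    x ∈ parity U i ↔ ∀ p : U, evalAt p x ∈ evenOdd (0 : QuadraticForm ℝ (Fin d.odd → ℝ)) i := by
  simp only [mem_parity_iff_invol, mem_evenOdd_iff, ← evalAt_invol, ← map_smul]
  exact ⟨fun h p => by rw [h], ext_evalAt⟩

theorem superfunction_neg_one_smul {d : SuperDomain} {U : Opens d.Body} (x : O U) :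
    (-1 : ℝ) • x = -x := neg_one_smul ℝ x

theorem mul_mem_parity {d : SuperDomain} {U : Opens d.Body} {x y : O U} {i j : ZMod 2}
    (hx : x ∈ parity U i) (hy : y ∈ parity U j) : x * y ∈ parity U (i + j) := by
  rw [mem_parity_iff_invol] at *
  rw [map_mul, hx, hy, koszul_add_left, smul_mul_smul_comm]

theorem smul_mem_parity {d : SuperDomain} {U : Opens d.Body} (s : Smooth U) {x : O U}
    {i : ZMod 2} (hx : x ∈ parity U i) : s • x ∈ parity U i := by
  rw [mem_parity_iff] at *
  exact fun p => by rw [evalAt_smul]; exact Submodule.smul_mem _ _ (hx p)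

theorem res_mem_parity {d : SuperDomain} {U V : Opens d.Body} (h : U ≤ V) {x : O V} {i : ZMod 2}
    (hx : x ∈ parity V i) : res h x ∈ parity U i := by
  rw [mem_parity_iff] at *
  exact fun p => by rw [evalAt_res]; exact hx _

theorem tmul_one_mem_parity {d : SuperDomain} {U : Opens d.Body} (s : Smooth U) :
    s ⊗ₜ[ℝ] (1 : Grassmann d) ∈ parity U 0 := by
  rw [mem_parity_iff_invol, invol_tmul, map_one, koszul_zero_left, one_smul]

theorem evenCoord_mem_parity {d : SuperDomain} {U : Opens d.Body} (i : Fin d.even) :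
    evenCoord U i ∈ parity U 0 := tmul_one_mem_parity _

theorem oddCoord_mem_parity {d : SuperDomain} {U : Opens d.Body} (j : Fin d.odd) :
    oddCoord U j ∈ parity U 1 := by
  rw [mem_parity_iff_invol, oddCoord, invol_tmul, koszul_one_one, superfunction_neg_one_smul]
  erw [CliffordAlgebra.involute_ι]
  rw [TensorProduct.tmul_neg]

theorem eq_zero_of_mem_parity {d : SuperDomain} {U : Opens d.Body} {x : O U}
    (h0 : x ∈ parity U 0) (h1 : x ∈ parity U 1) : x = 0 := by
  rw [mem_parity_iff_invol] at h0 h1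
  rw [h0, koszul_zero_left, koszul_one_one, one_smul, superfunction_neg_one_smul] at h1
  have h2 : (2 : ℝ) • x = 0 := by rw [two_smul]; nth_rw 1 [h1]; exact neg_add_cancel _
  exact (smul_eq_zero.mp h2).resolve_left two_ne_zero

theorem commute_of_mem_parity {d : SuperDomain} {U : Opens d.Body} {x : O U}
    (hx : x ∈ parity U 0) (y : O U) : Commute x y :=
  ext_evalAt fun p => by
    rw [map_mul, map_mul]
    exact (ExteriorAlgebra.commute_of_mem_even (mem_parity_iff.mp hx p) _).eq

theorem mul_self_eq_zero_of_mem_parity {d : SuperDomain} {U : Opens d.Body} {x : O U}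
    (hx : x ∈ parity U 1) : x * x = 0 :=
  ext_evalAt fun p => by
    rw [map_mul, map_zero]
    exact ExteriorAlgebra.mul_self_eq_zero_of_mem_odd (mem_parity_iff.mp hx p)

theorem mul_eq_neg_mul_of_mem_parity {d : SuperDomain} {U : Opens d.Body} {x y : O U}
    (hx : x ∈ parity U 1) (hy : y ∈ parity U 1) : x * y = -(y * x) :=
  ext_evalAt fun p => by
    rw [map_neg, map_mul, map_mul]
    exact ExteriorAlgebra.mul_eq_neg_mul_of_mem_odd (mem_parity_iff.mp hx p)
      (mem_parity_iff.mp hy p)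

theorem mul_eq_zero_of_nilpotent {d : SuperDomain} (hd : d.odd ≤ 3) {U : Opens d.Body} {x y : O U}
    (hx : x ∈ parity U 0) (hx0 : ∀ p, bodyAt p x = 0)
    (hy : y ∈ parity U 0) (hy0 : ∀ p, bodyAt p y = 0) : x * y = 0 :=
  ext_evalAt fun p => by
    rw [map_mul, map_zero]
    exact ExteriorAlgebra.mul_eq_zero_of_mem_even hd (mem_parity_iff.mp hx p) (hx0 p)
      (mem_parity_iff.mp hy p) (hy0 p)

theorem bodyAt_eq_zero_of_mem_parity {d : SuperDomain} {U : Opens d.Body} {x : O U}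
    (hx : x ∈ parity U 1) (p : U) : bodyAt p x = 0 := by
  have h := congrArg (bodyAt p) (mul_self_eq_zero_of_mem_parity hx)
  rw [map_mul, map_zero] at h
  exact mul_self_eq_zero.mp h

/-! ### Partial derivatives of smooth functions -/

theorem ext0_eventuallyEq {d : SuperDomain} {U : Opens d.Body} (s : Smooth U) {f : d.Body → ℝ}
    (p : U) {W : Set d.Body} (hW : W ∈ nhds p.1) (h : ∀ x : U, x.1 ∈ W → s x = f x) :
    ext0 s =ᶠ[nhds p.1] f := by
  filter_upwards [U.isOpen.mem_nhds p.2, hW] with y hy hyW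
  exact (ext0_apply s ⟨y, hy⟩).trans (h ⟨y, hy⟩ hyW)

theorem smoothPartial_apply {d : SuperDomain} {U : Opens d.Body} (i : Fin d.even) (s : Smooth U)
    (p : U) : smoothPartial i U s p = fderiv ℝ (ext0 s) p (Pi.single i 1) := rfl

theorem smoothPartial_eq {d : SuperDomain} {U : Opens d.Body} (i : Fin d.even) (s : Smooth U)
    {f : d.Body → ℝ} (p : U) (h : ∀ x : U, s x = f x) :
    smoothPartial i U s p = fderiv ℝ f p (Pi.single i 1) := by
  rw [smoothPartial_apply,
    (ext0_eventuallyEq s p Filter.univ_mem fun x _ => h x).fderiv_eq]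

theorem smoothPartial_mul {d : SuperDomain} {U : Opens d.Body} (i : Fin d.even)
    (s t : Smooth U) :
    smoothPartial i U (s * t) = smoothPartial i U s * t + s * smoothPartial i U t := by
  ext p
  have hs := (contDiffAt_ext0 s p).differentiableAt (by simp)
  have ht := (contDiffAt_ext0 t p).differentiableAt (by simp)
  rw [smoothPartial_eq i (s * t) (f := fun x => ext0 s x * ext0 t x) p fun x => by
    rw [ext0_apply, ext0_apply]; rfl]
  change _ = smoothPartial i U s p * t p + s p * smoothPartial i U t p
  rw [smoothPartial_apply, smoothPartial_apply, fderiv_fun_mul hs ht, ← ext0_apply s p,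
    ← ext0_apply t p]
  simp only [add_apply, smul_apply, smul_eq_mul]
  ring

theorem smoothPartial_one {d : SuperDomain} {U : Opens d.Body} (i : Fin d.even) :
    smoothPartial i U (1 : Smooth U) = 0 := by
  have := smoothPartial_mul (U := U) i 1 1
  simpa using this

theorem smoothPartial_pull {d : SuperDomain} {U V : Opens d.Body} (i : Fin d.even) (h : U ≤ V)
    (s : Smooth V) :
    smoothPartial i U (smoothPull id contDiff_id V U h s) =
      smoothPull id contDiff_id V U h (smoothPartial i V s) := by
  ext p
  rw [smoothPartial_apply, (ext0_eventuallyEq (smoothPull id contDiff_id V U h s) (f := ext0 s) p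
    Filter.univ_mem fun x _ => (ext0_apply s ⟨x, h x.2⟩).symm).fderiv_eq]
  rfl

/-! ### Locality of morphisms and their determination by the coordinates -/

/-- The smooth function on `U` given by a function on the body which is smooth on `U`. -/
def smoothMk {d : SuperDomain} (U : Opens d.Body) (f : d.Body → ℝ)
    (hf : ∀ x ∈ U, ContDiffAt ℝ ∞ f x) : Smooth U :=
  ⟨fun x => f x, fun x => by
    rw [contMDiffAt_subtype_iff (f := f), contMDiffAt_iff_contDiffAt]
    exact hf x x.2⟩

theorem smoothMk_apply {d : SuperDomain} {U : Opens d.Body} {f : d.Body → ℝ}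
    (hf : ∀ x ∈ U, ContDiffAt ℝ ∞ f x) (x : U) : smoothMk U f hf x = f x := rfl

/-- Hadamard's lemma for superfunctions without odd coordinates. -/
theorem exists_res_eq_add_sum {d : SuperDomain} {V : Opens d.Body} (s : Smooth V) (q : V) :
    ∃ (W : Opens d.Body) (h : W ≤ V) (_ : q.1 ∈ W) (g : Fin d.even → Smooth W),
      res h (s ⊗ₜ[ℝ] (1 : Grassmann d)) = algebraMap ℝ (O W) (s q) +
        ∑ i, (evenCoord W i - algebraMap ℝ (O W) (q.1 i)) * (g i ⊗ₜ[ℝ] (1 : Grassmann d)) := by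
  -- Hadamard's lemma is available for functions on the whole body, so the germ of `s` at `q` is
  -- first extended to such a function; the formula then holds on a small ball.
  obtain ⟨f, hf, r, hr, hrV, hfr⟩ := exists_contDiff_eqOn_ball V.isOpen
    (fun x hx => contDiffAt_ext0 s ⟨x, hx⟩) q.2
  obtain ⟨g, hg, hfg⟩ := exists_eq_add_sum_mul_of_contDiff hf q.1
  obtain ⟨W, hW⟩ : ∃ W : Opens d.Body, (W : Set d.Body) = Metric.ball q.1 r :=
    ⟨⟨Metric.ball q.1 r, Metric.isOpen_ball⟩, rfl⟩
  have hWV : W ≤ V := by rw [← SetLike.coe_subset_coe, hW]; exact hrV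
  rw [← hW] at hfr
  have hqW : q.1 ∈ W := by rw [← SetLike.mem_coe, hW]; exact Metric.mem_ball_self hr
  refine ⟨W, hWV, hqW, fun i => smoothMk _ (g i) fun x _ => (hg i).contDiffAt,
    ext_evalAt fun p => ?_⟩
  have h1 : s ⟨p, hWV p.2⟩ = s q + ∑ i, (p.1 i - q.1 i) * g i p := by
    rw [← ext0_apply s q, hfr hqW, ← hfg, ← hfr p.2]
    exact (ext0_apply s ⟨p, hWV p.2⟩).symm
  rw [evalAt_res, evalAt_tmul, map_add, map_sum, AlgHom.commutes, h1,
    ← Algebra.algebraMap_eq_smul_one, map_add, map_sum]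
  congr 1
  refine Finset.sum_congr rfl fun i _ => Eq.symm ?_
  rw [map_mul, map_sub, evalAt_evenCoord, AlgHom.commutes, evalAt_tmul, smoothMk_apply,
    ← Algebra.algebraMap_eq_smul_one, ← map_sub, ← map_mul]

/-- Morphisms of superdomains are local. -/
theorem bodyAt_pull_tmul_one {d e : SuperDomain} (φ : d ⟶ₛ e) {V : Opens e.Body} (s : Smooth V)
    (p : preim φ.base V) :
    bodyAt p (φ.pull V (s ⊗ₜ[ℝ] (1 : Grassmann e))) = s ⟨φ.base p, p.2⟩ := by
  by_contra hne
  set c := bodyAt p (φ.pull V (s ⊗ₜ[ℝ] (1 : Grassmann e))) with hc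
  -- If the value `c` at `p` differed from `s (φ p)`, then `s - c` would be invertible on the
  -- neighbourhood `W` of `φ p` where `s ≠ c`. Its pull-back would be invertible near `p`, yet has
  -- value 0 at `p`.
  let W : Opens e.Body := ⟨{x | ∃ h : x ∈ V, s ⟨x, h⟩ ≠ c}, by
    have : {x | ∃ h : x ∈ V, s ⟨x, h⟩ ≠ c} = Subtype.val '' {x : V | s x ≠ c} := by
      ext x; simp
    rw [this]
    exact V.isOpen.isOpenMap_subtype_val _
      (isOpen_ne_fun s.contMDiff.continuous continuous_const)⟩
  have hWV : W ≤ V := fun x hx => hx.1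
  have hpW : p.1 ∈ preim φ.base W := ⟨p.2, fun h => hne h.symm⟩
  let t : Smooth W := smoothMk W (fun x => (ext0 s x - c)⁻¹) fun x hx =>
    ((contDiffAt_ext0 s ⟨x, hx.1⟩).sub contDiffAt_const).inv (by
      rw [sub_ne_zero]
      intro h
      exact hx.2 ((ext0_apply s ⟨x, hx.1⟩).symm.trans h))
  have hmul : res hWV (s ⊗ₜ[ℝ] (1 : Grassmann e) - algebraMap ℝ (O V) c) *
      (t ⊗ₜ[ℝ] (1 : Grassmann e)) = 1 := ext_evalAt fun x => by
    rw [map_mul, evalAt_res, map_sub, evalAt_tmul, evalAt_tmul, AlgHom.commutes,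
      ← Algebra.algebraMap_eq_smul_one, ← Algebra.algebraMap_eq_smul_one, ← map_sub, ← map_mul,
      map_one]
    change algebraMap ℝ _ ((s ⟨x, hWV x.2⟩ - c) * (ext0 s x - c)⁻¹) = 1
    rw [show ext0 s x.1 = s ⟨x, hWV x.2⟩ from ext0_apply s ⟨x, hWV x.2⟩,
      mul_inv_cancel₀ (sub_ne_zero.mpr x.2.2), map_one]
  have h1 := congrArg (fun f => bodyAt ⟨p.1, hpW⟩ (φ.pull W f)) hmul
  simp only [map_mul, map_one, φ.pull_res] at h1
  have h2 : bodyAt ⟨p.1, hpW⟩ (res (preim_mono φ.base hWV)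
      (φ.pull V (s ⊗ₜ[ℝ] (1 : Grassmann e) - algebraMap ℝ (O V) c))) = 0 := by
    rw [bodyAt_apply, evalAt_res, ← bodyAt_apply, map_sub, map_sub, AlgHom.commutes,
      AlgHom.commutes]
    exact sub_eq_zero.mpr hc.symm
  rw [h2, zero_mul] at h1
  exact zero_ne_one h1

theorem bodyAt_pull_evenCoord {d e : SuperDomain} (φ : d ⟶ₛ e) {V : Opens e.Body}
    (i : Fin e.even) (p : preim φ.base V) :
    bodyAt p (φ.pull V (evenCoord V i)) = φ.base p i := bodyAt_pull_tmul_one φ _ p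

/-- A family of additive maps along a morphism of superdomains is zero on smooth functions if it
is a derivation which vanishes on the even coordinates. -/
theorem eq_zero_of_evenCoord {d e : SuperDomain} (φ : d ⟶ₛ e)
    (D : ∀ V : Opens e.Body, O V →ₗ[ℝ] O (preim φ.base V))
    (hres : ∀ (V W : Opens e.Body) (h : V ≤ W) (f : O W),
      D V (res h f) = res (preim_mono φ.base h) (D W f))
    (hone : ∀ V, D V 1 = 0)
    (heven : ∀ V i g, D V (evenCoord V i * g) = φ.pull V (evenCoord V i) * D V g)
    (V : Opens e.Body) (s : Smooth V) : D V (s ⊗ₜ[ℝ] (1 : Grassmann e)) = 0 := by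
  have hconst : ∀ V (r : ℝ), D V (algebraMap ℝ (O V) r) = 0 := fun V r => by
    rw [Algebra.algebraMap_eq_smul_one, map_smul, hone, smul_zero]
  -- Each use of Hadamard's lemma at the image of `p` produces a factor `φ^* t_i - φ(p)_i`, which
  -- has no body at `p` and so raises the degree by one. The claim is needed for all open sets and
  -- functions at once because the lemma shrinks `V` and replaces `s` by the `g i`.
  have key : ∀ (k : ℕ) (V : Opens e.Body) (s : Smooth V) (p : preim φ.base V),
      evalAt p (D V (s ⊗ₜ[ℝ] (1 : Grassmann e))) ∈
        ExteriorAlgebra.degreeGE (Fin d.odd → ℝ) k := by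
    intro k
    induction k with
    | zero => intros; rw [ExteriorAlgebra.degreeGE_zero]; exact Submodule.mem_top
    | succ k ih =>
      intro V s p
      obtain ⟨W, h, hq, g, hg⟩ := exists_res_eq_add_sum s ⟨φ.base p, p.2⟩
      have h1 := congrArg (fun f => evalAt (⟨p.1, hq⟩ : preim φ.base W) (D W f)) hg
      simp only [hres, evalAt_res, map_add, map_sum, hconst, zero_add] at h1
      refine h1 ▸ Submodule.sum_mem _ fun i _ => ?_
      have h2 : D W ((evenCoord W i - algebraMap ℝ (O W) (φ.base p i)) *
          (g i ⊗ₜ[ℝ] (1 : Grassmann e))) =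
          (φ.pull W (evenCoord W i) - algebraMap ℝ _ (φ.base p i)) *
            D W (g i ⊗ₜ[ℝ] (1 : Grassmann e)) := by
        rw [sub_mul, map_sub, heven, sub_mul, ← Algebra.smul_def, map_smul, ← Algebra.smul_def]
      rw [h2, map_mul, add_comm k 1]
      refine ExteriorAlgebra.mul_mem_degreeGE (ExteriorAlgebra.mem_degreeGE_one ?_) (ih W (g i) _)
      rw [← bodyAt_apply, map_sub, bodyAt_pull_evenCoord, AlgHom.commutes]
      exact sub_self _
  exact ext_evalAt fun p => by
    -- The first degree beyond the top one.
    have := key (d.odd + 1) V s p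
    rwa [ExteriorAlgebra.degreeGE_eq_bot _ (Nat.lt_succ_self _), Submodule.mem_bot,
      ← map_zero (evalAt p)] at this

/-- A family of additive maps along a morphism of superdomains is zero if it is a derivation which
vanishes on the coordinates. -/
theorem eq_zero_of_coord {d e : SuperDomain} (φ : d ⟶ₛ e)
    (D : ∀ V : Opens e.Body, O V →ₗ[ℝ] O (preim φ.base V))
    (hres : ∀ (V W : Opens e.Body) (h : V ≤ W) (f : O W),
      D V (res h f) = res (preim_mono φ.base h) (D W f))
    (hone : ∀ V, D V 1 = 0)
    (heven : ∀ V i g, D V (evenCoord V i * g) = φ.pull V (evenCoord V i) * D V g) {c : ℝ}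
    (hodd : ∀ V j g, D V (oddCoord V j * g) = c • (φ.pull V (oddCoord V j) * D V g)) :
    ∀ V f, D V f = 0 := by
  have hsmooth := eq_zero_of_evenCoord φ D hres hone heven
  intro V f
  induction f using TensorProduct.induction_on with
  | zero => exact map_zero _
  | add x y hx hy => rw [map_add, hx, hy, add_zero]
  | tmul s l =>
    induction l using CliffordAlgebra.left_induction with
    | algebraMap r =>
      rw [Algebra.algebraMap_eq_smul_one, TensorProduct.tmul_smul, map_smul]
      exact (congrArg (r • ·) (hsmooth V s)).trans (smul_zero r)
    | add a b ha hb => rw [TensorProduct.tmul_add, map_add, ha, hb, add_zero]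
    | ι_mul a v ih =>
      -- The smooth factor commutes with the generators, so each odd coordinate can be pulled out to
      -- the left, where `hodd` applies.
      have hv : s ⊗ₜ[ℝ] (CliffordAlgebra.ι (0 : QuadraticForm ℝ (Fin e.odd → ℝ)) v * a) =
          ∑ j, v j • (oddCoord V j * s ⊗ₜ[ℝ] a) := by
        have h3 : (CliffordAlgebra.ι (0 : QuadraticForm ℝ (Fin e.odd → ℝ)) v) =
            ∑ j, v j • CliffordAlgebra.ι (0 : QuadraticForm ℝ (Fin e.odd → ℝ))
              (Pi.single j (1 : ℝ)) := by
          conv_lhs => rw [← Finset.univ_sum_single v, map_sum]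
          refine Finset.sum_congr rfl fun j _ => ?_
          rw [← map_smul, ← Pi.single_smul', smul_eq_mul, mul_one]
        rw [h3, Finset.sum_mul, TensorProduct.tmul_sum]
        refine Finset.sum_congr rfl fun j _ => ?_
        rw [oddCoord, Algebra.TensorProduct.tmul_mul_tmul, one_mul, smul_mul_assoc,
          TensorProduct.tmul_smul]
      rw [hv, map_sum]
      refine Finset.sum_eq_zero fun j _ => ?_
      rw [map_smul, hodd, ih, mul_zero, smul_zero, smul_zero]

/-- The pull-back of an even coordinate along a morphism. -/
def Hom.evenPull {d e : SuperDomain} (φ : d ⟶ₛ e) (i : Fin e.even) : O (⊤ : Opens d.Body) :=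
  φ.pull ⊤ (evenCoord ⊤ i)

/-- The pull-back of an odd coordinate along a morphism. -/
def Hom.oddPull {d e : SuperDomain} (φ : d ⟶ₛ e) (j : Fin e.odd) : O (⊤ : Opens d.Body) :=
  φ.pull ⊤ (oddCoord ⊤ j)

theorem pull_evenCoord {d e : SuperDomain} (φ : d ⟶ₛ e) (V : Opens e.Body) (i : Fin e.even) :
    φ.pull V (evenCoord V i) = res le_top (φ.evenPull i) := by
  rw [← res_evenCoord (le_top : V ≤ ⊤) i, φ.pull_res]
  rfl

theorem pull_oddCoord {d e : SuperDomain} (φ : d ⟶ₛ e) (V : Opens e.Body) (j : Fin e.odd) :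
    φ.pull V (oddCoord V j) = res le_top (φ.oddPull j) := by
  rw [← res_oddCoord (le_top : V ≤ ⊤) j, φ.pull_res]
  rfl

theorem base_apply {d e : SuperDomain} (φ : d ⟶ₛ e) (p : d.Body) (i : Fin e.even) :
    φ.base p i = bodyAt (⟨p, trivial⟩ : (⊤ : Opens d.Body)) (φ.evenPull i) :=
  (bodyAt_pull_evenCoord φ (V := ⊤) i ⟨p, trivial⟩).symm

/-- A morphism of superdomains is determined by the pull-backs of the coordinates. -/
theorem hom_ext_coord {d e : SuperDomain} {φ ψ : d ⟶ₛ e}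
    (heven : ∀ i, φ.evenPull i = ψ.evenPull i) (hodd : ∀ j, φ.oddPull j = ψ.oddPull j) :
    φ = ψ := by
  -- The map of bodies is not independent data: its components are the bodies of the pulled back
  -- even coordinates.
  have hbase : φ.base = ψ.base := ContinuousMap.ext fun p => funext fun i => by
    rw [base_apply, base_apply, heven]
  have hcoord := fun V i => (pull_evenCoord φ V i)
  have hcoord' := fun V i => (pull_evenCoord ψ V i)
  have hco := fun V i => (pull_oddCoord φ V i)
  have hco' := fun V i => (pull_oddCoord ψ V i)
  simp only [heven] at hcoord
  simp only [hodd] at hco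
  generalize ψ.evenPull = E at *
  generalize ψ.oddPull = Θ at *
  clear heven hodd
  obtain ⟨b, P, hP, hPr⟩ := φ
  obtain ⟨b', Q, hQ, hQr⟩ := ψ
  obtain rfl : b = b' := hbase
  -- For a coordinate `x` with `P x = Q x` one has `P (x g) - Q (x g) = P x (P g - Q g)`, so the
  -- difference vanishes by `eq_zero_of_coord` with `c = 1`.
  have h : ∀ V f, (P V).toLinearMap f - (Q V).toLinearMap f = 0 := by
    refine eq_zero_of_coord ⟨b, P, hP, hPr⟩
      (fun V => (P V).toLinearMap - (Q V).toLinearMap) ?_ ?_ ?_ (c := 1) ?_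
    · intro V W h f
      change P V (res h f) - Q V (res h f) = res _ (P W f - Q W f)
      rw [hPr, hQr, map_sub]
    · intro V
      change P V 1 - Q V 1 = 0
      rw [map_one, map_one, sub_self]
    · intro V i g
      change P V (evenCoord V i * g) - Q V (evenCoord V i * g) =
        P V (evenCoord V i) * (P V g - Q V g)
      rw [map_mul, map_mul, mul_sub]
      congr 2
      exact (hcoord' V i).trans (hcoord V i).symm
    · intro V j g
      change P V (oddCoord V j * g) - Q V (oddCoord V j * g) =
        (1 : ℝ) • (P V (oddCoord V j) * (P V g - Q V g))
      rw [one_smul, map_mul, map_mul, mul_sub]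
      congr 2
      exact (hco' V j).trans (hco V j).symm
  congr
  funext V
  exact AlgHom.ext fun f => sub_eq_zero.mp (h V f)

theorem smoothPartial_of_eq_coord {d : SuperDomain} {U : Opens d.Body} (i j : Fin d.even)
    (s : Smooth U) (hs : ∀ x : U, s x = x.1 j) (p : U) :
    smoothPartial i U s p = if i = j then 1 else 0 := by
  rw [smoothPartial_eq i _ (f := fun x => x j) p hs]
  have : fderiv ℝ (fun x : d.Body => x j) p.1 = ContinuousLinearMap.proj (R := ℝ) j :=
    (ContinuousLinearMap.proj (R := ℝ) (φ := fun _ : Fin d.even => ℝ) j).hasFDerivAt.fderiv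
  rw [this, ContinuousLinearMap.proj_apply, Pi.single_apply]
  simp only [eq_comm]

/-- A point of the body as a point of the largest open subset. -/
def topPt {d : SuperDomain} (p : d.Body) : (⊤ : Opens d.Body) := ⟨p, trivial⟩

/-! ### Morphisms with prescribed pull-backs of the coordinates -/

section Construction

variable {d e : SuperDomain} (φ : d.Body → e.Body) (hφ : ContDiff ℝ ∞ φ)
  (n : Fin e.even → O (⊤ : Opens d.Body)) (θ : Fin e.odd → O (⊤ : Opens d.Body))

/-- The first order Taylor expansion of `s (φ + n)`. -/
def taylorFun (V : Opens e.Body) (U : Opens d.Body) (h : ∀ x ∈ U, φ x ∈ V) (s : Smooth V) : O U :=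
  smoothPull φ hφ V U h s ⊗ₜ[ℝ] (1 : Grassmann d) +
    ∑ i, smoothPull φ hφ V U h (smoothPartial i V s) • res le_top (n i)

theorem evalAt_taylorFun (V : Opens e.Body) (U : Opens d.Body) (h : ∀ x ∈ U, φ x ∈ V)
    (s : Smooth V) (p : U) :
    evalAt p (taylorFun φ hφ n V U h s) = algebraMap ℝ _ (s ⟨φ p, h p p.2⟩) +
      ∑ i, smoothPartial i V s ⟨φ p, h p p.2⟩ • evalAt (topPt p.1) (n i) := by
  rw [taylorFun, map_add, map_sum, evalAt_tmul, ← Algebra.algebraMap_eq_smul_one]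
  congr 1
  refine Finset.sum_congr rfl fun i _ => ?_
  rw [evalAt_smul, evalAt_res]
  rfl

/-- The product of the two first order terms consists of multiples of the `n i * n j`, which vanish;
what remains is the Leibniz rule. -/
theorem taylorFun_mul (hnn : ∀ i j, n i * n j = 0) (V : Opens e.Body) (U : Opens d.Body)
    (h : ∀ x ∈ U, φ x ∈ V) (s t : Smooth V) :
    taylorFun φ hφ n V U h (s * t) = taylorFun φ hφ n V U h s * taylorFun φ hφ n V U h t :=
  ext_evalAt fun p => by
    rw [map_mul]
    simp only [evalAt_taylorFun, smoothPartial_mul]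
    set q : V := ⟨φ p, h p p.2⟩
    have hN : ∀ i j, evalAt (topPt p.1) (n i) *
        evalAt (topPt p.1) (n j) = 0 := fun i j => by rw [← map_mul, hnn, map_zero]
    have h0 : (∑ i, smoothPartial i V s q • evalAt (topPt p.1) (n i)) *
        ∑ i, smoothPartial i V t q • evalAt (topPt p.1) (n i) = 0 := by
      rw [Finset.sum_mul_sum]
      refine Finset.sum_eq_zero fun i _ => Finset.sum_eq_zero fun j _ => ?_
      rw [smul_mul_smul_comm, hN, smul_zero]
    rw [add_mul, mul_add, mul_add, h0, add_zero, ← Algebra.smul_def, ← Algebra.commutes,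
      ← Algebra.smul_def, ← Algebra.smul_def, Finset.smul_sum, Finset.smul_sum, add_assoc,
      ← Finset.sum_add_distrib]
    congr 1
    · rw [Algebra.smul_def, ← map_mul]
      rfl
    · refine Finset.sum_congr rfl fun i _ => ?_
      rw [smul_smul, smul_smul, ← add_smul]
      congr 1
      change smoothPartial i V s q * t q + s q * smoothPartial i V t q = _
      ring

theorem taylorFun_one (V : Opens e.Body) (U : Opens d.Body) (h : ∀ x ∈ U, φ x ∈ V) :
    taylorFun φ hφ n V U h 1 = 1 := ext_evalAt fun p => by
  refine Eq.trans ?_ (map_one (evalAt p)).symm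
  rw [evalAt_taylorFun]
  simp only [smoothPartial_one]
  exact (congrArg₂ (· + ·) (map_one (algebraMap ℝ (Grassmann d)))
    (Finset.sum_eq_zero fun i _ => zero_smul ℝ _)).trans (add_zero _)

/-- The algebra homomorphism `s ↦ s (φ + n)`. -/
def taylor (hnn : ∀ i j, n i * n j = 0) (V : Opens e.Body) (U : Opens d.Body)
    (h : ∀ x ∈ U, φ x ∈ V) : Smooth V →ₐ[ℝ] O U :=
  AlgHom.ofLinearMap
    { toFun := taylorFun φ hφ n V U h
      map_add' := fun s t => by
        simp only [taylorFun, map_add, TensorProduct.add_tmul, add_smul, Finset.sum_add_distrib]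
        abel
      map_smul' := fun r s => ext_evalAt fun p => by
        simp only [map_smul, evalAt_taylorFun, RingHom.id_apply, smul_add, Finset.smul_sum]
        congr 1
        · exact (congrArg (algebraMap ℝ _) rfl).trans
            ((map_mul (algebraMap ℝ (Grassmann d)) r _).trans (Algebra.smul_def _ _).symm)
        · refine Finset.sum_congr rfl fun i _ => ?_
          rw [smul_smul]; rfl }
    (taylorFun_one φ hφ n V U h)
    (taylorFun_mul φ hφ n hnn V U h)

theorem taylor_mem_parity (hn : ∀ i, n i ∈ parity ⊤ 0) (hnn : ∀ i j, n i * n j = 0)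
    (V : Opens e.Body) (U : Opens d.Body) (h : ∀ x ∈ U, φ x ∈ V) (s : Smooth V) :
    taylor φ hφ n hnn V U h s ∈ parity U 0 :=
  add_mem (tmul_one_mem_parity _) (sum_mem fun i _ => smul_mem_parity _ (res_mem_parity _ (hn i)))

theorem sum_smul_mem_parity (hθ : ∀ j, θ j ∈ parity ⊤ 1) (U : Opens d.Body)
    (v : Fin e.odd → ℝ) :
    (Pi.basisFun ℝ (Fin e.odd)).constr ℝ (fun j => res (le_top : U ≤ ⊤) (θ j)) v ∈
      parity U 1 := by
  rw [Module.Basis.constr_apply_fintype]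
  exact sum_mem fun j _ => Submodule.smul_mem _ _ (res_mem_parity _ (hθ j))

/-- The algebra homomorphism of the Grassmann algebra with `τ_j ↦ θ_j`. -/
def oddLift (hθ : ∀ j, θ j ∈ parity ⊤ 1) (U : Opens d.Body) : Grassmann e →ₐ[ℝ] O U :=
  ExteriorAlgebra.lift ℝ ⟨(Pi.basisFun ℝ (Fin e.odd)).constr ℝ
      fun j => res (le_top : U ≤ ⊤) (θ j),
    fun v => mul_self_eq_zero_of_mem_parity (sum_smul_mem_parity θ hθ U v)⟩

theorem oddLift_ι (hθ : ∀ j, θ j ∈ parity ⊤ 1) (U : Opens d.Body) (v : Fin e.odd → ℝ) :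
    oddLift θ hθ U (ExteriorAlgebra.ι ℝ v) =
      (Pi.basisFun ℝ (Fin e.odd)).constr ℝ (fun j => res (le_top : U ≤ ⊤) (θ j)) v :=
  ExteriorAlgebra.lift_ι_apply _ _ _ _

theorem res_oddLift (hθ : ∀ j, θ j ∈ parity ⊤ 1) {U W : Opens d.Body} (h : U ≤ W)
    (l : Grassmann e) : res h (oddLift θ hθ W l) = oddLift θ hθ U l := by
  have : (res h).comp (oddLift θ hθ W) = oddLift θ hθ U := by
    refine ExteriorAlgebra.hom_ext (LinearMap.ext fun v => ?_)
    change res h (oddLift θ hθ W (ExteriorAlgebra.ι ℝ v)) =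
      oddLift θ hθ U (ExteriorAlgebra.ι ℝ v)
    rw [oddLift_ι, oddLift_ι, Module.Basis.constr_apply_fintype,
      Module.Basis.constr_apply_fintype, map_sum]
    refine Finset.sum_congr rfl fun j _ => ?_
    rw [map_smul]
    congr 1
    exact ext_evalAt fun p => by simp
  exact DFunLike.congr_fun this l

theorem invol_oddLift (hθ : ∀ j, θ j ∈ parity ⊤ 1) (U : Opens d.Body) (l : Grassmann e) :
    invol U (oddLift θ hθ U l) = oddLift θ hθ U (involute l) := by
  have : (invol U).comp (oddLift θ hθ U) = (oddLift θ hθ U).comp involute := by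
    refine ExteriorAlgebra.hom_ext (LinearMap.ext fun v => ?_)
    change invol U (oddLift θ hθ U (ExteriorAlgebra.ι ℝ v)) =
      oddLift θ hθ U (involute (CliffordAlgebra.ι _ v))
    rw [CliffordAlgebra.involute_ι, map_neg]
    change _ = -oddLift θ hθ U (ExteriorAlgebra.ι ℝ v)
    rw [oddLift_ι, mem_parity_iff_invol.mp (sum_smul_mem_parity θ hθ U v), koszul_one_one,
      superfunction_neg_one_smul]
  exact DFunLike.congr_fun this l

theorem base_mem (V : Opens e.Body) (x : d.Body)
    (h : x ∈ preim (⟨φ, hφ.continuous⟩ : C(d.Body, e.Body)) V) : φ x ∈ V := h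

/-- The pull-back of superfunctions along the morphism with `t_i ↦ φ_i + n_i` and `τ_j ↦ θ_j`. -/
def pullMk (hn : ∀ i, n i ∈ parity ⊤ 0) (hnn : ∀ i j, n i * n j = 0)
    (hθ : ∀ j, θ j ∈ parity ⊤ 1) (V : Opens e.Body) (U : Opens d.Body) (h : ∀ x ∈ U, φ x ∈ V) :
    O V →ₐ[ℝ] O U :=
  Algebra.TensorProduct.lift (taylor φ hφ n hnn V U h) (oddLift θ hθ U)
    fun s _ => commute_of_mem_parity (taylor_mem_parity φ hφ n hn hnn V U h s) _

theorem pullMk_tmul (hn : ∀ i, n i ∈ parity ⊤ 0) (hnn : ∀ i j, n i * n j = 0)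
    (hθ : ∀ j, θ j ∈ parity ⊤ 1) (V : Opens e.Body) (U : Opens d.Body) (h : ∀ x ∈ U, φ x ∈ V)
    (s : Smooth V) (l : Grassmann e) :
    pullMk φ hφ n θ hn hnn hθ V U h (s ⊗ₜ[ℝ] l) =
      taylorFun φ hφ n V U h s * oddLift θ hθ U l :=
  Algebra.TensorProduct.lift_tmul _ _ _ _ _

theorem invol_pullMk (hn : ∀ i, n i ∈ parity ⊤ 0) (hnn : ∀ i j, n i * n j = 0)
    (hθ : ∀ j, θ j ∈ parity ⊤ 1) (V : Opens e.Body) (U : Opens d.Body) (h : ∀ x ∈ U, φ x ∈ V)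
    (f : O V) : invol U (pullMk φ hφ n θ hn hnn hθ V U h f) =
      pullMk φ hφ n θ hn hnn hθ V U h (invol V f) := by
  induction f using TensorProduct.induction_on with
  | zero => simp
  | add x y hx hy => simp only [map_add, hx, hy]
  | tmul s l =>
    have hs : invol U (taylorFun φ hφ n V U h s) = koszul 0 1 • taylorFun φ hφ n V U h s :=
      mem_parity_iff_invol.mp (taylor_mem_parity φ hφ n hn hnn V U h s)
    rw [invol_tmul, pullMk_tmul, pullMk_tmul, map_mul, invol_oddLift, hs, koszul_zero_left,
      one_smul]

theorem res_pullMk (hn : ∀ i, n i ∈ parity ⊤ 0) (hnn : ∀ i j, n i * n j = 0)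
    (hθ : ∀ j, θ j ∈ parity ⊤ 1) {V V' : Opens e.Body} {U U' : Opens d.Body}
    (h : ∀ x ∈ U, φ x ∈ V) (h' : ∀ x ∈ U', φ x ∈ V') (hV : V ≤ V') (hU : U ≤ U') (f : O V') :
    pullMk φ hφ n θ hn hnn hθ V U h (res hV f) =
      res hU (pullMk φ hφ n θ hn hnn hθ V' U' h' f) := by
  induction f using TensorProduct.induction_on with
  | zero => simp
  | add x y hx hy => simp only [map_add, hx, hy]
  | tmul s l =>
    rw [pullMk_tmul, map_mul, res_oddLift]
    refine (pullMk_tmul φ hφ n θ hn hnn hθ V U h _ _).trans ?_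
    congr 1
    refine ext_evalAt fun p => ?_
    rw [evalAt_res]
    refine (evalAt_taylorFun φ hφ n V U h (smoothPull id contDiff_id V' V hV s) p).trans ?_
    rw [evalAt_taylorFun]
    simp only [smoothPartial_pull]
    rfl

/-- The morphism of superdomains with `t_i ↦ φ_i + n_i` and `τ_j ↦ θ_j`. -/
def homMk (hn : ∀ i, n i ∈ parity ⊤ 0) (hnn : ∀ i j, n i * n j = 0)
    (hθ : ∀ j, θ j ∈ parity ⊤ 1) : d ⟶ₛ e where
  base := ⟨φ, hφ.continuous⟩
  pull V := pullMk φ hφ n θ hn hnn hθ V _ (base_mem φ hφ V)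
  pull_parity V i f hf := by
    rw [mem_parity_iff_invol] at *
    rw [invol_pullMk, hf, map_smul]
  pull_res V W h f := res_pullMk φ hφ n θ hn hnn hθ _ _ h _ f

theorem evalAt_homMk_pull (hn : ∀ i, n i ∈ parity ⊤ 0) (hnn : ∀ i j, n i * n j = 0)
    (hθ : ∀ j, θ j ∈ parity ⊤ 1) (V : Opens e.Body) (s : Smooth V)
    (p : preim (homMk φ hφ n θ hn hnn hθ).base V) :
    evalAt p ((homMk φ hφ n θ hn hnn hθ).pull V (s ⊗ₜ[ℝ] (1 : Grassmann e))) =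
      algebraMap ℝ _ (s ⟨φ p, p.2⟩) +
      ∑ i, smoothPartial i V s ⟨φ p, p.2⟩ • evalAt (topPt p.1) (n i) := by
  refine (congrArg (evalAt p) (pullMk_tmul φ hφ n θ hn hnn hθ V _ (base_mem φ hφ V) s 1)).trans ?_
  rw [map_one, mul_one]
  exact evalAt_taylorFun φ hφ n V _ (base_mem φ hφ V) s p

theorem homMk_evenPull (hn : ∀ i, n i ∈ parity ⊤ 0) (hnn : ∀ i j, n i * n j = 0)
    (hθ : ∀ j, θ j ∈ parity ⊤ 1) (i : Fin e.even) (p : (⊤ : Opens d.Body)) :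
    evalAt p ((homMk φ hφ n θ hn hnn hθ).evenPull i) =
      algebraMap ℝ _ (φ p i) + evalAt p (n i) := by
  refine (evalAt_homMk_pull φ hφ n θ hn hnn hθ ⊤ _ p).trans ?_
  congr 1
  have h : ∀ j, smoothPartial j ⊤ _ _ = if j = i then (1 : ℝ) else 0 := fun j =>
    smoothPartial_of_eq_coord (d := e) (U := ⊤) j i
      ⟨fun x => x.1 i, (contDiff_apply ℝ ℝ i).contMDiff.comp contMDiff_subtype_val⟩
      (fun _ => rfl) ⟨φ p, trivial⟩
  rw [Finset.sum_eq_single i]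
  · refine (congrArg (· • evalAt p (n i)) (h i)).trans ?_
    rw [if_pos rfl, one_smul]
  · intro j _ hj
    refine (congrArg (· • evalAt p (n j)) (h j)).trans ?_
    rw [if_neg hj, zero_smul]
  · exact fun h => absurd (Finset.mem_univ _) h

theorem homMk_oddPull (hn : ∀ i, n i ∈ parity ⊤ 0) (hnn : ∀ i j, n i * n j = 0)
    (hθ : ∀ j, θ j ∈ parity ⊤ 1) (j : Fin e.odd) :
    (homMk φ hφ n θ hn hnn hθ).oddPull j = θ j := by
  have hmem : ∀ x ∈ (⊤ : Opens d.Body), φ x ∈ (⊤ : Opens e.Body) := fun _ _ => trivial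
  refine (pullMk_tmul φ hφ n θ hn hnn hθ ⊤ ⊤ hmem 1 _).trans ?_
  rw [taylorFun_one, one_mul, oddLift_ι]
  have h : (Pi.single j (1 : ℝ) : Fin e.odd → ℝ) = Pi.basisFun ℝ (Fin e.odd) j := by simp
  rw [h, Module.Basis.constr_basis]
  exact ext_evalAt fun p => evalAt_res _ _ _

end Construction

/-- Morphisms into a superdomain exist with given pull-backs of the coordinates. -/
theorem exists_hom {d e : SuperDomain} (hd : d.odd ≤ 3) (F : Fin e.even → O (⊤ : Opens d.Body))
    (θ : Fin e.odd → O (⊤ : Opens d.Body)) (hF : ∀ i, F i ∈ parity ⊤ 0)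
    (hθ : ∀ j, θ j ∈ parity ⊤ 1) :
    ∃ φ : d ⟶ₛ e, (∀ i, φ.evenPull i = F i) ∧ (∀ j, φ.oddPull j = θ j) ∧
      ∀ (V : Opens e.Body) (s : Smooth V) (p : preim φ.base V),
        evalAt p (φ.pull V (s ⊗ₜ[ℝ] (1 : Grassmann e))) =
          algebraMap ℝ _ (s ⟨φ.base p, p.2⟩) +
          ∑ i, smoothPartial i V s ⟨φ.base p, p.2⟩ •
            (evalAt (topPt p.1) (F i) - algebraMap ℝ _ (φ.base p i)) := by
  -- `F i` is split into its body, which gives the map of bodies, and the nilpotent rest `n i`, in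
  -- which Taylor's formula stops after the first order.
  let φ : d.Body → e.Body := fun x i => bodyMap ⊤ (F i) (topPt x)
  have hφ : ContDiff ℝ ∞ φ := contDiff_pi.mpr fun i => contDiff_iff_contDiffAt.mpr fun x => by
    have h := contDiffAt_ext0 (bodyMap ⊤ (F i)) (topPt x)
    have h2 : ext0 (bodyMap ⊤ (F i)) = fun x => φ x i :=
      funext fun y => ext0_apply (bodyMap ⊤ (F i)) (topPt y)
    rwa [h2] at h
  let n : Fin e.even → O (⊤ : Opens d.Body) := fun i =>
    F i - bodyMap ⊤ (F i) ⊗ₜ[ℝ] (1 : Grassmann d)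
  have hev : ∀ i p, evalAt p (n i) = evalAt p (F i) - algebraMap ℝ _ (φ p.1 i) := fun i p => by
    rw [map_sub, evalAt_tmul, ← Algebra.algebraMap_eq_smul_one]
    rfl
  have hn : ∀ i, n i ∈ parity ⊤ 0 := fun i => sub_mem (hF i) (tmul_one_mem_parity _)
  have hn0 : ∀ i p, bodyAt p (n i) = 0 := fun i p => by
    rw [bodyAt_apply, hev, map_sub, algebraMapInv_algebraMap]
    exact sub_eq_zero.mpr (bodyMap_apply (F i) p).symm
  have hnn : ∀ i j, n i * n j = 0 := fun i j =>
    mul_eq_zero_of_nilpotent hd (hn i) (hn0 i) (hn j) (hn0 j)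
  refine ⟨homMk φ hφ n θ hn hnn hθ, fun i => ext_evalAt fun p => ?_,
    homMk_oddPull φ hφ n θ hn hnn hθ, fun V s p => ?_⟩
  · rw [homMk_evenPull, hev, add_sub_cancel]
  · rw [evalAt_homMk_pull]
    simp only [hev]
    rfl

theorem oddPull_mem_parity {d e : SuperDomain} (φ : d ⟶ₛ e) (j : Fin e.odd) :
    φ.oddPull j ∈ parity ⊤ 1 := φ.pull_parity ⊤ 1 _ (oddCoord_mem_parity j)

theorem evenPull_mem_parity {d e : SuperDomain} (φ : d ⟶ₛ e) (i : Fin e.even) :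
    φ.evenPull i ∈ parity ⊤ 0 := φ.pull_parity ⊤ 0 _ (evenCoord_mem_parity i)

/-- Taylor's formula for the pull-back of smooth functions. -/
theorem evalAt_pull_tmul_one {d e : SuperDomain} (hd : d.odd ≤ 3) (φ : d ⟶ₛ e) (V : Opens e.Body)
    (s : Smooth V) (p : preim φ.base V) :
    evalAt p (φ.pull V (s ⊗ₜ[ℝ] (1 : Grassmann e))) = algebraMap ℝ _ (s ⟨φ.base p, p.2⟩) +
      ∑ i, smoothPartial i V s ⟨φ.base p, p.2⟩ •
        (evalAt (topPt p.1) (φ.evenPull i) - algebraMap ℝ _ (φ.base p i)) := by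
  -- The morphism constructed from the coordinates of `φ` obeys the formula, and by uniqueness it is
  -- `φ`.
  obtain ⟨ψ, h0, h1, h⟩ := exists_hom hd φ.evenPull φ.oddPull (evenPull_mem_parity φ)
    (oddPull_mem_parity φ)
  obtain rfl : ψ = φ := hom_ext_coord h0 h1
  exact h V s p

/-! ### Composition and coordinate maps -/

/-- The pull-back of global superfunctions. -/
def Hom.pullTop {d e : SuperDomain} (φ : d ⟶ₛ e) :
    O (⊤ : Opens e.Body) →ₐ[ℝ] O (⊤ : Opens d.Body) := φ.pull ⊤

theorem comp_pullTop {d e k : SuperDomain} (φ : d ⟶ₛ e) (ψ : e ⟶ₛ k) (f : O (⊤ : Opens k.Body)) :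
    (φ ⋙ₛ ψ).pullTop f = φ.pullTop (ψ.pullTop f) := rfl

theorem comp_evenPull {d e k : SuperDomain} (φ : d ⟶ₛ e) (ψ : e ⟶ₛ k) (i : Fin k.even) :
    (φ ⋙ₛ ψ).evenPull i = φ.pullTop (ψ.evenPull i) := rfl

theorem comp_oddPull {d e k : SuperDomain} (φ : d ⟶ₛ e) (ψ : e ⟶ₛ k) (j : Fin k.odd) :
    (φ ⋙ₛ ψ).oddPull j = φ.pullTop (ψ.oddPull j) := rfl

theorem pullTop_evenCoord {d e : SuperDomain} (φ : d ⟶ₛ e) (i : Fin e.even) :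
    φ.pullTop (evenCoord ⊤ i) = φ.evenPull i := rfl

theorem pullTop_oddCoord {d e : SuperDomain} (φ : d ⟶ₛ e) (j : Fin e.odd) :
    φ.pullTop (oddCoord ⊤ j) = φ.oddPull j := rfl

theorem grassmannMap_ι {d e : SuperDomain} (κ : Fin e.odd → Fin d.odd) (j : Fin e.odd) :
    grassmannMap κ (ExteriorAlgebra.ι ℝ (Pi.single j (1 : ℝ))) =
      ExteriorAlgebra.ι ℝ (Pi.single (κ j) (1 : ℝ)) := by
  have h : (Pi.single j (1 : ℝ) : Fin e.odd → ℝ) = Pi.basisFun ℝ (Fin e.odd) j := by simp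
  rw [grassmannMap, ExteriorAlgebra.map_apply_ι, h, Module.Basis.constr_basis]

theorem coordMap_pull_tmul {d e : SuperDomain} (ι : Fin e.even → Fin d.even)
    (κ : Fin e.odd → Fin d.odd) (V : Opens e.Body) (s : Smooth V) (l : Grassmann e) :
    (coordMap ι κ : d ⟶ₛ e).pull V (s ⊗ₜ[ℝ] l) =
      smoothPull (fun x i => x (ι i)) (by fun_prop) V
        (preim (coordMap ι κ : d ⟶ₛ e).base V) (fun _ h => h) s ⊗ₜ[ℝ] grassmannMap κ l := rfl

theorem coordMap_pull_evenCoord {d e : SuperDomain} (ι : Fin e.even → Fin d.even)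
    (κ : Fin e.odd → Fin d.odd) (V : Opens e.Body) (i : Fin e.even) :
    (coordMap ι κ : d ⟶ₛ e).pull V (evenCoord V i) = evenCoord _ (ι i) := by
  refine (coordMap_pull_tmul ι κ V _ _).trans ?_
  rw [map_one]
  rfl

theorem coordMap_pull_oddCoord {d e : SuperDomain} (ι : Fin e.even → Fin d.even)
    (κ : Fin e.odd → Fin d.odd) (V : Opens e.Body) (j : Fin e.odd) :
    (coordMap ι κ : d ⟶ₛ e).pull V (oddCoord V j) = oddCoord _ (κ j) := by
  refine (coordMap_pull_tmul ι κ V _ _).trans ?_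
  rw [map_one, grassmannMap_ι]
  rfl

theorem coordMap_evenPull {d e : SuperDomain} (ι : Fin e.even → Fin d.even)
    (κ : Fin e.odd → Fin d.odd) (i : Fin e.even) :
    (coordMap ι κ : d ⟶ₛ e).evenPull i = evenCoord ⊤ (ι i) :=
  coordMap_pull_evenCoord ι κ ⊤ i

theorem coordMap_oddPull {d e : SuperDomain} (ι : Fin e.even → Fin d.even)
    (κ : Fin e.odd → Fin d.odd) (j : Fin e.odd) :
    (coordMap ι κ : d ⟶ₛ e).oddPull j = oddCoord ⊤ (κ j) :=
  coordMap_pull_oddCoord ι κ ⊤ j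

theorem even_mul_odd_mem_parity {d : SuperDomain} {U : Opens d.Body} {x y : O U}
    (hx : x ∈ parity U 0) (hy : y ∈ parity U 1) : x * y ∈ parity U 1 :=
  zero_add (1 : ZMod 2) ▸ mul_mem_parity hx hy

theorem odd_mul_odd_mem_parity {d : SuperDomain} {U : Opens d.Body} {x y : O U}
    (hx : x ∈ parity U 1) (hy : y ∈ parity U 1) : x * y ∈ parity U 0 :=
  (show (1 : ZMod 2) + 1 = 0 from rfl) ▸ mul_mem_parity hx hy

theorem superfunction_neg_mul {d : SuperDomain} {U : Opens d.Body} (x y : O U) :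
    -x * y = -(x * y) := neg_mul x y

theorem superfunction_mul_neg {d : SuperDomain} {U : Opens d.Body} (x y : O U) :
    x * -y = -(x * y) := mul_neg x y

/-! ### Products -/

theorem comp_fst_evenPull {T d e : SuperDomain} (h : T ⟶ₛ prod d e) (i : Fin d.even) :
    (h ⋙ₛ fst d e).evenPull i = h.evenPull (Fin.castAdd e.even i) := by
  rw [comp_evenPull, fst, coordMap_evenPull, pullTop_evenCoord]

theorem comp_fst_oddPull {T d e : SuperDomain} (h : T ⟶ₛ prod d e) (i : Fin d.odd) :
    (h ⋙ₛ fst d e).oddPull i = h.oddPull (Fin.castAdd e.odd i) := by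
  rw [comp_oddPull, fst, coordMap_oddPull, pullTop_oddCoord]

theorem comp_snd_evenPull {T d e : SuperDomain} (h : T ⟶ₛ prod d e) (i : Fin e.even) :
    (h ⋙ₛ snd d e).evenPull i = h.evenPull (Fin.natAdd d.even i) := by
  rw [comp_evenPull, snd, coordMap_evenPull, pullTop_evenCoord]

theorem comp_snd_oddPull {T d e : SuperDomain} (h : T ⟶ₛ prod d e) (i : Fin e.odd) :
    (h ⋙ₛ snd d e).oddPull i = h.oddPull (Fin.natAdd d.odd i) := by
  rw [comp_oddPull, snd, coordMap_oddPull, pullTop_oddCoord]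

theorem prod_hom_ext {T d e : SuperDomain} {h k : T ⟶ₛ prod d e}
    (hfst : h ⋙ₛ fst d e = k ⋙ₛ fst d e) (hsnd : h ⋙ₛ snd d e = k ⋙ₛ snd d e) : h = k := by
  refine hom_ext_coord (fun i => ?_) fun j => ?_
  · refine Fin.addCases (fun i => ?_) (fun i => ?_) i
    · rw [← comp_fst_evenPull, hfst, comp_fst_evenPull]
    · rw [← comp_snd_evenPull, hsnd, comp_snd_evenPull]
  · refine Fin.addCases (fun i => ?_) (fun i => ?_) j
    · rw [← comp_fst_oddPull, hfst, comp_fst_oddPull]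
    · rw [← comp_snd_oddPull, hsnd, comp_snd_oddPull]

theorem exists_pair {T d e : SuperDomain} (hT : T.odd ≤ 3) (x : T ⟶ₛ d) (y : T ⟶ₛ e) :
    ∃ h : T ⟶ₛ prod d e, h ⋙ₛ fst d e = x ∧ h ⋙ₛ snd d e = y := by
  obtain ⟨h, h0, h1, -⟩ := exists_hom (e := prod d e) hT
    (Fin.addCases x.evenPull y.evenPull) (Fin.addCases x.oddPull y.oddPull)
    (fun i => by
      refine Fin.addCases (fun i => ?_) (fun i => ?_) i
      · rw [Fin.addCases_left]; exact evenPull_mem_parity x i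
      · rw [Fin.addCases_right]; exact evenPull_mem_parity y i)
    (fun j => by
      refine Fin.addCases (fun i => ?_) (fun i => ?_) j
      · rw [Fin.addCases_left]; exact oddPull_mem_parity x i
      · rw [Fin.addCases_right]; exact oddPull_mem_parity y i)
  refine ⟨h, hom_ext_coord (fun i => ?_) fun i => ?_, hom_ext_coord (fun i => ?_) fun i => ?_⟩
  · rw [comp_fst_evenPull, h0, Fin.addCases_left]
  · rw [comp_fst_oddPull, h1, Fin.addCases_left]
  · rw [comp_snd_evenPull, h0, Fin.addCases_right]
  · rw [comp_snd_oddPull, h1, Fin.addCases_right]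

/-- The morphism `(x, y)` into a product. -/
def pair {T d e : SuperDomain} (hT : T.odd ≤ 3) (x : T ⟶ₛ d) (y : T ⟶ₛ e) : T ⟶ₛ prod d e :=
  (exists_pair hT x y).choose

theorem pair_fst {T d e : SuperDomain} (hT : T.odd ≤ 3) (x : T ⟶ₛ d) (y : T ⟶ₛ e) :
    pair hT x y ⋙ₛ fst d e = x := (exists_pair hT x y).choose_spec.1

theorem pair_snd {T d e : SuperDomain} (hT : T.odd ≤ 3) (x : T ⟶ₛ d) (y : T ⟶ₛ e) :
    pair hT x y ⋙ₛ snd d e = y := (exists_pair hT x y).choose_spec.2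

theorem pair_evenPull_castAdd {T d e : SuperDomain} (hT : T.odd ≤ 3) (x : T ⟶ₛ d) (y : T ⟶ₛ e)
    (i : Fin d.even) : (pair hT x y).evenPull (Fin.castAdd e.even i) = x.evenPull i := by
  rw [← comp_fst_evenPull, pair_fst]

theorem pair_oddPull_castAdd {T d e : SuperDomain} (hT : T.odd ≤ 3) (x : T ⟶ₛ d) (y : T ⟶ₛ e)
    (i : Fin d.odd) : (pair hT x y).oddPull (Fin.castAdd e.odd i) = x.oddPull i := by
  rw [← comp_fst_oddPull, pair_fst]

theorem pair_evenPull_natAdd {T d e : SuperDomain} (hT : T.odd ≤ 3) (x : T ⟶ₛ d) (y : T ⟶ₛ e)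
    (i : Fin e.even) : (pair hT x y).evenPull (Fin.natAdd d.even i) = y.evenPull i := by
  rw [← comp_snd_evenPull, pair_snd]

theorem pair_oddPull_natAdd {T d e : SuperDomain} (hT : T.odd ≤ 3) (x : T ⟶ₛ d) (y : T ⟶ₛ e)
    (i : Fin e.odd) : (pair hT x y).oddPull (Fin.natAdd d.odd i) = y.oddPull i := by
  rw [← comp_snd_oddPull, pair_snd]

/-- The product of morphisms `x, y : T → G`. -/
def mulHom {G T : SuperDomain} (μ : prod G G ⟶ₛ G) (hT : T.odd ≤ 3) (x y : T ⟶ₛ G) : T ⟶ₛ G :=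
  pair hT x y ⋙ₛ μ

/-- Since pairs exist and are unique, the relation is the graph of an operation on `T`-points, and
the group axioms become identities for this operation. -/
theorem mulEq_iff {G T : SuperDomain} (μ : prod G G ⟶ₛ G) (hT : T.odd ≤ 3) (x y z : T ⟶ₛ G) :
    MulEq μ x y z ↔ mulHom μ hT x y = z := by
  constructor
  · rintro ⟨h, ⟨⟨h1, h2⟩, -⟩, rfl⟩
    have : pair hT x y = h :=
      prod_hom_ext ((pair_fst hT x y).trans h1.symm) ((pair_snd hT x y).trans h2.symm)
    rw [mulHom, this]
  · rintro rfl
    exact ⟨pair hT x y, ⟨⟨pair_fst hT x y, pair_snd hT x y⟩, fun h' h1 h2 =>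
      prod_hom_ext (h1.trans (pair_fst hT x y).symm) (h2.trans (pair_snd hT x y).symm)⟩, rfl⟩

/-! ### The multiplication of `ℝ^{1|1}` -/

theorem contDiff_exp_coord {d : SuperDomain} (b : ℝ) (i : Fin d.even) :
    ContDiff ℝ ∞ fun x : d.Body => Real.exp (b * x i) := by fun_prop

/-- The superfunction `e^{b t_i}`. -/
def expCoord {d : SuperDomain} (b : ℝ) (i : Fin d.even) (U : Opens d.Body) : O U :=
  ofSmooth (fun x => Real.exp (b * x i)) (contDiff_exp_coord b i) U

theorem evalAt_expCoord {d : SuperDomain} (b : ℝ) (i : Fin d.even) {U : Opens d.Body} (p : U) :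
    evalAt p (expCoord b i U) = algebraMap ℝ _ (Real.exp (b * p.1 i)) := evalAt_ofSmooth _ _ _

theorem smoothPartial_exp {d : SuperDomain} {U : Opens d.Body} (b : ℝ) (i j : Fin d.even)
    (s : Smooth U) (hs : ∀ x : U, s x = Real.exp (b * x.1 j)) (p : U) :
    smoothPartial i U s p = if i = j then b * Real.exp (b * p.1 j) else 0 := by
  rw [smoothPartial_eq i _ (f := fun x => Real.exp (b * x j)) p hs]
  have h := ((ContinuousLinearMap.proj (R := ℝ) (φ := fun _ : Fin d.even => ℝ)
    j).hasFDerivAt (x := p.1)).const_mul b |>.exp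
  simp only [ContinuousLinearMap.proj_apply] at h
  rw [h.fderiv]
  simp only [smul_apply, ContinuousLinearMap.proj_apply, smul_eq_mul,
    Pi.single_apply, eq_comm (a := j)]
  split_ifs <;> ring

/-- The condition on the body is automatic: the body of `μ^* t` is `t₁ + t₂`, the product `τ₁ τ₂`
having none. -/
theorem isMu_iff {a b : ℝ} {μ : prod R11 R11 ⟶ₛ R11} :
    IsMu a b μ ↔ μ.evenPull 0 =
      evenCoord ⊤ 0 + evenCoord ⊤ 1 + a • (oddCoord ⊤ 0 * oddCoord ⊤ 1) ∧
      μ.oddPull 0 = oddCoord ⊤ 0 + expCoord b 0 ⊤ * oddCoord ⊤ 1 := by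
  refine ⟨fun h => h.2, fun h => ⟨fun x => ?_, h⟩⟩
  rw [base_apply, h.1, bodyAt_apply]
  simp only [map_add, map_smul, map_mul, evalAt_evenCoord, evalAt_oddCoord,
    algebraMapInv_algebraMap, algebraMapInv_ι, mul_zero, smul_zero, add_zero]

theorem exists_isMu (a b : ℝ) : ∃ μ, IsMu a b μ := by
  obtain ⟨μ, h0, h1, -⟩ := exists_hom (d := prod R11 R11) (e := R11) (by decide)
    (fun _ => evenCoord ⊤ 0 + evenCoord ⊤ 1 + a • (oddCoord ⊤ 0 * oddCoord ⊤ 1))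
    (fun _ => oddCoord ⊤ 0 + expCoord b 0 ⊤ * oddCoord ⊤ 1)
    (fun _ => add_mem (add_mem (evenCoord_mem_parity _) (evenCoord_mem_parity _))
      (Submodule.smul_mem _ _
        (odd_mul_odd_mem_parity (oddCoord_mem_parity _) (oddCoord_mem_parity _))))
    (fun _ => add_mem (oddCoord_mem_parity _)
      (even_mul_odd_mem_parity (tmul_one_mem_parity _) (oddCoord_mem_parity _)))
  exact ⟨μ, isMu_iff.mpr ⟨h0 0, h1 0⟩⟩

theorem hom_ext_R11 {T : SuperDomain} {x y : T ⟶ₛ R11} (h0 : x.evenPull 0 = y.evenPull 0)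
    (h1 : x.oddPull 0 = y.oddPull 0) : x = y :=
  hom_ext_coord (fun i => by rwa [Subsingleton.elim i 0]) fun j => by rwa [Subsingleton.elim j 0]

theorem IsMu.unique {a b : ℝ} {μ ν : prod R11 R11 ⟶ₛ R11} (hμ : IsMu a b μ) (hν : IsMu a b ν) :
    ν = μ :=
  hom_ext_R11 ((isMu_iff.mp hν).1.trans (isMu_iff.mp hμ).1.symm)
    ((isMu_iff.mp hν).2.trans (isMu_iff.mp hμ).2.symm)

/-! ### The group law on `T`-points -/

section Group

variable {a b : ℝ} {μ : prod R11 R11 ⟶ₛ R11} {T : SuperDomain} (hT : T.odd ≤ 3)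

/-- The superfunction `e^{b t}` pulled back along a morphism. -/
def expPull (b : ℝ) (x : T ⟶ₛ R11) : O (⊤ : Opens T.Body) := x.pullTop (expCoord b 0 ⊤)

/-- `e^{b t₁}` on the product is the pull-back of `e^{b t}` along the first projection. -/
theorem pair_pullTop_expCoord (x y : T ⟶ₛ R11) :
    (pair hT x y).pullTop (expCoord b 0 ⊤) = expPull b x := by
  have h := comp_pullTop (pair hT x y) (fst R11 R11) (expCoord b 0 ⊤)
  rw [pair_fst] at h
  refine Eq.trans ?_ h.symm
  congr 1
  exact (coordMap_pull_tmul _ _ ⊤ _ _).trans (by rw [map_one]; rfl) |>.symm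

theorem mulHom_evenPull (hμ : IsMu a b μ) (x y : T ⟶ₛ R11) :
    (mulHom μ hT x y).evenPull 0 =
      x.evenPull 0 + y.evenPull 0 + a • (x.oddPull 0 * y.oddPull 0) := by
  rw [mulHom, comp_evenPull, (isMu_iff.mp hμ).1, map_add, map_add, map_smul, map_mul,
    pullTop_evenCoord, pullTop_evenCoord, pullTop_oddCoord, pullTop_oddCoord]
  exact congrArg₂ (· + ·) (congrArg₂ (· + ·) (pair_evenPull_castAdd hT x y 0)
    (pair_evenPull_natAdd hT x y 0)) (congrArg (a • ·) (congrArg₂ (· * ·)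
    (pair_oddPull_castAdd hT x y 0) (pair_oddPull_natAdd hT x y 0)))

theorem mulHom_oddPull (hμ : IsMu a b μ) (x y : T ⟶ₛ R11) :
    (mulHom μ hT x y).oddPull 0 = x.oddPull 0 + expPull b x * y.oddPull 0 := by
  rw [mulHom, comp_oddPull, (isMu_iff.mp hμ).2, map_add, map_mul,
    pair_pullTop_expCoord, pullTop_oddCoord, pullTop_oddCoord]
  exact congrArg₂ (· + ·) (pair_oddPull_castAdd hT x y 0)
    (congrArg (expPull b x * ·) (pair_oddPull_natAdd hT x y 0))

/-- Taylor's formula for the exponential: `e^{b(r + n)} = e^{br} (1 + b n)`, with `r` the body and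
`n` the nilpotent part. -/
theorem evalAt_expPull (hT : T.odd ≤ 3) (x : T ⟶ₛ R11) (p : (⊤ : Opens T.Body)) :
    evalAt p (expPull b x) = Real.exp (b * bodyAt p (x.evenPull 0)) •
      (1 + b • (evalAt p (x.evenPull 0) - algebraMap ℝ _ (bodyAt p (x.evenPull 0)))) := by
  have h := evalAt_pull_tmul_one hT x ⊤ (⟨fun x => Real.exp (b * x.1 0),
    (contDiff_exp_coord (d := R11) b 0).contMDiff.comp contMDiff_subtype_val⟩ :
      Smooth (⊤ : Opens R11.Body)) p
  refine h.trans ?_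
  have hd := smoothPartial_exp (d := R11) (U := ⊤) b 0 0 ⟨fun x => Real.exp (b * x.1 0),
    (contDiff_exp_coord (d := R11) b 0).contMDiff.comp contMDiff_subtype_val⟩ (fun _ => rfl)
    ⟨x.base p, trivial⟩
  rw [if_pos rfl] at hd
  have hb : x.base p 0 = bodyAt p (x.evenPull 0) := base_apply x p 0
  rw [← hb, smul_add, smul_smul, mul_comm _ b]
  refine congrArg₂ (· + ·) (Algebra.algebraMap_eq_smul_one _) ?_
  refine (Fin.sum_univ_one _).trans ?_
  exact congrArg (· • (evalAt p (x.evenPull 0) - algebraMap ℝ _ (x.base p 0))) hd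

theorem expPull_eq_one (hT : T.odd ≤ 3) {x : T ⟶ₛ R11} (hx : x.evenPull 0 = 0) :
    expPull b x = 1 := ext_evalAt fun p => by
  rw [evalAt_expPull hT, hx]
  simp

theorem expPull_zero (hT : T.odd ≤ 3) (x : T ⟶ₛ R11) : expPull 0 x = 1 := ext_evalAt fun p => by
  rw [evalAt_expPull hT]
  simp

/-- For `a = 0` the even coordinates add, and the exponentials multiply because the product of the
two nilpotent parts has degree at least 4. For `b = 0` all exponentials are 1. -/
theorem expPull_mul (hab : a * b = 0) (hμ : IsMu a b μ) (x y : T ⟶ₛ R11) :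
    expPull b (mulHom μ hT x y) = expPull b x * expPull b y := by
  rcases mul_eq_zero.mp hab with rfl | rfl
  · have hnil : ∀ z : T ⟶ₛ R11, ∀ p : (⊤ : Opens T.Body),
        evalAt p (z.evenPull 0) - algebraMap ℝ _ (bodyAt p (z.evenPull 0)) ∈
          ExteriorAlgebra.degreeGE _ 2 := fun z p => by
      refine ExteriorAlgebra.mem_degreeGE_two ?_ ?_
      · exact sub_mem (mem_parity_iff.mp (evenPull_mem_parity z 0) p)
          (SetLike.algebraMap_mem_graded _ _)
      · rw [map_sub, algebraMapInv_algebraMap, bodyAt_apply, sub_self]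
    refine ext_evalAt fun p => ?_
    rw [map_mul, evalAt_expPull hT, evalAt_expPull hT, evalAt_expPull hT, mulHom_evenPull hT hμ,
      zero_smul, add_zero, map_add, map_add, map_add, mul_add, Real.exp_add, smul_mul_smul_comm]
    have h := ExteriorAlgebra.mul_mem_degreeGE (hnil x p) (hnil y p)
    rw [ExteriorAlgebra.degreeGE_eq_bot _ (by omega), Submodule.mem_bot] at h
    congr 1
    rw [add_mul, one_mul, mul_add, mul_one, smul_mul_smul_comm, h, smul_zero, add_zero,
      add_sub_add_comm, smul_add]
    abel
  · rw [expPull_zero hT, expPull_zero hT, expPull_zero hT, one_mul]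

/-- With odd coordinates `ξ, η, ζ`, the even coordinates of the two bracketings differ by multiples
of `a (e^{bx} - 1) η ζ` and `a (e^{by} - 1) ξ ζ`, which vanish as `a = 0` or `b = 0`. The odd
coordinates agree because the exponential is multiplicative. -/
theorem mulHom_assoc (hab : a * b = 0) (hμ : IsMu a b μ) (x y z : T ⟶ₛ R11) :
    mulHom μ hT (mulHom μ hT x y) z = mulHom μ hT x (mulHom μ hT y z) := by
  refine hom_ext_R11 ?_ ?_
  · simp only [mulHom_evenPull hT hμ, mulHom_oddPull hT hμ]
    rcases mul_eq_zero.mp hab with rfl | rfl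
    · simp only [zero_smul, add_zero, add_assoc]
    · simp only [expPull_zero hT, one_mul, mul_add, add_mul, smul_add]
      abel
  · simp only [mulHom_oddPull hT hμ, expPull_mul hT hab hμ, mul_add, mul_assoc, add_assoc]

theorem mulHom_eq_right (hμ : IsMu a b μ) {x : T ⟶ₛ R11} (h0 : x.evenPull 0 = 0)
    (h1 : x.oddPull 0 = 0) (y : T ⟶ₛ R11) : mulHom μ hT x y = y := by
  refine hom_ext_R11 ?_ ?_
  · rw [mulHom_evenPull hT hμ, h0, h1, zero_mul, smul_zero, zero_add, add_zero]
  · rw [mulHom_oddPull hT hμ, h1, expPull_eq_one hT h0, one_mul, zero_add]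

theorem mulHom_eq_left (hμ : IsMu a b μ) {y : T ⟶ₛ R11} (h0 : y.evenPull 0 = 0)
    (h1 : y.oddPull 0 = 0) (x : T ⟶ₛ R11) : mulHom μ hT x y = x := by
  refine hom_ext_R11 ?_ ?_
  · rw [mulHom_evenPull hT hμ, h0, h1, mul_zero, smul_zero, add_zero, add_zero]
  · rw [mulHom_oddPull hT hμ, h1, mul_zero, add_zero]

theorem exists_one : ∃ e : point ⟶ₛ R11, e.evenPull 0 = 0 ∧ e.oddPull 0 = 0 := by
  obtain ⟨e, h0, h1, -⟩ := exists_hom (d := point) (e := R11) (by decide)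
    (fun _ => 0) (fun _ => 0) (fun _ => zero_mem _) (fun _ => zero_mem _)
  exact ⟨e, h0 0, h1 0⟩

/-- The solution `(y, η)` of `t + y + a τ η = 0` and `τ + e^{bt} η = 0`: since `η` is a multiple of
`τ`, the term `a τ η` vanishes. -/
theorem exists_inv (b : ℝ) : ∃ i : R11 ⟶ₛ R11, i.evenPull 0 = -evenCoord ⊤ 0 ∧
    i.oddPull 0 = -(expCoord (-b) 0 ⊤ * oddCoord ⊤ 0) := by
  obtain ⟨e, h0, h1, -⟩ := exists_hom (d := R11) (e := R11) (by decide)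
    (fun _ => -evenCoord ⊤ 0) (fun _ => -(expCoord (-b) 0 ⊤ * oddCoord ⊤ 0))
    (fun _ => neg_mem (evenCoord_mem_parity _))
    (fun _ => neg_mem (even_mul_odd_mem_parity (tmul_one_mem_parity _) (oddCoord_mem_parity _)))
  exact ⟨e, h0 0, h1 0⟩

theorem toPoint_comp_eq_zero {e : point ⟶ₛ R11} (h0 : e.evenPull 0 = 0) (h1 : e.oddPull 0 = 0) :
    (toPoint T ⋙ₛ e).evenPull 0 = 0 ∧ (toPoint T ⋙ₛ e).oddPull 0 = 0 := by
  rw [comp_evenPull, comp_oddPull, h0, h1, map_zero]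
  exact ⟨rfl, rfl⟩

theorem id_evenPull (d : SuperDomain) (i : Fin d.even) : (Hom.id d).evenPull i = evenCoord ⊤ i :=
  rfl

theorem id_oddPull (d : SuperDomain) (j : Fin d.odd) : (Hom.id d).oddPull j = oddCoord ⊤ j :=
  rfl

theorem mulHom_inv_left (hμ : IsMu a b μ) (h3 : R11.odd ≤ 3) {i u : R11 ⟶ₛ R11}
    (hi0 : i.evenPull 0 = -evenCoord ⊤ 0)
    (hi1 : i.oddPull 0 = -(expCoord (-b) 0 ⊤ * oddCoord ⊤ 0)) (hu0 : u.evenPull 0 = 0)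
    (hu1 : u.oddPull 0 = 0) : mulHom μ h3 i (Hom.id R11) = u := by
  refine hom_ext_R11 ?_ ?_
  · rw [mulHom_evenPull h3 hμ, hu0, hi0, hi1, id_evenPull, id_oddPull, superfunction_neg_mul, mul_assoc,
      mul_self_eq_zero_of_mem_parity (oddCoord_mem_parity _), mul_zero, neg_zero, smul_zero,
      add_zero, neg_add_cancel]
  · rw [mulHom_oddPull h3 hμ, hu1, hi1, id_oddPull]
    have : expPull b i = expCoord (-b) 0 ⊤ := ext_evalAt fun p => by
      rw [evalAt_expPull h3, hi0, evalAt_expCoord, bodyAt_apply, map_neg, evalAt_evenCoord,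
        map_neg, algebraMapInv_algebraMap, map_neg, sub_self, smul_zero, add_zero,
        Algebra.algebraMap_eq_smul_one, mul_neg, neg_mul]
    rw [this, neg_add_cancel]

theorem mulHom_inv_right (hμ : IsMu a b μ) (h3 : R11.odd ≤ 3) {i u : R11 ⟶ₛ R11}
    (hi0 : i.evenPull 0 = -evenCoord ⊤ 0)
    (hi1 : i.oddPull 0 = -(expCoord (-b) 0 ⊤ * oddCoord ⊤ 0)) (hu0 : u.evenPull 0 = 0)
    (hu1 : u.oddPull 0 = 0) : mulHom μ h3 (Hom.id R11) i = u := by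
  refine hom_ext_R11 ?_ ?_
  · have hc : Commute (expCoord (-b) 0 ⊤) (oddCoord (d := R11) ⊤ 0) :=
      commute_of_mem_parity (tmul_one_mem_parity _) _
    rw [mulHom_evenPull h3 hμ, hu0, hi0, hi1, id_evenPull, id_oddPull, superfunction_mul_neg, hc.eq,
      ← mul_assoc,
      mul_self_eq_zero_of_mem_parity (oddCoord_mem_parity _), zero_mul, neg_zero, smul_zero,
      add_zero, add_neg_cancel]
  · rw [mulHom_oddPull h3 hμ, hu1, hi1, id_oddPull]
    have : expPull b (Hom.id R11) * expCoord (-b) 0 ⊤ = 1 := ext_evalAt fun p => by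
      change evalAt p (expCoord b 0 ⊤ * expCoord (-b) 0 ⊤) = _
      rw [map_mul, evalAt_expCoord, evalAt_expCoord, ← map_mul, ← Real.exp_add, neg_mul,
        add_neg_cancel, Real.exp_zero, map_one, map_one]
    rw [superfunction_mul_neg, ← mul_assoc, this, one_mul, add_neg_cancel]

theorem existsUnique_lieSupergroup (hab : a * b = 0) (hμ : IsMu a b μ) :
    ∃! S : LieSupergroup R11, S.mul = μ := by
  have h3 : R11.odd ≤ 3 := by decide
  have h33 : (prod (prod R11 R11) R11).odd ≤ 3 := by decide
  obtain ⟨e, he0, he1⟩ := exists_one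
  obtain ⟨i, hi0, hi1⟩ := exists_inv b
  obtain ⟨hu0, hu1⟩ := toPoint_comp_eq_zero (T := R11) he0 he1
  have hinv := mulHom_inv_right hμ h3 hi0 hi1 hu0 hu1
  refine ⟨⟨μ, e, i, ⟨mulHom μ h33 _ _, mulHom μ h33 _ _, mulHom μ h33 _ _,
    (mulEq_iff μ h33 _ _ _).mpr rfl, (mulEq_iff μ h33 _ _ _).mpr rfl,
    (mulEq_iff μ h33 _ _ _).mpr rfl,
    (mulEq_iff μ h33 _ _ _).mpr (mulHom_assoc h33 hab hμ _ _ _).symm⟩,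
    (mulEq_iff μ h3 _ _ _).mpr (mulHom_eq_right h3 hμ hu0 hu1 _),
    (mulEq_iff μ h3 _ _ _).mpr (mulHom_eq_left h3 hμ hu0 hu1 _),
    (mulEq_iff μ h3 _ _ _).mpr (mulHom_inv_left hμ h3 hi0 hi1 hu0 hu1),
    (mulEq_iff μ h3 _ _ _).mpr hinv⟩, rfl, ?_⟩
  rintro ⟨m, e', i', _, h1, _, h2, _⟩ (rfl : m = μ)
  have h1' := (mulEq_iff m h3 _ _ _).mp h1
  have h2' := (mulEq_iff m h3 _ _ _).mp h2
  -- With `u` the constant unit and `i` the inverse already found: `e' = e' u = e' (id · i) = (e' ·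
  -- id) i = id · i = u`.
  have hu : toPoint R11 ⋙ₛ e' = toPoint R11 ⋙ₛ e := by
    rw [← mulHom_eq_left h3 hμ hu0 hu1 (toPoint R11 ⋙ₛ e'), ← hinv,
      ← mulHom_assoc h3 hab hμ, h1']
  -- Any point `q` of `ℝ^{1|1}` is a section of the map to the point, so that map can be cancelled.
  have he : e' = e := by
    obtain ⟨q, -⟩ : ∃ q : point ⟶ₛ R11, True := ⟨e, trivial⟩
    have hq : q ⋙ₛ toPoint R11 = Hom.id point :=
      hom_ext_coord (fun i => i.elim0) fun j => j.elim0
    have h := congrArg (fun f => q ⋙ₛ f) hu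
    change (q ⋙ₛ toPoint R11) ⋙ₛ e' = (q ⋙ₛ toPoint R11) ⋙ₛ e at h
    rwa [hq] at h
  -- `i' = i' (id · i) = (i' · id) i = u i = i`.
  have hi : i' = i := by
    rw [hu] at h2'
    rw [← mulHom_eq_left h3 hμ hu0 hu1 i', ← hinv, ← mulHom_assoc h3 hab hμ, h2',
      mulHom_eq_right h3 hμ hu0 hu1]
  exact LieSupergroup.ext rfl he hi

end Group

/-! ### Vector fields -/

theorem sheafEnd_ext {d : SuperDomain} {X Y : SheafEnd d} (h : ∀ U f, X.1 U f = Y.1 U f) : X = Y :=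
  Subtype.ext (funext fun U => LinearMap.ext (h U))

theorem add_app {d : SuperDomain} (X Y : SheafEnd d) (U : Opens d.Body) (f : O U) :
    (X + Y).1 U f = X.1 U f + Y.1 U f := rfl

theorem smul_app {d : SuperDomain} (c : ℝ) (X : SheafEnd d) (U : Opens d.Body) (f : O U) :
    (c • X).1 U f = c • X.1 U f := rfl

theorem mul_app {d : SuperDomain} (X Y : SheafEnd d) (U : Opens d.Body) (f : O U) :
    (X * Y).1 U f = X.1 U (Y.1 U f) := rfl

theorem zero_app {d : SuperDomain} (U : Opens d.Body) (f : O U) :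
    (0 : SheafEnd d).1 U f = 0 := rfl

theorem app_res {d : SuperDomain} (X : SheafEnd d) {U V : Opens d.Body} (h : U ≤ V) (f : O V) :
    X.1 U (res h f) = res h (X.1 V f) := X.2 U V h f

theorem homVectorFields_one {d : SuperDomain} {i : ZMod 2} {X : SheafEnd d}
    (hX : X ∈ homVectorFields d i) (U : Opens d.Body) : X.1 U 1 = 0 := by
  have h1 : (1 : O U) ∈ parity U 0 := tmul_one_mem_parity 1
  have := (hX U 0 1 h1).2 1
  rw [koszul_zero_right, one_smul, mul_one, mul_one, one_mul] at this
  simpa using this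

theorem homVectorFields_even_mul {d : SuperDomain} {i : ZMod 2} {X : SheafEnd d}
    (hX : X ∈ homVectorFields d i) {U : Opens d.Body} {f : O U} (hf : f ∈ parity U 0) (g : O U) :
    X.1 U (f * g) = X.1 U f * g + f * X.1 U g := by
  rw [(hX U 0 f hf).2 g, koszul_zero_right, one_smul]

theorem leibniz_sub_leibniz {A : Type*} [Ring A] [Algebra ℝ A] (c : ℝ) (u t y z : A) :
    u + c • (t * y) - (u + c • (t * z)) = c • (t * (y - z)) := by
  rw [mul_sub, add_sub_add_left_eq_sub, smul_sub]

set_option maxHeartbeats 1000000 in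
/-- A homogeneous vector field `Y` is `φ`-related to `X` if this holds on the coordinates. -/
theorem related_of_coord {d e : SuperDomain} (φ : d ⟶ₛ e) {i : ZMod 2} {X : SheafEnd e}
    {Y : SheafEnd d} (hX : X ∈ homVectorFields e i) (hY : Y ∈ homVectorFields d i)
    (heven : ∀ k, Y.1 ⊤ (φ.evenPull k) = φ.pullTop (X.1 ⊤ (evenCoord ⊤ k)))
    (hodd : ∀ j, Y.1 ⊤ (φ.oddPull j) = φ.pullTop (X.1 ⊤ (oddCoord ⊤ j)))
    (V : Opens e.Body) (f : O V) :
    Y.1 (preim φ.base V) (φ.pull V f) = φ.pull V (X.1 V f) := by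
  have he : ∀ V k, Y.1 (preim φ.base V) (φ.pull V (evenCoord V k)) =
      φ.pull V (X.1 V (evenCoord V k)) := fun V k => by
    rw [pull_evenCoord, app_res, heven, ← res_evenCoord (le_top : V ≤ ⊤) k, app_res, φ.pull_res]
    rfl
  have ho : ∀ V k, Y.1 (preim φ.base V) (φ.pull V (oddCoord V k)) =
      φ.pull V (X.1 V (oddCoord V k)) := fun V k => by
    rw [pull_oddCoord, app_res, hodd, ← res_oddCoord (le_top : V ≤ ⊤) k, app_res, φ.pull_res]
    rfl
  -- The defect `Y φ^* - φ^* X` kills 1 and, as `X` and `Y` agree on coordinates, moves past a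
  -- coordinate with only the Koszul sign, which is the constant `c`.
  refine sub_eq_zero.mp (eq_zero_of_coord φ
    (fun V => (Y.1 (preim φ.base V)).comp (φ.pull V).toLinearMap -
      (φ.pull V).toLinearMap.comp (X.1 V)) ?_ ?_ ?_ (c := koszul i 1) ?_ V f)
  · intro V W h f
    change Y.1 _ (φ.pull V (res h f)) - φ.pull V (X.1 V (res h f)) =
      res _ (Y.1 _ (φ.pull W f) - φ.pull W (X.1 W f))
    rw [φ.pull_res, app_res, app_res, φ.pull_res, map_sub]
  · intro V
    change Y.1 _ (φ.pull V 1) - φ.pull V (X.1 V 1) = 0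
    rw [map_one, homVectorFields_one hX, homVectorFields_one hY, map_zero, sub_zero]
  · intro V k g
    change Y.1 _ (φ.pull V (evenCoord V k * g)) - φ.pull V (X.1 V (evenCoord V k * g)) =
      φ.pull V (evenCoord V k) * (Y.1 _ (φ.pull V g) - φ.pull V (X.1 V g))
    rw [map_mul, homVectorFields_even_mul hX (evenCoord_mem_parity k),
      homVectorFields_even_mul hY (φ.pull_parity V 0 _ (evenCoord_mem_parity k)), map_add, map_mul,
      map_mul, he, mul_sub, add_sub_add_left_eq_sub]
  · intro V k g
    change Y.1 _ (φ.pull V (oddCoord V k * g)) - φ.pull V (X.1 V (oddCoord V k * g)) =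
      koszul i 1 • (φ.pull V (oddCoord V k) * (Y.1 _ (φ.pull V g) - φ.pull V (X.1 V g)))
    rw [map_mul, (hX V 1 _ (oddCoord_mem_parity k)).2,
      (hY _ 1 _ (φ.pull_parity V 1 _ (oddCoord_mem_parity k))).2, map_add, map_smul, map_mul,
      map_mul, ho]
    exact leibniz_sub_leibniz _ _ _ _ _

/-- `X` and the zero field, which lies in every parity, are compared along the identity morphism. -/
theorem homVectorField_eq_zero {d : SuperDomain} {i : ZMod 2} {X : SheafEnd d}
    (hX : X ∈ homVectorFields d i) (h0 : ∀ k, X.1 ⊤ (evenCoord ⊤ k) = 0)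
    (h1 : ∀ j, X.1 ⊤ (oddCoord ⊤ j) = 0) : X = 0 :=
  sheafEnd_ext fun U f => (related_of_coord (Hom.id d) hX (zero_mem (homVectorFields d i))
    (fun k => by rw [h0, map_zero]; rfl) (fun j => by rw [h1, map_zero]; rfl) U f).symm

/-- On a homogeneous superfunction the even and the odd component give results of opposite parity,
so they cannot cancel. -/
theorem app_eq_zero_of_add {d : SuperDomain} {X Y : SheafEnd d} (hX : X ∈ homVectorFields d 0)
    (hY : Y ∈ homVectorFields d 1) {U : Opens d.Body} {i : ZMod 2} {f : O U} (hf : f ∈ parity U i)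
    (h : X.1 U f + Y.1 U f = 0) : X.1 U f = 0 ∧ Y.1 U f = 0 := by
  have h1 := (hX U i f hf).1
  have h2 := (hY U i f hf).1
  have hXY : X.1 U f = -Y.1 U f := eq_neg_of_add_eq_zero_left h
  have h3 : X.1 U f = 0 := by
    rcases zmod_two i with rfl | rfl
    · exact eq_zero_of_mem_parity h1 (by rw [hXY]; exact neg_mem h2)
    · refine eq_zero_of_mem_parity (by rw [hXY]; exact neg_mem h2) h1
  rw [h3, zero_add] at h
  exact ⟨h3, h⟩

theorem vectorField_eq_zero {d : SuperDomain} {X : SheafEnd d}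
    (hX : X ∈ vectorFields d) (h0 : ∀ k, X.1 ⊤ (evenCoord ⊤ k) = 0)
    (h1 : ∀ j, X.1 ⊤ (oddCoord ⊤ j) = 0) : X = 0 := by
  obtain ⟨Y, hY, Z, hZ, rfl⟩ := Submodule.mem_sup.mp hX
  have h0' := fun k => app_eq_zero_of_add hY hZ (evenCoord_mem_parity k) (h0 k)
  have h1' := fun k => app_eq_zero_of_add hY hZ (oddCoord_mem_parity k) (h1 k)
  rw [homVectorField_eq_zero hY (fun k => (h0' k).1) fun k => (h1' k).1,
    homVectorField_eq_zero hZ (fun k => (h0' k).2) fun k => (h1' k).2, add_zero]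

theorem vectorField_ext {d : SuperDomain} {X Y : SheafEnd d}
    (hX : X ∈ vectorFields d) (hY : Y ∈ vectorFields d)
    (h0 : ∀ k, X.1 ⊤ (evenCoord ⊤ k) = Y.1 ⊤ (evenCoord ⊤ k))
    (h1 : ∀ j, X.1 ⊤ (oddCoord ⊤ j) = Y.1 ⊤ (oddCoord ⊤ j)) : X = Y := by
  have h : X + (-1 : ℝ) • Y = 0 := by
    refine vectorField_eq_zero (add_mem hX (Submodule.smul_mem _ _ hY)) (fun k => ?_) fun k => ?_
    · rw [add_app, smul_app, h0, superfunction_neg_one_smul, add_neg_cancel]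
    · rw [add_app, smul_app, h1, superfunction_neg_one_smul, add_neg_cancel]
  refine sheafEnd_ext fun U f => ?_
  have hU : (X + (-1 : ℝ) • Y).1 U f = 0 := by rw [h]; rfl
  rwa [add_app, smul_app, superfunction_neg_one_smul, add_neg_eq_zero] at hU

theorem vectorFields_one {d : SuperDomain} {X : SheafEnd d} (hX : X ∈ vectorFields d)
    (U : Opens d.Body) : X.1 U 1 = 0 := by
  obtain ⟨Y, hY, Z, hZ, rfl⟩ := Submodule.mem_sup.mp hX
  rw [add_app, homVectorFields_one hY, homVectorFields_one hZ, add_zero]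

theorem vectorFields_even_mul {d : SuperDomain} {X : SheafEnd d}
    (hX : X ∈ vectorFields d) {U : Opens d.Body} {f : O U} (hf : f ∈ parity U 0) (g : O U) :
    X.1 U (f * g) = X.1 U f * g + f * X.1 U g := by
  obtain ⟨Y, hY, Z, hZ, rfl⟩ := Submodule.mem_sup.mp hX
  rw [add_app, add_app, add_app, homVectorFields_even_mul hY hf, homVectorFields_even_mul hZ hf,
    add_mul, mul_add]
  abel

/-- The even and odd components of `X` have different signs in the Leibniz rule, but both kill `g`,
so the term with the sign disappears. -/
theorem vectorFields_mul_of_eq_zero {d : SuperDomain} {X : SheafEnd d}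
    (hX : X ∈ vectorFields d) {U : Opens d.Body} {i j : ZMod 2} {f g : O U} (hf : f ∈ parity U i)
    (hg : g ∈ parity U j) (h : X.1 U g = 0) : X.1 U (f * g) = X.1 U f * g := by
  obtain ⟨Y, hY, Z, hZ, rfl⟩ := Submodule.mem_sup.mp hX
  obtain ⟨h1, h2⟩ := app_eq_zero_of_add hY hZ hg h
  rw [add_app, add_app, (hY U i f hf).2, (hZ U i f hf).2, h1, h2, mul_zero, smul_zero, smul_zero,
    add_zero, add_zero, add_mul]

/-! ### Coordinate vector fields and their values on coordinates -/

theorem evenPartial_tmul {d : SuperDomain} (i : Fin d.even) {U : Opens d.Body} (s : Smooth U)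
    (l : Grassmann d) : (evenPartial i).1 U (s ⊗ₜ[ℝ] l) = smoothPartial i U s ⊗ₜ[ℝ] l := rfl

theorem oddPartial_tmul {d : SuperDomain} (j : Fin d.odd) {U : Opens d.Body} (s : Smooth U)
    (l : Grassmann d) : (oddPartial j).1 U (s ⊗ₜ[ℝ] l) =
      s ⊗ₜ[ℝ] CliffordAlgebra.contractLeft (Q := (0 : QuadraticForm ℝ (Fin d.odd → ℝ)))
        (LinearMap.proj j : (Fin d.odd → ℝ) →ₗ[ℝ] ℝ) l := rfl

theorem oddMul_apply {d : SuperDomain} (j : Fin d.odd) {U : Opens d.Body} (f : O U) :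
    (oddMul j).1 U f = oddCoord U j * f := rfl

theorem evenPartial_mem {d : SuperDomain} (i : Fin d.even) :
    evenPartial i ∈ homVectorFields d 0 := by
  intro U j f hf
  refine ⟨?_, fun g => ?_⟩
  · have h : ∀ f : O U, invol U ((evenPartial i).1 U f) = (evenPartial i).1 U (invol U f) := by
      intro f
      induction f using TensorProduct.induction_on with
      | zero => simp
      | add x y hx hy => simp only [map_add, hx, hy]
      | tmul s l => rfl
    rw [mem_parity_iff_invol] at *
    rw [h, hf, map_smul, zero_add]
  · rw [koszul_zero_left, one_smul]
    clear hf
    induction f using TensorProduct.induction_on with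
    | zero => simp
    | add x y hx hy => rw [add_mul, map_add, map_add, hx, hy, add_mul, add_mul]; abel
    | tmul s l =>
      induction g using TensorProduct.induction_on with
      | zero => simp
      | add x y hx hy => rw [mul_add, map_add, map_add, hx, hy, mul_add, mul_add]; abel
      | tmul t m =>
        rw [Algebra.TensorProduct.tmul_mul_tmul, evenPartial_tmul, evenPartial_tmul,
          evenPartial_tmul, Algebra.TensorProduct.tmul_mul_tmul,
          Algebra.TensorProduct.tmul_mul_tmul, smoothPartial_mul, TensorProduct.add_tmul]

theorem oddPartial_mem {d : SuperDomain} (j : Fin d.odd) :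
    oddPartial j ∈ homVectorFields d 1 := by
  intro U k f hf
  refine ⟨?_, fun g => ?_⟩
  · have h : ∀ f : O U, invol U ((oddPartial j).1 U f) = -(oddPartial j).1 U (invol U f) := by
      intro f
      induction f using TensorProduct.induction_on with
      | zero => simp
      | add x y hx hy => simp only [map_add, hx, hy, neg_add]
      | tmul s l =>
        rw [oddPartial_tmul, invol_tmul, invol_tmul, oddPartial_tmul,
          ExteriorAlgebra.involute_contractLeft, TensorProduct.tmul_neg]
    rw [mem_parity_iff_invol] at *
    rw [h, hf, map_smul, koszul_add_left, koszul_one_one, mul_smul, superfunction_neg_one_smul]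
  · have h : (oddPartial j).1 U (f * g) =
        (oddPartial j).1 U f * g + invol U f * (oddPartial j).1 U g := by
      clear hf
      induction f using TensorProduct.induction_on with
      | zero => simp
      | add x y hx hy => rw [add_mul, map_add, map_add, hx, hy, add_mul, map_add, add_mul]; abel
      | tmul s l =>
        induction g using TensorProduct.induction_on with
        | zero => simp
        | add x y hx hy => rw [mul_add, map_add, map_add, hx, hy, mul_add, mul_add]; abel
        | tmul t m =>
          rw [Algebra.TensorProduct.tmul_mul_tmul, oddPartial_tmul, oddPartial_tmul,
            oddPartial_tmul, invol_tmul, Algebra.TensorProduct.tmul_mul_tmul,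
            Algebra.TensorProduct.tmul_mul_tmul, ExteriorAlgebra.contractLeft_mul,
            TensorProduct.tmul_add]
    rw [h, mem_parity_iff_invol.mp hf, smul_mul_assoc, koszul_comm]

theorem oddMul_mul_mem {d : SuperDomain} (j : Fin d.odd) {i : ZMod 2} {X : SheafEnd d}
    (hX : X ∈ homVectorFields d i) : oddMul j * X ∈ homVectorFields d (1 + i) := by
  intro U k f hf
  obtain ⟨h1, h2⟩ := hX U k f hf
  refine ⟨?_, fun g => ?_⟩
  · rw [mul_app, oddMul_apply, add_assoc]
    exact mul_mem_parity (oddCoord_mem_parity j) h1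
  · rw [mul_app, mul_app, mul_app, oddMul_apply, oddMul_apply, oddMul_apply, h2, mul_add,
      mul_smul_comm, koszul_add_left, mul_comm (koszul 1 k), mul_smul, mul_assoc]
    have h3 : oddCoord U j * f = koszul 1 k • (f * oddCoord U j) := by
      rcases zmod_two k with rfl | rfl
      · rw [koszul_zero_right, one_smul]
        exact (commute_of_mem_parity hf _).eq.symm
      · rw [koszul_one_one, superfunction_neg_one_smul]
        exact mul_eq_neg_mul_of_mem_parity (oddCoord_mem_parity j) hf
    rw [← mul_assoc (oddCoord U j) f, h3, smul_mul_assoc, mul_assoc]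

theorem oddPartial_tmul_one {d : SuperDomain} (j : Fin d.odd) {U : Opens d.Body} (s : Smooth U) :
    (oddPartial j).1 U (s ⊗ₜ[ℝ] (1 : Grassmann d)) = 0 := by
  rw [oddPartial_tmul, CliffordAlgebra.contractLeft_one, TensorProduct.tmul_zero]

theorem oddPartial_evenCoord {d : SuperDomain} (j : Fin d.odd) (k : Fin d.even)
    (U : Opens d.Body) : (oddPartial j).1 U (evenCoord U k) = 0 := oddPartial_tmul_one j _

theorem oddPartial_expCoord {d : SuperDomain} (j : Fin d.odd) (k : Fin d.even) (b : ℝ)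
    (U : Opens d.Body) : (oddPartial j).1 U (expCoord b k U) = 0 := oddPartial_tmul_one j _

theorem expCoord_mem_parity {d : SuperDomain} (b : ℝ) (i : Fin d.even) (U : Opens d.Body) :
    expCoord b i U ∈ parity U 0 := tmul_one_mem_parity _

/-- The vector field `∂/∂t_i + b τ_j ∂/∂τ_j`. -/
def evenField {d : SuperDomain} (i : Fin d.even) (j : Fin d.odd) (b : ℝ) : SheafEnd d :=
  evenPartial i + b • (oddMul j * oddPartial j)

/-- The vector field `∂/∂τ_j + a τ_j ∂/∂t_i`. -/
def oddField {d : SuperDomain} (i : Fin d.even) (j : Fin d.odd) (a : ℝ) : SheafEnd d :=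
  oddPartial j + a • (oddMul j * evenPartial i)

theorem evenField_mem {d : SuperDomain} (i : Fin d.even) (j : Fin d.odd) (b : ℝ) :
    evenField i j b ∈ homVectorFields d 0 := by
  have h := oddMul_mul_mem j (oddPartial_mem j)
  rw [show (1 : ZMod 2) + 1 = 0 from rfl] at h
  exact add_mem (evenPartial_mem i) (Submodule.smul_mem _ b h)

theorem oddField_mem {d : SuperDomain} (i : Fin d.even) (j : Fin d.odd) (a : ℝ) :
    oddField i j a ∈ homVectorFields d 1 := by
  have h := oddMul_mul_mem j (evenPartial_mem i)
  rw [add_zero] at h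
  exact add_mem (oddPartial_mem j) (Submodule.smul_mem _ a h)

theorem evenPartial_evenCoord {d : SuperDomain} (i k : Fin d.even) (U : Opens d.Body) :
    (evenPartial i).1 U (evenCoord U k) = if i = k then 1 else 0 := by
  have h : smoothPartial i U (⟨fun x => x.1 k, (contDiff_apply ℝ ℝ k).contMDiff.comp
      contMDiff_subtype_val⟩ : Smooth U) = if i = k then 1 else 0 := by
    ext p
    refine (smoothPartial_of_eq_coord i k _ (fun _ => rfl) p).trans ?_
    split_ifs <;> rfl
  refine (congrArg (· ⊗ₜ[ℝ] (1 : Grassmann d)) h).trans ?_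
  split_ifs
  · rfl
  · exact TensorProduct.zero_tmul _ _

theorem evenPartial_oddCoord {d : SuperDomain} (i : Fin d.even) (j : Fin d.odd)
    (U : Opens d.Body) : (evenPartial i).1 U (oddCoord U j) = 0 := by
  rw [oddCoord, evenPartial_tmul, smoothPartial_one, TensorProduct.zero_tmul]

theorem evenPartial_expCoord {d : SuperDomain} (i k : Fin d.even) (b : ℝ) (U : Opens d.Body) :
    (evenPartial i).1 U (expCoord b k U) = if i = k then b • expCoord b k U else 0 := by
  have h : smoothPartial i U (⟨fun x => Real.exp (b * x.1 k),
      (contDiff_exp_coord b k).contMDiff.comp contMDiff_subtype_val⟩ : Smooth U) =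
      if i = k then b • (show Smooth U from ⟨fun x => Real.exp (b * x.1 k),
      (contDiff_exp_coord b k).contMDiff.comp contMDiff_subtype_val⟩) else 0 := by
    ext p
    refine (smoothPartial_exp b i k _ (fun _ => rfl) p).trans ?_
    split_ifs <;> rfl
  refine (congrArg (· ⊗ₜ[ℝ] (1 : Grassmann d)) h).trans ?_
  split_ifs
  · rfl
  · exact TensorProduct.zero_tmul _ _

theorem oddPartial_oddCoord {d : SuperDomain} (j k : Fin d.odd) (U : Opens d.Body) :
    (oddPartial j).1 U (oddCoord U k) = if j = k then 1 else 0 := by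
  rw [oddCoord, oddPartial_tmul]
  refine (congrArg ((1 : Smooth U) ⊗ₜ[ℝ] ·) (CliffordAlgebra.contractLeft_ι (Q := (0 : QuadraticForm ℝ (Fin d.odd → ℝ)))
    (d := LinearMap.proj j) (Pi.single k 1))).trans ?_
  rw [LinearMap.proj_apply, Pi.single_apply]
  split_ifs
  · rw [map_one]; rfl
  · rw [map_zero, TensorProduct.tmul_zero]

theorem evenField_app {d : SuperDomain} (i : Fin d.even) (j : Fin d.odd) (b : ℝ)
    (U : Opens d.Body) (f : O U) : (evenField i j b).1 U f =
      (evenPartial i).1 U f + b • (oddCoord U j * (oddPartial j).1 U f) := rfl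

theorem oddField_app {d : SuperDomain} (i : Fin d.even) (j : Fin d.odd) (a : ℝ)
    (U : Opens d.Body) (f : O U) : (oddField i j a).1 U f =
      (oddPartial j).1 U f + a • (oddCoord U j * (evenPartial i).1 U f) := rfl

theorem evenField_evenCoord {d : SuperDomain} (i k : Fin d.even) (j : Fin d.odd) (b : ℝ)
    (U : Opens d.Body) :
    (evenField i j b).1 U (evenCoord U k) = if i = k then 1 else 0 := by
  rw [evenField_app, evenPartial_evenCoord, oddPartial_evenCoord, mul_zero,
    smul_zero, add_zero]

theorem evenField_oddCoord {d : SuperDomain} (i : Fin d.even) (j k : Fin d.odd) (b : ℝ)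
    (U : Opens d.Body) :
    (evenField i j b).1 U (oddCoord U k) = if j = k then b • oddCoord U j else 0 := by
  rw [evenField_app, evenPartial_oddCoord, oddPartial_oddCoord, zero_add]
  split_ifs
  · rw [mul_one]
  · rw [mul_zero, smul_zero]

theorem evenField_expCoord {d : SuperDomain} (i : Fin d.even) (j : Fin d.odd) (b c : ℝ)
    (U : Opens d.Body) :
    (evenField i j b).1 U (expCoord c i U) = c • expCoord c i U := by
  rw [evenField_app, evenPartial_expCoord, if_pos rfl, oddPartial_expCoord, mul_zero, smul_zero,
    add_zero]

theorem oddField_evenCoord {d : SuperDomain} (i k : Fin d.even) (j : Fin d.odd) (a : ℝ)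
    (U : Opens d.Body) :
    (oddField i j a).1 U (evenCoord U k) = if i = k then a • oddCoord U j else 0 := by
  rw [oddField_app, evenPartial_evenCoord, oddPartial_evenCoord, zero_add]
  split_ifs
  · rw [mul_one]
  · rw [mul_zero, smul_zero]

theorem oddField_oddCoord {d : SuperDomain} (i : Fin d.even) (j k : Fin d.odd) (a : ℝ)
    (U : Opens d.Body) :
    (oddField i j a).1 U (oddCoord U k) = if j = k then 1 else 0 := by
  rw [oddField_app, evenPartial_oddCoord, oddPartial_oddCoord, mul_zero, smul_zero, add_zero]

theorem oddField_expCoord {d : SuperDomain} (i : Fin d.even) (j : Fin d.odd) (a c : ℝ)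
    (U : Opens d.Body) :
    (oddField i j a).1 U (expCoord c i U) = a • (oddCoord U j * c • expCoord c i U) := by
  rw [oddField_app, evenPartial_expCoord, if_pos rfl, oddPartial_expCoord, zero_add]

theorem D0_eq (b : ℝ) : D0 b = evenField 0 0 b := rfl

theorem D1_eq (a : ℝ) : D1 a = oddField 0 0 a := rfl

/-! ### Supercommutators -/

section Relations

variable {d : SuperDomain} (i : Fin d.even) (j : Fin d.odd) (U : Opens d.Body)

theorem evenPartial_mul_oddPartial :
    (evenPartial i).1 U * (oddPartial j).1 U = (oddPartial j).1 U * (evenPartial i).1 U :=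
  TensorProduct.ext' fun _ _ => rfl

theorem evenPartial_mul_oddMul :
    (evenPartial i).1 U * (oddMul j).1 U = (oddMul j).1 U * (evenPartial i).1 U :=
  LinearMap.ext fun f => by
    change (evenPartial i).1 U (oddCoord U j * f) = oddCoord U j * (evenPartial i).1 U f
    rw [(evenPartial_mem i U 1 _ (oddCoord_mem_parity j)).2, evenPartial_oddCoord, zero_mul,
      zero_add, koszul_zero_left, one_smul]

theorem oddPartial_mul_self : (oddPartial j).1 U * (oddPartial j).1 U = 0 :=
  TensorProduct.ext' fun s l => by
    change (oddPartial j).1 U ((oddPartial j).1 U (s ⊗ₜ[ℝ] l)) = 0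
    rw [oddPartial_tmul, oddPartial_tmul, CliffordAlgebra.contractLeft_contractLeft,
      TensorProduct.tmul_zero]

theorem oddMul_mul_self : (oddMul j).1 U * (oddMul j).1 U = 0 :=
  LinearMap.ext fun f => by
    change oddCoord U j * (oddCoord U j * f) = 0
    rw [← mul_assoc, mul_self_eq_zero_of_mem_parity (oddCoord_mem_parity j), zero_mul]

theorem oddPartial_mul_oddMul :
    (oddPartial j).1 U * (oddMul j).1 U + (oddMul j).1 U * (oddPartial j).1 U = 1 :=
  LinearMap.ext fun f => by
    change (oddPartial j).1 U (oddCoord U j * f) + oddCoord U j * (oddPartial j).1 U f = f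
    rw [(oddPartial_mem j U 1 _ (oddCoord_mem_parity j)).2, oddPartial_oddCoord, if_pos rfl,
      koszul_one_one, one_mul, superfunction_neg_one_smul, neg_add_cancel_right]

end Relations

section Heisenberg

variable {A : Type*} [Ring A] [Algebra ℝ A] {T S M : A} {a b : ℝ}

/-- `T`, `S`, `M` stand for `∂_t`, `∂_τ` and multiplication by `τ`. As `T` commutes with both and
`[M S, S] = -S`, the result is `-b S`; the term `-b a M T` may be added because `ab = 0`. -/
theorem commutator_eq (hab : a * b = 0) (hTS : T * S = S * T) (hTM : T * M = M * T)
    (hSS : S * S = 0) (hanti : S * M + M * S = 1) :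
    (T + b • (M * S)) * (S + a • (M * T)) +
      (-1 : ℝ) • ((S + a • (M * T)) * (T + b • (M * S))) = (-b) • (S + a • (M * T)) := by
  have hSM : S * M = 1 - M * S := eq_sub_of_add_eq hanti
  have hba : b * a = 0 := by rw [mul_comm, hab]
  have h1 : M * S * S = 0 := by rw [mul_assoc, hSS, mul_zero]
  have h2 : S * (M * S) = S := by rw [← mul_assoc, hSM, sub_mul, one_mul, mul_assoc, hSS, mul_zero,
    sub_zero]
  have h3 : T * (M * T) = M * T * T := by rw [← mul_assoc, hTM]
  rw [neg_one_smul, ← sub_eq_add_neg]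
  simp only [mul_add, add_mul, smul_mul_assoc, mul_smul_comm, hab, hba,
    zero_smul, h1, h2, h3, smul_add, smul_smul, neg_mul, neg_smul, smul_zero, hTS, neg_zero,
    add_zero, mul_assoc]
  abel

/-- The square of `S + a M T` is `a (S M + M S) T = a T`; the term with `M S` on the right is free
because `ab = 0`. -/
theorem mul_self_add_mul_self_eq (hab : a * b = 0) (hTS : T * S = S * T) (hTM : T * M = M * T)
    (hSS : S * S = 0) (hMM : M * M = 0) (hanti : S * M + M * S = 1) :
    (S + a • (M * T)) * (S + a • (M * T)) +
      (1 : ℝ) • ((S + a • (M * T)) * (S + a • (M * T))) = (2 * a) • (T + b • (M * S)) := by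
  have hSM : S * M = 1 - M * S := eq_sub_of_add_eq hanti
  have h1 : S * (M * T) + M * T * S = T := by
    rw [← mul_assoc, hSM, mul_assoc, hTS, sub_mul, one_mul, mul_assoc, sub_add_cancel]
  have h2 : M * T * (M * T) = 0 := by
    rw [mul_assoc, ← mul_assoc T, hTM, mul_assoc, ← mul_assoc, hMM, zero_mul]
  have h3 : (S + a • (M * T)) * (S + a • (M * T)) = a • T := by
    rw [mul_add, add_mul, add_mul, hSS, smul_mul_smul_comm, h2, smul_zero, zero_add, add_zero,
      smul_mul_assoc, mul_smul_comm, ← smul_add, add_comm (M * T * S), h1]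
  rw [h3, one_smul, ← two_smul ℝ, smul_smul, smul_add, smul_smul, mul_assoc 2 a b, hab, mul_zero,
    zero_smul, add_zero]

end Heisenberg

theorem superBracket_app {d : SuperDomain} (i j : ZMod 2) (X Y : SheafEnd d) (U : Opens d.Body) :
    (superBracket i j X Y).1 U = X.1 U * Y.1 U + (-koszul i j) • (Y.1 U * X.1 U) := rfl

theorem superBracket_D0_D0 (b : ℝ) : superBracket 0 0 (D0 b) (D0 b) = 0 :=
  sheafEnd_ext fun U f => by
    rw [superBracket_app, koszul_zero_left]
    change (D0 b).1 U ((D0 b).1 U f) + (-1 : ℝ) • (D0 b).1 U ((D0 b).1 U f) = 0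
    rw [superfunction_neg_one_smul, add_neg_cancel]

theorem superBracket_D0_D1 {a b : ℝ} (hab : a * b = 0) :
    superBracket 0 1 (D0 b) (D1 a) = (-b) • D1 a :=
  Subtype.ext (funext fun U => by
    rw [superBracket_app, koszul_zero_left]
    exact commutator_eq (A := Module.End ℝ (O U)) hab
      (evenPartial_mul_oddPartial 0 0 U) (evenPartial_mul_oddMul 0 0 U)
      (oddPartial_mul_self 0 U) (oddPartial_mul_oddMul 0 U))

theorem superBracket_D1_D1 {a b : ℝ} (hab : a * b = 0) :
    superBracket 1 1 (D1 a) (D1 a) = (2 * a) • D0 b :=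
  Subtype.ext (funext fun U => by
    rw [superBracket_app, koszul_one_one, neg_neg]
    exact mul_self_add_mul_self_eq (A := Module.End ℝ (O U)) hab
      (evenPartial_mul_oddPartial 0 0 U)
      (evenPartial_mul_oddMul 0 0 U) (oddPartial_mul_self 0 U) (oddMul_mul_self 0 U)
      (oddPartial_mul_oddMul 0 U))

/-! ### Linear independence -/

/-- The values at the origin of the coefficients of a vector field on `ℝ^{1|1}`. -/
def valueAtZero : SheafEnd R11 →ₗ[ℝ] Fin 2 → ℝ where
  toFun X := ![bodyAt (topPt 0) (X.1 ⊤ (evenCoord ⊤ 0)), bodyAt (topPt 0) (X.1 ⊤ (oddCoord ⊤ 0))]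
  map_add' X Y := by
    rw [add_app, add_app, map_add, map_add]
    simp
  map_smul' c X := by
    rw [smul_app, smul_app, map_smul, map_smul]
    simp

theorem bodyAt_oddCoord {d : SuperDomain} {U : Opens d.Body} (p : U) (j : Fin d.odd) :
    bodyAt p (oddCoord U j) = 0 := bodyAt_eq_zero_of_mem_parity (oddCoord_mem_parity j) p

theorem valueAtZero_D0 (b : ℝ) : valueAtZero (D0 b) = Pi.single 0 1 := by
  change ![bodyAt (topPt 0) ((evenField 0 0 b).1 ⊤ (evenCoord ⊤ 0)),
    bodyAt (topPt 0) ((evenField 0 0 b).1 ⊤ (oddCoord ⊤ 0))] = _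
  rw [evenField_evenCoord, evenField_oddCoord, if_pos rfl, if_pos rfl, map_one, map_smul,
    bodyAt_oddCoord, smul_zero]
  ext i
  fin_cases i <;> simp

theorem valueAtZero_D1 (a : ℝ) : valueAtZero (D1 a) = Pi.single 1 1 := by
  change ![bodyAt (topPt 0) ((oddField 0 0 a).1 ⊤ (evenCoord ⊤ 0)),
    bodyAt (topPt 0) ((oddField 0 0 a).1 ⊤ (oddCoord ⊤ 0))] = _
  rw [oddField_evenCoord, oddField_oddCoord, if_pos rfl, if_pos rfl, map_one, map_smul,
    bodyAt_oddCoord, smul_zero]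
  ext i
  fin_cases i <;> simp

/-- At the origin `τ` vanishes, so the two fields take the standard basis vectors as values. -/
theorem linearIndependent_D0_D1 (a b : ℝ) : LinearIndependent ℝ ![D0 b, D1 a] := by
  refine LinearIndependent.of_comp valueAtZero ?_
  convert (Pi.basisFun ℝ (Fin 2)).linearIndependent using 1
  ext i : 1
  fin_cases i
  · exact (valueAtZero_D0 b).trans (Pi.basisFun_apply ℝ (Fin 2) 0).symm
  · exact (valueAtZero_D1 a).trans (Pi.basisFun_apply ℝ (Fin 2) 1).symm

/-! ### Right invariant vector fields -/

theorem combination_evenCoord (a b α β : ℝ) :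
    (α • D0 b + β • D1 a).1 ⊤ (evenCoord ⊤ 0) =
      algebraMap ℝ (O (⊤ : Opens R11.Body)) α + (β * a) • oddCoord ⊤ 0 := by
  rw [add_app, smul_app, smul_app, D0_eq, D1_eq, evenField_evenCoord, oddField_evenCoord,
    if_pos rfl, if_pos rfl, smul_smul, Algebra.algebraMap_eq_smul_one]

theorem combination_oddCoord (a b α β : ℝ) :
    (α • D0 b + β • D1 a).1 ⊤ (oddCoord ⊤ 0) =
      algebraMap ℝ (O (⊤ : Opens R11.Body)) β + (α * b) • oddCoord ⊤ 0 := by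
  rw [add_app, smul_app, smul_app, D0_eq, D1_eq, evenField_oddCoord, oddField_oddCoord,
    if_pos rfl, if_pos rfl, smul_smul, Algebra.algebraMap_eq_smul_one, add_comm]

/-- On `ℝ^{2|2}` the field `W = evenField 0 0 b` is `D₀ ⊗ id`. It sends `μ^* t` to `1 + ab τ₁ τ₂ =
1` and `μ^* τ` to `b μ^* τ`. -/
theorem evenField_related_mu {a b : ℝ} {μ : prod R11 R11 ⟶ₛ R11} (hab : a * b = 0)
    (hμ : IsMu a b μ) (V : Opens R11.Body) (f : O V) :
    (evenField 0 0 b : SheafEnd (prod R11 R11)).1 (preim μ.base V) (μ.pull V f) =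
      μ.pull V ((D0 b).1 V f) := by
  obtain ⟨h0, h1⟩ := isMu_iff.mp hμ
  have hW := evenField_mem (d := prod R11 R11) 0 0 b
  refine related_of_coord μ (evenField_mem (d := R11) 0 0 b) hW (fun k => ?_) (fun k => ?_) V f
  · rw [Subsingleton.elim k 0, evenField_evenCoord, if_pos rfl, map_one, h0, map_add, map_add,
      map_smul, (hW ⊤ 1 _ (oddCoord_mem_parity 0)).2, evenField_evenCoord, evenField_evenCoord,
      evenField_oddCoord, evenField_oddCoord, if_pos rfl, if_neg (by decide), if_pos rfl,
      if_neg (by decide), mul_zero, smul_zero, add_zero, add_zero, smul_mul_assoc, smul_smul, hab,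
      zero_smul, add_zero]
  · rw [Subsingleton.elim k 0, evenField_oddCoord, if_pos rfl, map_smul, pullTop_oddCoord, h1,
      map_add, homVectorFields_even_mul hW (expCoord_mem_parity b 0 ⊤), evenField_expCoord,
      evenField_oddCoord, evenField_oddCoord, if_pos rfl, if_neg (by decide), mul_zero, add_zero,
      smul_mul_assoc, smul_add]

/-- Here `D₁ ⊗ id` sends `μ^* t` to `a (τ₁ + τ₂)`, which is `a μ^* τ` since `a e^{b t₁} = a`, and
`μ^* τ` to 1 up to a multiple of `ab`. -/
theorem oddField_related_mu {a b : ℝ} {μ : prod R11 R11 ⟶ₛ R11} (hab : a * b = 0)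
    (hμ : IsMu a b μ) (V : Opens R11.Body) (f : O V) :
    (oddField 0 0 a : SheafEnd (prod R11 R11)).1 (preim μ.base V) (μ.pull V f) =
      μ.pull V ((D1 a).1 V f) := by
  obtain ⟨h0, h1⟩ := isMu_iff.mp hμ
  have hW := oddField_mem (d := prod R11 R11) 0 0 a
  have hexp : a • (expCoord b 0 ⊤ * oddCoord (d := prod R11 R11) ⊤ 1) = a • oddCoord ⊤ 1 := by
    rcases mul_eq_zero.mp hab with rfl | rfl
    · rw [zero_smul, zero_smul]
    · have : expCoord (d := prod R11 R11) 0 0 ⊤ = 1 := ext_evalAt fun p => by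
        rw [evalAt_expCoord, zero_mul, Real.exp_zero, map_one, map_one]
      rw [this, one_mul]
  refine related_of_coord μ (oddField_mem (d := R11) 0 0 a) hW (fun k => ?_) (fun k => ?_) V f
  · rw [Subsingleton.elim k 0, oddField_evenCoord, if_pos rfl, map_smul, pullTop_oddCoord, h0, h1,
      map_add, map_add, map_smul, (hW ⊤ 1 _ (oddCoord_mem_parity 0)).2, oddField_evenCoord,
      oddField_evenCoord, oddField_oddCoord, oddField_oddCoord, if_pos rfl, if_neg (by decide),
      if_pos rfl, if_neg (by decide), mul_zero, smul_zero, add_zero, add_zero, one_mul, smul_add,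
      hexp]
  · rw [Subsingleton.elim k 0, oddField_oddCoord, if_pos rfl, map_one, h1,
      map_add, homVectorFields_even_mul hW (expCoord_mem_parity b 0 ⊤), oddField_expCoord,
      oddField_oddCoord, oddField_oddCoord, if_pos rfl, if_neg (by decide), mul_zero, add_zero,
      mul_smul_comm, smul_smul, hab, zero_smul, zero_mul, add_zero]

theorem evenField_related_fst (b : ℝ) (V : Opens R11.Body) (f : O V) :
    (evenField 0 0 b : SheafEnd (prod R11 R11)).1 (preim (fst R11 R11).base V)
      ((fst R11 R11).pull V f) = (fst R11 R11).pull V ((D0 b).1 V f) := by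
  refine related_of_coord (fst R11 R11) (evenField_mem (d := R11) 0 0 b)
    (evenField_mem (d := prod R11 R11) 0 0 b) (fun k => ?_) (fun k => ?_) V f
  · rw [Subsingleton.elim k 0, evenField_evenCoord, if_pos rfl, map_one, fst, coordMap_evenPull,
      evenField_evenCoord]
    exact if_pos rfl
  · rw [Subsingleton.elim k 0, evenField_oddCoord, if_pos rfl, map_smul, pullTop_oddCoord, fst,
      coordMap_oddPull, evenField_oddCoord]
    exact if_pos rfl

theorem oddField_related_fst (a : ℝ) (V : Opens R11.Body) (f : O V) :
    (oddField 0 0 a : SheafEnd (prod R11 R11)).1 (preim (fst R11 R11).base V)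
      ((fst R11 R11).pull V f) = (fst R11 R11).pull V ((D1 a).1 V f) := by
  refine related_of_coord (fst R11 R11) (oddField_mem (d := R11) 0 0 a)
    (oddField_mem (d := prod R11 R11) 0 0 a) (fun k => ?_) (fun k => ?_) V f
  · rw [Subsingleton.elim k 0, oddField_evenCoord, if_pos rfl, map_smul, pullTop_oddCoord, fst,
      coordMap_evenPull, coordMap_oddPull, oddField_evenCoord]
    exact if_pos rfl
  · rw [Subsingleton.elim k 0, oddField_oddCoord, if_pos rfl, map_one, fst,
      coordMap_oddPull, oddField_oddCoord]
    exact if_pos rfl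

theorem evenField_related_snd (b : ℝ) (V : Opens R11.Body) (f : O V) :
    (evenField 0 0 b : SheafEnd (prod R11 R11)).1 (preim (snd R11 R11).base V)
      ((snd R11 R11).pull V f) = 0 := by
  refine (related_of_coord (snd R11 R11) (zero_mem (homVectorFields R11 0))
    (evenField_mem (d := prod R11 R11) 0 0 b) (fun k => ?_) (fun k => ?_) V f).trans
    (map_zero ((snd R11 R11).pull V))
  · rw [Subsingleton.elim k 0, snd, coordMap_evenPull, evenField_evenCoord, zero_app, map_zero]
    exact if_neg (by decide)
  · rw [Subsingleton.elim k 0, snd, coordMap_oddPull, evenField_oddCoord, zero_app, map_zero]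
    exact if_neg (by decide)

theorem oddField_related_snd (a : ℝ) (V : Opens R11.Body) (f : O V) :
    (oddField 0 0 a : SheafEnd (prod R11 R11)).1 (preim (snd R11 R11).base V)
      ((snd R11 R11).pull V f) = 0 := by
  refine (related_of_coord (snd R11 R11) (zero_mem (homVectorFields R11 1))
    (oddField_mem (d := prod R11 R11) 0 0 a) (fun k => ?_) (fun k => ?_) V f).trans
    (map_zero ((snd R11 R11).pull V))
  · rw [Subsingleton.elim k 0, snd, coordMap_evenPull, oddField_evenCoord, zero_app, map_zero]
    exact if_neg (by decide)
  · rw [Subsingleton.elim k 0, snd, coordMap_oddPull, oddField_oddCoord, zero_app, map_zero]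
    exact if_neg (by decide)

theorem combination_mem_vectorFields {d : SuperDomain} {X Y : SheafEnd d}
    (hX : X ∈ homVectorFields d 0) (hY : Y ∈ homVectorFields d 1) (α β : ℝ) :
    α • X + β • Y ∈ vectorFields d :=
  Submodule.add_mem_sup (Submodule.smul_mem _ α hX) (Submodule.smul_mem _ β hY)

theorem isRightInvariant_combination {a b : ℝ} {μ : prod R11 R11 ⟶ₛ R11} (hab : a * b = 0)
    (hμ : IsMu a b μ) (α β : ℝ) : IsRightInvariant μ (α • D0 b + β • D1 a) := by
  refine ⟨combination_mem_vectorFields (evenField_mem 0 0 b) (oddField_mem 0 0 a) α β,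
    α • evenField 0 0 b + β • oddField 0 0 a,
    ⟨combination_mem_vectorFields (evenField_mem 0 0 b) (oddField_mem 0 0 a) α β,
      fun V f => ⟨?_, ?_⟩⟩, fun V f => ?_⟩
  · rw [add_app, smul_app, smul_app, evenField_related_fst, oddField_related_fst, add_app,
      smul_app, smul_app, map_add, map_smul, map_smul]
  · rw [add_app, smul_app, smul_app, evenField_related_snd, oddField_related_snd, smul_zero,
      smul_zero, add_zero]
  · refine Eq.trans ?_ (congrArg₂ (fun x y => α • x + β • y) (evenField_related_mu hab hμ V f)
      (oddField_related_mu hab hμ V f)).symm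
    rw [add_app, smul_app, smul_app, map_add, map_smul, map_smul]

/-! ### Right invariant fields are determined by two real numbers -/

/-- The chain rule for a vector field on `ℝ^{1|1}`. -/
theorem vectorField_tmul_one {Z : SheafEnd R11} (hZ : Z ∈ vectorFields R11) (V : Opens R11.Body)
    (s : Smooth V) : Z.1 V (s ⊗ₜ[ℝ] (1 : Grassmann R11)) =
      Z.1 V (evenCoord V 0) * (evenPartial 0).1 V (s ⊗ₜ[ℝ] (1 : Grassmann R11)) := by
  -- The difference of the two sides obeys the Leibniz rule on `t` and kills `t`. No sign arises for
  -- inhomogeneous `Z`, because `t` is even.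
  refine sub_eq_zero.mp (eq_zero_of_evenCoord (Hom.id R11)
    (fun V => Z.1 V - (LinearMap.mulLeft ℝ (Z.1 V (evenCoord V 0))).comp ((evenPartial 0).1 V))
    ?_ ?_ ?_ V s)
  · intro V W h f
    change Z.1 V (res h f) - Z.1 V (evenCoord V 0) * (evenPartial 0).1 V (res h f) =
      res h (Z.1 W f - Z.1 W (evenCoord W 0) * (evenPartial 0).1 W f)
    rw [app_res, app_res, map_sub, map_mul, ← res_evenCoord h, app_res]
  · intro V
    change Z.1 V 1 - Z.1 V (evenCoord V 0) * (evenPartial 0).1 V 1 = 0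
    rw [vectorFields_one hZ, homVectorFields_one (evenPartial_mem 0), mul_zero, sub_zero]
  · intro V k g
    change Z.1 V (evenCoord V k * g) -
        Z.1 V (evenCoord V 0) * (evenPartial 0).1 V (evenCoord V k * g) =
      evenCoord V k * (Z.1 V g - Z.1 V (evenCoord V 0) * (evenPartial 0).1 V g)
    have hc := commute_of_mem_parity (evenCoord_mem_parity (U := V) 0) (Z.1 V (evenCoord V 0))
    rw [Subsingleton.elim k 0, vectorFields_even_mul hZ (evenCoord_mem_parity 0),
      homVectorFields_even_mul (evenPartial_mem 0) (evenCoord_mem_parity 0),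
      evenPartial_evenCoord, if_pos rfl, one_mul, mul_add, ← mul_assoc, ← hc.eq, mul_assoc,
      add_sub_add_left_eq_sub, mul_sub]

theorem vectorField_expCoord {Z : SheafEnd R11} (hZ : Z ∈ vectorFields R11) (b : ℝ) :
    Z.1 ⊤ (expCoord b 0 ⊤) = b • (Z.1 ⊤ (evenCoord ⊤ 0) * expCoord b 0 ⊤) := by
  refine (vectorField_tmul_one hZ ⊤ _).trans ?_
  rw [← mul_smul_comm]
  exact congrArg (Z.1 ⊤ (evenCoord ⊤ 0) * ·)
    ((evenPartial_expCoord 0 0 b ⊤).trans (if_pos rfl))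

/-- The body is a single point and, without odd coordinates, the Grassmann algebra has nothing in
positive degree. -/
theorem exists_eq_algebraMap (x : O (⊤ : Opens point.Body)) :
    ∃ r : ℝ, x = algebraMap ℝ _ r := by
  refine ⟨bodyAt (topPt 0) x, ext_evalAt fun p => ?_⟩
  have hp : p = topPt 0 := Subtype.ext (Subsingleton.elim _ _)
  subst hp
  have h := ExteriorAlgebra.sub_algebraMapInv_mem (evalAt (topPt 0) x)
  rw [ExteriorAlgebra.degreeGE_eq_bot _ Nat.one_pos, Submodule.mem_bot, sub_eq_zero] at h
  rw [AlgHom.commutes]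
  exact h

theorem toPoint_comp_pullTop {T : SuperDomain} (e : point ⟶ₛ R11) (x : O (⊤ : Opens R11.Body)) :
    ∃ r : ℝ, (toPoint T ⋙ₛ e).pullTop x = algebraMap ℝ _ r := by
  obtain ⟨r, hr⟩ := exists_eq_algebraMap (e.pullTop x)
  exact ⟨r, by rw [comp_pullTop, hr]; exact AlgHom.commutes _ r⟩

/-- The coefficients of a right invariant vector field, pulled back along the multiplication. -/
theorem IsRightInvariant.pullTop_eq {a b : ℝ} {μ : prod R11 R11 ⟶ₛ R11}
    (hμ : IsMu a b μ) {Z : SheafEnd R11} (hZ : IsRightInvariant μ Z) :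
    μ.pullTop (Z.1 ⊤ (evenCoord ⊤ 0)) = (fst R11 R11).pullTop (Z.1 ⊤ (evenCoord ⊤ 0)) +
      a • ((fst R11 R11).pullTop (Z.1 ⊤ (oddCoord ⊤ 0)) * oddCoord ⊤ 1) ∧
    μ.pullTop (Z.1 ⊤ (oddCoord ⊤ 0)) = (fst R11 R11).pullTop (Z.1 ⊤ (oddCoord ⊤ 0)) +
      (fst R11 R11).pullTop (Z.1 ⊤ (expCoord b 0 ⊤)) * oddCoord ⊤ 1 := by
  obtain ⟨-, W, ⟨hW, hWfs⟩, hinv⟩ := hZ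
  obtain ⟨h0, h1⟩ := isMu_iff.mp hμ
  have hfst : ∀ f, W.1 ⊤ ((fst R11 R11).pullTop f) = (fst R11 R11).pullTop (Z.1 ⊤ f) :=
    fun f => (hWfs ⊤ f).1
  have hsnd : ∀ f, W.1 ⊤ ((snd R11 R11).pullTop f) = 0 := fun f => (hWfs ⊤ f).2
  have hmu : ∀ f, μ.pullTop (Z.1 ⊤ f) = W.1 ⊤ (μ.pullTop f) := fun f => hinv ⊤ f
  have hfst0 : (fst R11 R11).pullTop (evenCoord ⊤ 0) = evenCoord ⊤ 0 := coordMap_evenPull _ _ 0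
  have hfst1 : (fst R11 R11).pullTop (oddCoord ⊤ 0) = oddCoord ⊤ 0 := coordMap_oddPull _ _ 0
  have hsnd0 : (snd R11 R11).pullTop (evenCoord ⊤ 0) = evenCoord ⊤ 1 := coordMap_evenPull _ _ 0
  have hsnd1 : (snd R11 R11).pullTop (oddCoord ⊤ 0) = oddCoord ⊤ 1 := coordMap_oddPull _ _ 0
  have hfste : (fst R11 R11).pullTop (expCoord b 0 ⊤) = expCoord b 0 ⊤ :=
    (coordMap_pull_tmul _ _ ⊤ _ _).trans (by rw [map_one]; rfl)
  -- The coordinates of the product are pulled back from the factors, so `W = Z ⊗ id` is known on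
  -- each of them, and likewise on `e^{b t₁}`.
  have hW0 : W.1 ⊤ (evenCoord ⊤ 1) = 0 := by rw [← hsnd0, hsnd]
  have hW1 : W.1 ⊤ (oddCoord ⊤ 1) = 0 := by rw [← hsnd1, hsnd]
  have hWt : W.1 ⊤ (evenCoord ⊤ 0) = (fst R11 R11).pullTop (Z.1 ⊤ (evenCoord ⊤ 0)) := by
    rw [← hfst0, hfst]
  have hWτ : W.1 ⊤ (oddCoord ⊤ 0) = (fst R11 R11).pullTop (Z.1 ⊤ (oddCoord ⊤ 0)) := by
    rw [← hfst1, hfst]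
  have hWe : W.1 ⊤ (expCoord b 0 ⊤) = (fst R11 R11).pullTop (Z.1 ⊤ (expCoord b 0 ⊤)) := by
    rw [← hfste, hfst]
  constructor
  · rw [hmu, pullTop_evenCoord, h0, map_add, map_add, map_smul,
      vectorFields_mul_of_eq_zero hW (oddCoord_mem_parity 0) (oddCoord_mem_parity 1) hW1,
      hW0, add_zero, hWt, hWτ]
  · rw [hmu, pullTop_oddCoord, h1, map_add,
      vectorFields_mul_of_eq_zero hW (expCoord_mem_parity b 0 ⊤) (oddCoord_mem_parity 1) hW1,
      hWτ, hWe]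

set_option maxHeartbeats 1000000 in
-- The formulas for `μ^* (Z t)` and `μ^* (Z τ)` are pulled back along `(u, id)`, with `u` the
-- constant map to the unit. The unit law turns the left sides into `Z t` and `Z τ`; functions of
-- the first factor become constants, `α` and `β` being the values of `Z t` and `Z τ` at the unit.
-- These are the coefficients of `α D₀ + β D₁`.
theorem IsRightInvariant.exists_eq {a b : ℝ} {μ : prod R11 R11 ⟶ₛ R11}
    (hμ : IsMu a b μ) {Z : SheafEnd R11} (hZ : IsRightInvariant μ Z) :
    ∃ α β : ℝ, α • D0 b + β • D1 a = Z := by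
  obtain ⟨hz0, hz1⟩ := hZ.pullTop_eq hμ
  have hZv := hZ.1
  have hsnd1 : (snd R11 R11).pullTop (oddCoord ⊤ 0) = oddCoord ⊤ 1 := coordMap_oddPull _ _ 0
  have h3 : R11.odd ≤ 3 := by decide
  obtain ⟨e, he0, he1⟩ := exists_one
  obtain ⟨hu0, hu1⟩ := toPoint_comp_eq_zero (T := R11) he0 he1
  obtain ⟨α, hα⟩ := toPoint_comp_pullTop (T := R11) e (Z.1 ⊤ (evenCoord ⊤ 0))
  obtain ⟨β, hβ⟩ := toPoint_comp_pullTop (T := R11) e (Z.1 ⊤ (oddCoord ⊤ 0))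
  generalize toPoint R11 ⋙ₛ e = u at *
  have hιμ : pair h3 u (Hom.id R11) ⋙ₛ μ = Hom.id R11 := mulHom_eq_right h3 hμ hu0 hu1 _
  have hι : ∀ f, (pair h3 u (Hom.id R11)).pullTop (μ.pullTop f) = f := fun f => by
    rw [← comp_pullTop, hιμ]; rfl
  have hιf : ∀ f, (pair h3 u (Hom.id R11)).pullTop ((fst R11 R11).pullTop f) = u.pullTop f :=
    fun f => by rw [← comp_pullTop, pair_fst]
  have hι1 : (pair h3 u (Hom.id R11)).pullTop (oddCoord ⊤ 1) = oddCoord ⊤ 0 := by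
    rw [← hsnd1, ← comp_pullTop, pair_snd]; rfl
  -- The chain rule gives `Z e^{bt} = b (Z t) e^{bt}`, which therefore pulls back along `u` to the
  -- constant `b α`.
  have hue : u.pullTop (expCoord b 0 ⊤) = 1 := expPull_eq_one h3 hu0
  have key0 : Z.1 ⊤ (evenCoord ⊤ 0) = algebraMap ℝ _ α + (β * a) • oddCoord ⊤ 0 := by
    have h := congrArg (pair h3 u (Hom.id R11)).pullTop hz0
    rwa [hι, map_add, map_smul, map_mul, hιf, hιf, hι1, hα, hβ, ← Algebra.smul_def, smul_smul,
      mul_comm a β] at h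
  have key1 : Z.1 ⊤ (oddCoord ⊤ 0) = algebraMap ℝ _ β + (α * b) • oddCoord ⊤ 0 := by
    have h := congrArg (pair h3 u (Hom.id R11)).pullTop hz1
    rwa [hι, map_add, map_mul, hιf, hιf, hι1, vectorField_expCoord hZv, map_smul, map_mul, hα, hβ,
      hue, mul_one, smul_mul_assoc, ← Algebra.smul_def, smul_smul, mul_comm b α] at h
  refine ⟨α, β, vectorField_ext (combination_mem_vectorFields
    (evenField_mem 0 0 b) (oddField_mem 0 0 a) α β) hZv (fun k => ?_) fun k => ?_⟩
  · rw [Subsingleton.elim k 0]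
    exact (combination_evenCoord a b α β).trans key0.symm
  · rw [Subsingleton.elim k 0]
    exact (combination_oddCoord a b α β).trans key1.symm

end SuperDomain

theorem mainTheorem6 (a b : ℝ) (hab : a * b = 0) :
    ∃ μ : SuperDomain.prod SuperDomain.R11 SuperDomain.R11 ⟶ₛ SuperDomain.R11,
      (SuperDomain.IsMu a b μ ∧ ∀ μ', SuperDomain.IsMu a b μ' → μ' = μ) ∧
      (∃! S : SuperDomain.LieSupergroup SuperDomain.R11, S.mul = μ) ∧
      (SuperDomain.D0 b ∈ SuperDomain.homVectorFields SuperDomain.R11 0 ∧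
        SuperDomain.D1 a ∈ SuperDomain.homVectorFields SuperDomain.R11 1 ∧
        LinearIndependent ℝ ![SuperDomain.D0 b, SuperDomain.D1 a] ∧
        ∀ Z : SuperDomain.SheafEnd SuperDomain.R11, SuperDomain.IsRightInvariant μ Z ↔
          Z ∈ Submodule.span ℝ {SuperDomain.D0 b, SuperDomain.D1 a}) ∧
      SuperDomain.superBracket 0 0 (SuperDomain.D0 b) (SuperDomain.D0 b) = 0 ∧
      SuperDomain.superBracket 0 1 (SuperDomain.D0 b) (SuperDomain.D1 a) =
        (-b) • SuperDomain.D1 a ∧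
      SuperDomain.superBracket 1 1 (SuperDomain.D1 a) (SuperDomain.D1 a) =
        (2 * a) • SuperDomain.D0 b := by
  obtain ⟨μ, hμ⟩ := SuperDomain.exists_isMu a b
  refine ⟨μ, ⟨hμ, fun ν hν => hμ.unique hν⟩, SuperDomain.existsUnique_lieSupergroup hab hμ,
    ⟨SuperDomain.evenField_mem 0 0 b, SuperDomain.oddField_mem 0 0 a,
      SuperDomain.linearIndependent_D0_D1 a b, fun Z => ?_⟩, SuperDomain.superBracket_D0_D0 b,
    SuperDomain.superBracket_D0_D1 hab, SuperDomain.superBracket_D1_D1 hab⟩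
  rw [Submodule.mem_span_pair]
  refine ⟨fun hZ => hZ.exists_eq hμ, ?_⟩
  rintro ⟨α, β, rfl⟩
  exact SuperDomain.isRightInvariant_combination hab hμ α β

end
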